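/- Let $q\in\mathbb C^\ast$ with $|q|=1$, $q$ not a root of unity. Write $(a;q)_n=\prod_{k=0}^{n-1}(1-q^ka)$ and assume that the power series $\sum_{n\ge 0}\frac{x^n}{(q;q)_n}$ converges (i.e. has positive radius of convergence). Let $K=\mathbb C(\{x\})$ be the field of germs at $0$ of meromorphic functions and $\widehat K=\mathbb C((x))$, both with the automorphism $\sigma_q\colon f(x)\mapsto f(qx)$. A $q$-difference module over $K$ (resp. $\widehat K$) is a finite-dimensional vector space $M$ over that field with a bijective additive map $\Sigma_q\colon M\to M$ such that $\Sigma_q(fm)=\sigma_q(f)\Sigma_q(m)$; morphisms are linear maps over that field commuting with the operators $\Sigma_q$. Let $\mathcal B_q$ be the category of $q$-difference modules over $K$. Let $\mathcal B_q^{iso}$ be the full subcategory of $\mathcal B_q$ of those $M$ such that every $N$ in $\mathcal B_q$ for which $N\otimes_K\widehat K$ and $M\otimes_K\widehat K$ are isomorphic as $q$-difference modules over $\widehat K$ is already isomorphic to $M$ in $\mathcal B_q$. The Newton polygon of an operator $\mathcal L=\sum_{i=0}^\nu a_i(x)\sigma_q^i$ with $a_i\in\mathbb C\{x\}$, $a_\nu\ne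 0$, is the convex hull of $\{(i,k): a_i\neq 0,\ k\ge \mathrm{ord}_x a_i\}\subset\mathbb R^2$, and its slopes are those of the non-vertical sides of its boundary. A module $M$ in $\mathcal B_q$ is pure of slope zero if there is an operator $\mathcal L$ of order $\nu=\dim_K M$ whose Newton polygon has no slope other than $0$ and for which $M\cong K[\sigma_q,\sigma_q^{-1}]/K[\sigma_q,\sigma_q^{-1}]\mathcal L$, i.e. there is $m\in M$ such that $m,\Sigma_qm,\dots,\Sigma_q^{\nu-1}m$ is a $K$-basis of $M$ and $\sum_i a_i\Sigma_q^i m=0$ (the zero module is included). Let $\mathcal B_q^{iso,f}$ be the full subcategory of $\mathcal B_q^{iso}$ of the modules that are pure of slope zero. Then $\mathcal B_q^{iso,f}$ is equivalent to the following category. Its objects are the finite-dimensional $\mathbb C^\ast/q^{\mathbb Z}$-graded complex vector spaces $V$ endowed with a nilpotent linear operator preserving the grading, that have the property $(\mathcal D)$ for every set $\lambda_1,\dots,\lambda_n\in\mathbb C^\ast$ of representatives (one for each class) of the classes of $\mathbb C^\ast/q^{\mathbb Z}$ corresponding to the nonzero homogeneous components of $V$, the power series $$\phi_{(q;\underline\Lambda)}(x)=\sum_{m\ge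 0}\frac{x^m}{\prod_{\lambda\in\underline\Lambda}(\lambda;q)_m},\qquad \underline\Lambda=\{\lambda_i\lambda_j^{-1} : i,j=1,\dots,n;\ \lambda_i\lambda_j^{-1}\notin q^{\mathbb Z_{\le 0}}\},$$ has a positive radius of convergence. Its morphisms are the $\mathbb C$-linear maps that preserve the grading and commute with the nilpotent operators. -/

import Mathlib

universe u

open CategoryTheory
open scoped TensorProduct

noncomputable section

namespace QDifference

/-! ## Convergent series, germs of meromorphic functions, the operator `σ_q` -/

/-- The power series `∑ c n * x ^ n` has a positive radius of convergence. -/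
def Converges (c : ℕ → ℂ) : Prop :=
  ∃ r : ℝ, 0 < r ∧ Summable fun n => ‖c n‖ * r ^ n

theorem converges_iff_bound {c : ℕ → ℂ} :
    Converges c ↔ ∃ A B : ℝ, 0 ≤ A ∧ 0 < B ∧ ∀ n, ‖c n‖ ≤ A * B ^ n := by
  constructor
  · rintro ⟨r, hr, hs⟩
    refine ⟨∑' n, ‖c n‖ * r ^ n, r⁻¹, tsum_nonneg fun n => by positivity, by positivity,
      fun n => ?_⟩
    have h := hs.le_tsum n (fun j _ => by positivity)
    rw [inv_pow, ← div_eq_mul_inv, le_div_iff₀ (by positivity)]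
    exact h
  · rintro ⟨A, B, hA, hB, h⟩
    refine ⟨(2 * B)⁻¹, by positivity, ?_⟩
    refine Summable.of_nonneg_of_le (fun n => by positivity) (fun n => ?_)
      (summable_geometric_two.mul_left A)
    calc ‖c n‖ * (2 * B)⁻¹ ^ n ≤ (A * B ^ n) * (2 * B)⁻¹ ^ n := by
          gcongr; exact h n
      _ = A * (1 / 2) ^ n := by
          rw [mul_assoc, ← mul_pow]; congr 2; field_simp

theorem converges_succ {c : ℕ → ℂ} : Converges (fun n => c (n + 1)) ↔ Converges c := by
  have key : ∀ r : ℝ, 0 < r →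
      ((Summable fun n => ‖c (n + 1)‖ * r ^ n) ↔ Summable fun n => ‖c n‖ * r ^ n) := by
    intro r hr
    rw [← summable_nat_add_iff (f := fun n => ‖c n‖ * r ^ n) 1,
      ← summable_mul_right_iff (f := fun n => ‖c (n + 1)‖ * r ^ n) hr.ne']
    simp only [pow_succ, mul_assoc]
  exact exists_congr fun r => and_congr_right fun hr => key r hr

theorem converges_shift (c : ℤ → ℂ) (k : ℤ) :
    Converges (fun n : ℕ => c (n + k)) ↔ Converges (fun n : ℕ => c n) := by
  have step : ∀ k : ℤ,
      (Converges (fun n : ℕ => c (n + (k + 1))) ↔ Converges (fun n : ℕ => c (n + k))) := by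
    intro k
    rw [← converges_succ (c := fun n : ℕ => c (n + k))]
    have : (fun n : ℕ => c (n + (k + 1))) = fun n : ℕ => c (((n + 1 : ℕ) : ℤ) + k) := by
      funext n; congr 1; push_cast; ring
    rw [this]
  induction k using Int.induction_on with
  | zero => simp
  | succ i ih => exact (step i).trans ih
  | pred i ih =>
    have h := step (-i - 1)
    rw [sub_add_cancel] at h
    exact h.symm.trans ih

theorem Converges.add {c d : ℕ → ℂ} (hc : Converges c) (hd : Converges d) :
    Converges fun n => c n + d n := by
  rw [converges_iff_bound] at *
  obtain ⟨A, B, hA, hB, h⟩ := hc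
  obtain ⟨A', B', hA', hB', h'⟩ := hd
  refine ⟨A + A', max B B', by positivity, by positivity, fun n => ?_⟩
  calc ‖c n + d n‖ ≤ A * B ^ n + A' * B' ^ n := (norm_add_le _ _).trans (add_le_add (h n) (h' n))
    _ ≤ A * (max B B') ^ n + A' * (max B B') ^ n := by
        gcongr
        · exact le_max_left _ _
        · exact le_max_right _ _
    _ = (A + A') * (max B B') ^ n := by ring

theorem Converges.mul {f g : PowerSeries ℂ} (hf : Converges fun n => PowerSeries.coeff n f)
    (hg : Converges fun n => PowerSeries.coeff n g) :
    Converges fun n => PowerSeries.coeff n (f * g) := by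
  rw [converges_iff_bound] at *
  obtain ⟨A, B, hA, hB, h⟩ := hf
  obtain ⟨A', B', hA', hB', h'⟩ := hg
  refine ⟨A * A', 2 * max B B', by positivity, by positivity, fun n => ?_⟩
  rw [PowerSeries.coeff_mul]
  calc ‖∑ p ∈ Finset.HasAntidiagonal.antidiagonal n, PowerSeries.coeff p.1 f * PowerSeries.coeff p.2 g‖
      ≤ ∑ p ∈ Finset.HasAntidiagonal.antidiagonal n, A * A' * (max B B') ^ n := by
        refine (norm_sum_le _ _).trans (Finset.sum_le_sum fun p hp => ?_)
        rw [norm_mul]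
        calc _ ≤ (A * B ^ p.1) * (A' * B' ^ p.2) := by
              gcongr
              · exact h _
              · exact h' _
          _ ≤ (A * (max B B') ^ p.1) * (A' * (max B B') ^ p.2) := by
              gcongr
              · exact le_max_left _ _
              · exact le_max_right _ _
          _ = A * A' * (max B B') ^ n := by
              rw [← Finset.HasAntidiagonal.mem_antidiagonal.mp hp, pow_add]; ring
    _ = (n + 1) * (A * A' * (max B B') ^ n) := by simp
    _ ≤ 2 ^ n * (A * A' * (max B B') ^ n) := by
        gcongr
        exact_mod_cast Nat.lt_two_pow_self (n := n)
    _ = A * A' * (2 * max B B') ^ n := by rw [mul_pow]; ring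

theorem Converges.inv {f : PowerSeries ℂ} (hf : Converges fun n => PowerSeries.coeff n f) :
    Converges fun n => PowerSeries.coeff n f⁻¹ := by
  rw [converges_iff_bound] at *
  obtain ⟨A, B, hA, hB, h⟩ := hf
  set a : ℝ := ‖(PowerSeries.constantCoeff f)⁻¹‖ with ha
  have ha0 : 0 ≤ a := norm_nonneg _
  refine ⟨a, B * (1 + a * A), ha0, by positivity, fun n => ?_⟩
  induction n using Nat.strong_induction_on with
  | _ n ih =>
    rw [PowerSeries.coeff_inv]
    split_ifs with hn
    · subst hn; simp [ha]
    · rw [norm_mul, norm_neg]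
      refine mul_le_mul_of_nonneg_left ?_ ha0
      have hsum : ∀ m : ℕ, ∑ k ∈ Finset.range m, (a * A) * (1 + a * A) ^ k = (1 + a * A) ^ m - 1 := by
        intro m
        rw [← Finset.mul_sum, mul_comm]
        simpa using geom_sum_mul (1 + a * A) m
      calc _ ≤ ∑ p ∈ Finset.HasAntidiagonal.antidiagonal n,
              (if p.2 < n then B ^ n * ((a * A) * (1 + a * A) ^ p.2) else 0) := by
            refine (norm_sum_le _ _).trans (Finset.sum_le_sum fun p hp => ?_)
            split_ifs with hlt
            · rw [norm_mul]
              calc _ ≤ (A * B ^ p.1) * (a * (B * (1 + a * A)) ^ p.2) := by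
                    gcongr
                    · exact h _
                    · exact ih _ hlt
                _ = _ := by
                    rw [← Finset.HasAntidiagonal.mem_antidiagonal.mp hp, pow_add, mul_pow]; ring
            · simp
        _ = ∑ k ∈ Finset.range n, B ^ n * ((a * A) * (1 + a * A) ^ k) := by
            rw [Finset.Nat.sum_antidiagonal_eq_sum_range_succ_mk, Finset.sum_range_succ',
              ← Finset.sum_range_reflect (fun k => B ^ n * ((a * A) * (1 + a * A) ^ k))]
            simp only [Nat.sub_zero, lt_irrefl, if_false, add_zero]
            refine Finset.sum_congr rfl fun k hk => ?_
            have := Finset.mem_range.mp hk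
            rw [if_pos (by omega), show n - (k + 1) = n - 1 - k by omega]
        _ = B ^ n * ((1 + a * A) ^ n - 1) := by rw [← Finset.mul_sum, hsum]
        _ ≤ (B * (1 + a * A)) ^ n := by
            rw [mul_pow]
            have : 0 ≤ B ^ n := by positivity
            nlinarith

theorem coeff_single_one_mul (k n : ℤ) (f : LaurentSeries ℂ) :
    (HahnSeries.single k (1 : ℂ) * f).coeff n = f.coeff (n - k) := by
  have := HahnSeries.coeff_single_mul_add (r := (1 : ℂ)) (x := f) (a := n - k) (b := k)
  rwa [sub_add_cancel, one_mul] at this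

theorem converges_single_mul (k : ℤ) (f : LaurentSeries ℂ) :
    Converges (fun n : ℕ => (HahnSeries.single k (1 : ℂ) * f).coeff n) ↔
      Converges (fun n : ℕ => f.coeff n) := by
  simp only [coeff_single_one_mul, sub_eq_add_neg]
  exact converges_shift f.coeff (-k)

theorem converges_powerSeriesPart (f : LaurentSeries ℂ) :
    Converges (fun n => PowerSeries.coeff n f.powerSeriesPart) ↔
      Converges (fun n : ℕ => f.coeff n) := by
  simp only [LaurentSeries.powerSeriesPart_coeff, add_comm f.order]
  exact converges_shift f.coeff _

/-- `K = ℂ({x})`, the field of germs at `0` of meromorphic functions, as a subfield of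
`ℂ((x))`: the Laurent series with finite polar part that converge in a punctured
neighbourhood of `0`. -/
def meroGerms : Subfield (LaurentSeries ℂ) where
  carrier := {f | Converges fun n : ℕ => f.coeff n}
  mul_mem' {f g} hf hg := by
    have e : f * g = HahnSeries.single (f.order + g.order) (1 : ℂ) *
        ((f.powerSeriesPart * g.powerSeriesPart : PowerSeries ℂ) : LaurentSeries ℂ) := by
      conv_lhs => rw [← f.single_order_mul_powerSeriesPart, ← g.single_order_mul_powerSeriesPart]
      rw [map_mul, mul_mul_mul_comm, HahnSeries.single_mul_single, one_mul]
    change Converges _ at hf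
    change Converges _ at hg
    change Converges _
    rw [e, converges_single_mul]
    simp only [LaurentSeries.coeff_coe_powerSeries]
    exact Converges.mul ((converges_powerSeriesPart f).2 hf) ((converges_powerSeriesPart g).2 hg)
  one_mem' := by
    refine ⟨1, one_pos, summable_of_ne_finset_zero (s := {0}) fun n hn => ?_⟩
    have hn' : n ≠ 0 := by simpa using hn
    simp [HahnSeries.coeff_one, hn']
  add_mem' {f g} hf hg := Converges.add hf hg
  zero_mem' := ⟨1, one_pos, by simp⟩
  neg_mem' {f} hf := by
    change Converges _
    simpa [Converges] using hf
  inv_mem' f hf := by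
    rcases eq_or_ne f 0 with rfl | h0
    · simpa using hf
    have hc : PowerSeries.constantCoeff f.powerSeriesPart ≠ 0 := by
      rw [← PowerSeries.coeff_zero_eq_constantCoeff_apply, LaurentSeries.powerSeriesPart_coeff]
      simpa using (HahnSeries.coeff_order_eq_zero (x := f)).not.2 h0
    have e : f⁻¹ = HahnSeries.single (-f.order) (1 : ℂ) *
        ((f.powerSeriesPart⁻¹ : PowerSeries ℂ) : LaurentSeries ℂ) := by
      refine inv_eq_of_mul_eq_one_right ?_
      have e' := f.single_order_mul_powerSeriesPart
      calc _ = (HahnSeries.single f.order (1 : ℂ) * (f.powerSeriesPart : LaurentSeries ℂ)) *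
            (HahnSeries.single (-f.order) (1 : ℂ) *
              ((f.powerSeriesPart⁻¹ : PowerSeries ℂ) : LaurentSeries ℂ)) := by rw [e']
        _ = 1 := ?_
      rw [mul_mul_mul_comm, HahnSeries.single_mul_single, ← map_mul,
        PowerSeries.mul_inv_cancel _ hc]
      simp
    change Converges _ at hf
    change Converges _
    rw [e, converges_single_mul]
    simp only [LaurentSeries.coeff_coe_powerSeries]
    exact Converges.inv ((converges_powerSeriesPart f).2 hf)

/-- `f(x) ↦ f(qx)` on Laurent series. -/
def dilate (q : ℂˣ) (f : LaurentSeries ℂ) : LaurentSeries ℂ where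
  coeff n := (q : ℂ) ^ n * f.coeff n
  isPWO_support' := f.isPWO_support.mono fun n hn => by
    simp only [Function.mem_support] at hn
    exact right_ne_zero_of_mul hn

theorem dilate_dilate (q p : ℂˣ) (h : q * p = 1) (f : LaurentSeries ℂ) :
    dilate q (dilate p f) = f := by
  ext n
  have : (q : ℂ) ^ n * (p : ℂ) ^ n = 1 := by
    rw [← mul_zpow, ← Units.val_mul, h]; simp
  simp [dilate, ← mul_assoc, this]

theorem support_dilate (q : ℂˣ) (f : LaurentSeries ℂ) : (dilate q f).support = f.support := by
  ext n
  simp [dilate, zpow_ne_zero n q.ne_zero]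

theorem dilate_mul (q : ℂˣ) (f g : LaurentSeries ℂ) :
    dilate q (f * g) = dilate q f * dilate q g := by
  ext n
  rw [HahnSeries.coeff_mul_left' f.isPWO_support (support_dilate q f).le]
  change (q : ℂ) ^ n * (f * g).coeff n = _
  rw [HahnSeries.coeff_mul_right' (x := f) (y := g) (s := (dilate q g).support)
    (dilate q g).isPWO_support (support_dilate q g).ge, Finset.mul_sum]
  refine Finset.sum_congr rfl fun p hp => ?_
  have hp' : p.1 + p.2 = n := (Finset.mem_antidiagonal.mp hp).2.2
  simp only [dilate, ← hp', zpow_add₀ q.ne_zero]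
  ring

/-- The automorphism `σ_q : f(x) ↦ f(qx)` of `ℂ((x))`. -/
def sigmaHat (q : ℂˣ) : LaurentSeries ℂ ≃+* LaurentSeries ℂ where
  toFun := dilate q
  invFun := dilate q⁻¹
  left_inv := dilate_dilate _ _ (by simp)
  right_inv := dilate_dilate _ _ (by simp)
  map_mul' := dilate_mul q
  map_add' f g := by ext n; simp [dilate, mul_add]

theorem dilate_mem (q : ℂˣ) {f : LaurentSeries ℂ} (hf : f ∈ meroGerms) :
    dilate q f ∈ meroGerms := by
  obtain ⟨r, hr, hs⟩ := hf
  have hq : 0 < ‖(q : ℂ)‖ := norm_pos_iff.2 q.ne_zero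
  refine ⟨r / ‖(q : ℂ)‖, by positivity, hs.congr fun n => ?_⟩
  simp only [dilate, zpow_natCast, norm_mul, norm_pow, div_pow]
  field_simp

/-- The automorphism `σ_q : f(x) ↦ f(qx)` of `K = ℂ({x})`. -/
def sigma (q : ℂˣ) : meroGerms ≃+* meroGerms where
  toFun f := ⟨dilate q f.1, dilate_mem q f.2⟩
  invFun f := ⟨dilate q⁻¹ f.1, dilate_mem q⁻¹ f.2⟩
  left_inv f := Subtype.ext (dilate_dilate _ _ (by simp) f.1)
  right_inv f := Subtype.ext (dilate_dilate _ _ (by simp) f.1)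
  map_mul' f g := Subtype.ext (dilate_mul q f.1 g.1)
  map_add' f g := Subtype.ext ((sigmaHat q).map_add f.1 g.1)

/-! ## `q`-difference modules -/

/-- A difference module over a field `F` with automorphism `σ`: a finite-dimensional
`F`-vector space with a `σ`-linear bijective endomorphism. -/
structure DiffModule (F : Type) [Field F] (σ : F ≃+* F) where
  carrier : Type u
  [addCommGroup : AddCommGroup carrier]
  [module : Module F carrier]
  [finite : FiniteDimensional F carrier]
  Sig : carrier ≃+ carrier
  Sig_smul : ∀ (f : F) (m : carrier), Sig (f • m) = σ f • Sig m

attribute [instance] DiffModule.addCommGroup DiffModule.module DiffModule.finite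

namespace DiffModule

variable {F : Type} [Field F] {σ : F ≃+* F}

/-- Morphisms: `F`-linear maps commuting with the semilinear operators. -/
@[ext]
structure Hom (M N : DiffModule.{u} F σ) where
  toLin : M.carrier →ₗ[F] N.carrier
  comm : ∀ m, toLin (M.Sig m) = N.Sig (toLin m)

instance : Category (DiffModule.{u} F σ) where
  Hom := Hom
  id M := ⟨LinearMap.id, fun _ => rfl⟩
  comp f g := ⟨g.toLin.comp f.toLin, fun m => by simp [f.comm, g.comm]⟩

variable {G : Type} [Field G] [Algebra F G] {τ : G ≃+* G}

/-- The additive map `τ ⊗ S` on `G ⊗ M`. -/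
def tensorAux {V : Type u} [AddCommGroup V] [Module F V] (σ : F ≃+* F) (τ : G ≃+* G)
    (h : ∀ f, τ (algebraMap F G f) = algebraMap F G (σ f)) (S : V ≃+ V)
    (hS : ∀ (f : F) (v : V), S (f • v) = σ f • S v) : G ⊗[F] V →+ G ⊗[F] V :=
  TensorProduct.liftAddHom
    { toFun := fun g =>
        { toFun := fun v => τ g ⊗ₜ[F] S v
          map_zero' := by simp
          map_add' := fun v w => by simp [TensorProduct.tmul_add] }
      map_zero' := by ext v; simp
      map_add' := fun g g' => by ext v; simp [TensorProduct.add_tmul] }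
    (fun f g v => by
      simp only [AddMonoidHom.coe_mk, ZeroHom.coe_mk, hS, TensorProduct.tmul_smul,
        Algebra.smul_def, map_mul, h]
      rw [← Algebra.smul_def, TensorProduct.smul_tmul'])

theorem tensorAux_tensorAux {V : Type u} [AddCommGroup V] [Module F V] {σ σ' : F ≃+* F}
    {τ τ' : G ≃+* G} (h : ∀ f, τ (algebraMap F G f) = algebraMap F G (σ f))
    (h' : ∀ f, τ' (algebraMap F G f) = algebraMap F G (σ' f)) {S S' : V ≃+ V}
    (hS : ∀ (f : F) (v : V), S (f • v) = σ f • S v)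
    (hS' : ∀ (f : F) (v : V), S' (f • v) = σ' f • S' v)
    (hτ : ∀ g, τ (τ' g) = g) (hSS : ∀ v, S (S' v) = v) (t : G ⊗[F] V) :
    tensorAux σ τ h S hS (tensorAux σ' τ' h' S' hS' t) = t := by
  induction t using TensorProduct.induction_on with
  | zero => simp
  | tmul g v =>
    change τ (τ' g) ⊗ₜ[F] S (S' v) = _
    rw [hτ, hSS]
  | add x y hx hy => rw [map_add, map_add, hx, hy]

theorem symm_compat (h : ∀ f, τ (algebraMap F G f) = algebraMap F G (σ f)) (f : F) :
    τ.symm (algebraMap F G f) = algebraMap F G (σ.symm f) := by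
  rw [RingEquiv.symm_apply_eq, h, RingEquiv.apply_symm_apply]

theorem symm_smul (M : DiffModule.{u} F σ) (f : F) (m : M.carrier) :
    M.Sig.symm (f • m) = σ.symm f • M.Sig.symm m := by
  rw [AddEquiv.symm_apply_eq, M.Sig_smul]; simp

/-- Extension of scalars `(G ⊗ M, τ ⊗ Σ)` along an extension `G/F` of difference fields. -/
def baseChange (h : ∀ f, τ (algebraMap F G f) = algebraMap F G (σ f))
    (M : DiffModule.{u} F σ) : DiffModule.{u} G τ where
  carrier := G ⊗[F] M.carrier
  Sig :=
    { tensorAux σ τ h M.Sig M.Sig_smul with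
      invFun := tensorAux σ.symm τ.symm (symm_compat h) M.Sig.symm M.symm_smul
      left_inv := tensorAux_tensorAux (symm_compat h) h M.symm_smul M.Sig_smul
        (by simp) (by simp)
      right_inv := tensorAux_tensorAux h (symm_compat h) M.Sig_smul M.symm_smul
        (by simp) (by simp) }
  Sig_smul g t := by
    change tensorAux σ τ h M.Sig M.Sig_smul (g • t) = τ g • tensorAux σ τ h M.Sig M.Sig_smul t
    induction t using TensorProduct.induction_on with
    | zero => simp
    | tmul g' v =>
      change τ (g * g') ⊗ₜ[F] M.Sig v = τ g • (τ g' ⊗ₜ[F] M.Sig v)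
      rw [map_mul, TensorProduct.smul_tmul', smul_eq_mul]
    | add x y hx hy => rw [smul_add, map_add, map_add, hx, hy, smul_add]

end DiffModule

/-- The category `B_q` of `q`-difference modules over `K = ℂ({x})`. -/
abbrev Bq (q : ℂˣ) := DiffModule.{u} meroGerms (sigma q)

/-- The category of `q`-difference modules over `ℂ((x))`. -/
abbrev BqHat (q : ℂˣ) := DiffModule.{u} (LaurentSeries ℂ) (sigmaHat q)

/-- The extension of scalars of an object from `ℂ({x})` to `ℂ((x))`. -/
def formalization {q : ℂˣ} (M : Bq.{u} q) : BqHat.{u} q :=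
  M.baseChange (τ := sigmaHat q) fun _ => rfl

/-- The objects of `B_q^iso`: every `N` in `B_q` that is formally isomorphic to `M` is
analytically isomorphic to `M`. -/
def InIso (q : ℂˣ) : ObjectProperty (Bq.{u} q) := fun M =>
  ∀ N : Bq.{u} q, Nonempty (formalization N ≅ formalization M) → Nonempty (N ≅ M)

/-! ## Newton polygons and slopes -/

/-- A `q`-difference operator `∑ i ≤ ν, a_i(x) σ_q ^ i` with coefficients germs of
holomorphic functions at `0` and `a_ν ≠ 0`. -/
structure DiffOperator where
  ν : ℕ
  coeff : Fin (ν + 1) → meroGerms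
  holomorphic : ∀ i, ∀ n : ℤ, n < 0 → (coeff i : LaurentSeries ℂ).coeff n = 0
  lead_ne_zero : coeff (Fin.last ν) ≠ 0

namespace DiffOperator

/-- The Newton polygon: the convex hull of `{(i, k) : a_i ≠ 0, k ≥ ord_x a_i}`. -/
def newtonPolygon (L : DiffOperator) : Set (ℝ × ℝ) :=
  convexHull ℝ {p | ∃ i : Fin (L.ν + 1), L.coeff i ≠ 0 ∧ p.1 = (i : ℕ) ∧
    (((L.coeff i : LaurentSeries ℂ).order : ℤ) : ℝ) ≤ p.2}

/-- `μ` is a finite slope of the Newton polygon: some supporting line of slope `μ` from below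
meets the polygon in a segment that is not a point. -/
def IsSlope (L : DiffOperator) (μ : ℝ) : Prop :=
  ∃ c : ℝ, (∀ p ∈ L.newtonPolygon, μ * p.1 + c ≤ p.2) ∧
    ∃ p ∈ L.newtonPolygon, ∃ p' ∈ L.newtonPolygon, p ≠ p' ∧
      p.2 = μ * p.1 + c ∧ p'.2 = μ * p'.1 + c

/-- The operator has no finite slope other than `μ`. (An operator of positive order with
`a_0 ≠ 0` has at least one finite slope; an operator of order `0` has none.) -/
def IsPure (L : DiffOperator) (μ : ℝ) : Prop := ∀ μ', L.IsSlope μ' → μ' = μ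

/-- `M` is the `q`-difference module associated with `L`, that is
`M ≅ K[σ_q, σ_q⁻¹] / K[σ_q, σ_q⁻¹] L` with `ν = dim M`: there is a cyclic vector `m`
(`m, Σ m, …, Σ^(ν-1) m` is a basis of `M`) killed by `L`. -/
def IsAssociated {q : ℂˣ} (L : DiffOperator) (M : Bq.{u} q) : Prop :=
  ∃ m : M.carrier,
    LinearIndependent meroGerms (fun i : Fin L.ν => M.Sig^[i] m) ∧
    Submodule.span meroGerms (Set.range fun i : Fin L.ν => M.Sig^[i] m) = ⊤ ∧
    ∑ i : Fin (L.ν + 1), L.coeff i • M.Sig^[i] m = 0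

end DiffOperator

/-- A `q`-difference module that is pure of slope `μ` (the zero module included). -/
def IsPureOfSlope (q : ℂˣ) (μ : ℝ) : ObjectProperty (Bq.{u} q) := fun M =>
  ∃ L : DiffOperator, L.IsAssociated M ∧ L.IsPure μ

/-- The category `B_q^{iso,f}`: the full subcategory of `B_q` of the objects of `B_q^iso`
that are pure of slope zero. -/
abbrev BqIsoF (q : ℂˣ) :=
  ObjectProperty.FullSubcategory fun M : Bq.{u} q => InIso q M ∧ IsPureOfSlope q 0 M

/-! ## Graded vector spaces with a nilpotent operator -/

/-- The group `ℂ* / q^ℤ`. -/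
abbrev CModQ (q : ℂˣ) := ℂˣ ⧸ Subgroup.zpowers q

open Classical in
/-- A finite-dimensional `ℂ* / q^ℤ`-graded complex vector space with a nilpotent operator that
preserves the grading. -/
structure GrNil (q : ℂˣ) where
  carrier : Type u
  [addCommGroup : AddCommGroup carrier]
  [module : Module ℂ carrier]
  [finite : FiniteDimensional ℂ carrier]
  comp : CModQ q → Submodule ℂ carrier
  isInternal : DirectSum.IsInternal comp
  nil : carrier →ₗ[ℂ] carrier
  isNilpotent : IsNilpotent nil
  nil_mem : ∀ c, ∀ v ∈ comp c, nil v ∈ comp c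

attribute [instance] GrNil.addCommGroup GrNil.module GrNil.finite

namespace GrNil

variable {q : ℂˣ}

/-- Morphisms: linear maps preserving the grading and commuting with the operators. -/
@[ext]
structure Hom (V W : GrNil.{u} q) where
  toLin : V.carrier →ₗ[ℂ] W.carrier
  map_comp : ∀ c, ∀ v ∈ V.comp c, toLin v ∈ W.comp c
  comm : ∀ v, toLin (V.nil v) = W.nil (toLin v)

instance : Category (GrNil.{u} q) where
  Hom := Hom
  id V := ⟨LinearMap.id, fun _ _ h => h, fun _ => rfl⟩
  comp f g := ⟨g.toLin.comp f.toLin, fun c v h => g.map_comp c _ (f.map_comp c v h),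
    fun v => by simp [f.comm, g.comm]⟩

end GrNil

/-- The `q`-Pochhammer symbol `(a;q)_n = (1 - a)(1 - q a) ⋯ (1 - q^(n-1) a)`. -/
def qPoch (a q : ℂ) (n : ℕ) : ℂ := ∏ k ∈ Finset.range n, (1 - q ^ k * a)

/-- The coefficients of `φ_{(q;Λ)}(x) = ∑ x^n / ∏_{l ∈ Λ} (l;q)_n`. -/
def phiCoeff (q : ℂˣ) (Λ : Finset ℂˣ) (n : ℕ) : ℂ := (∏ l ∈ Λ, qPoch l q n)⁻¹

open Classical in
/-- The set of the ratios `λ_i / λ_j` of elements of `S` that are not in `q^{ℤ_{≤ 0}}`. -/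
def ratios (q : ℂˣ) (S : Finset ℂˣ) : Finset ℂˣ :=
  ((S ×ˢ S).image fun p => p.1 * p.2⁻¹).filter fun l => ∀ k : ℤ, k ≤ 0 → l ≠ q ^ k

/-- Condition `(D)`: for every set of representatives of the classes of the nonzero homogeneous
components of `V`, the series `φ_{(q;Λ)}` converges. -/
def ConditionD (q : ℂˣ) : ObjectProperty (GrNil.{u} q) := fun V =>
  ∀ S : Finset ℂˣ, Set.BijOn (fun l : ℂˣ => (l : CModQ q)) S {c | V.comp c ≠ ⊥} →
    Converges (phiCoeff q (ratios q S))

/-- The category of finite-dimensional `ℂ* / q^ℤ`-graded complex vector spaces with a nilpotent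
operator preserving the grading that satisfy `(D)`. -/
abbrev GrNilD (q : ℂˣ) := ObjectProperty.FullSubcategory (ConditionD.{u} q)

end QDifference

end

/-!
A graded space with nilpotent operator `N` is sent to the constant-coefficient module `K ⊗ V`
whose operator is `λ (1 + N)` on the component of the class of `λ`. For two representatives
`λ`, `μ` the equality `q ^ k * λ = μ` forces `k = 0`, so comparing coefficients shows that every
morphism between formalizations of such modules is constant: the functor is fully faithful.

The coefficients of a formal isomorphism from such a module to an analytic one satisfy a recursion
that divides by `q ^ k * λ - μ` for eigenvalues `λ`, `μ`; condition `(D)` bounds the products of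
these small divisors, so the isomorphism converges. Conversely, if `E` has rank one and
`A E = z E`, `E A = w E`, then `1 + f E` with `z f(qx) = w f(x) + z / (1 - qx)` carries `A` to an
analytic module. In `B_q^iso` such an `f` must converge, which bounds the single divisors
`q ^ n * z / w - 1`, and the convergence of the `q`-exponential turns this into a bound on their
products.

A module that is pure of slope zero has a basis in which its operator and the inverse are both
holomorphic, so its matrix is invertible at `0` and formally gauge equivalent to a constant matrix
whose eigenvalues are the chosen representatives. For a module in `B_q^iso` this formal
equivalence is realised by an analytic one.
-/

noncomputable section

namespace QDifference

/-- A section of the projection `ℂ* → ℂ* / q^ℤ`. -/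
def rep (q : ℂˣ) (c : CModQ q) : ℂˣ := Quotient.out c

theorem coe_rep (q : ℂˣ) (c : CModQ q) : (rep q c : CModQ q) = c :=
  QuotientGroup.out_eq' c

theorem rep_coe_injective (q : ℂˣ) : Function.Injective fun c => (rep q c : ℂ) :=
  Units.val_injective.comp (Function.LeftInverse.injective (coe_rep q))

section Classes

variable {q : ℂˣ}

theorem coe_eq_coe_iff_exists_zpow {l m : ℂˣ} : (l : CModQ q) = m ↔ ∃ n : ℤ, m = q ^ n * l := by
  rw [QuotientGroup.eq, Subgroup.mem_zpowers_iff]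
  refine exists_congr fun n => ?_
  rw [eq_comm, inv_mul_eq_iff_eq_mul, mul_comm]

theorem exists_rep_eq_zpow_mul (q l : ℂˣ) : ∃ n : ℤ, rep q l = q ^ n * l :=
  coe_eq_coe_iff_exists_zpow.1 (coe_rep q l).symm

theorem zpow_mul_rep_ne_rep (hroot : ¬ IsOfFinOrder q) {n : ℤ} (hn : n ≠ 0) (c d : CModQ q) :
    (q : ℂ) ^ n * rep q c ≠ rep q d := by
  intro h
  have h' : q ^ n * rep q c = rep q d := Units.ext (by simpa using h)
  obtain rfl : c = d := by
    rw [← coe_rep q c, ← coe_rep q d]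
    exact coe_eq_coe_iff_exists_zpow.2 ⟨n, h'.symm⟩
  exact hroot (isOfFinOrder_iff_zpow_eq_one.2 ⟨n, hn, mul_eq_right.1 h'⟩)

end Classes

section GradedLinearAlgebra

theorem eq_of_le_of_iSupIndep_of_iSup_eq_top {ι α : Type*} [CompleteLattice α] [IsModularLattice α]
    {s t : ι → α} (hs : iSup s = ⊤) (ht : iSupIndep t) (hst : s ≤ t) : s = t := by
  funext i
  refine eq_of_le_of_inf_le_of_sup_le (z := ⨆ j ≠ i, t j) (hst i) (by simp [(ht i).eq_bot]) ?_
  have hcover : iSup s ≤ s i ⊔ ⨆ j ≠ i, t j := iSup_le fun j => by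
    rcases eq_or_ne j i with rfl | hj
    · exact le_sup_left
    · exact (hst j).trans (le_sup_of_le_right (le_iSup₂ (f := fun j (_ : j ≠ i) => t j) j hj))
  exact le_top.trans (hs ▸ hcover)

variable {ι R V W : Type*} [CommRing R] [AddCommGroup V] [Module R V] [AddCommGroup W] [Module R W]

theorem linearMap_ext_of_iSup_eq_top {s : ι → Submodule R V} (hs : iSup s = ⊤) {f g : V →ₗ[R] W}
    (h : ∀ i, ∀ v ∈ s i, f v = g v) : f = g := by
  refine LinearMap.eqLocus_eq_top.1 (top_le_iff.1 (hs ▸ iSup_le fun i v hv => ?_))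
  exact h i v hv

theorem pow_sub_smul_one_apply {A N : Module.End R V} {c : R} {p : Submodule R V}
    (hN : ∀ v ∈ p, N v ∈ p) (hA : ∀ v ∈ p, A v = c • (v + N v)) (n : ℕ) {v : V} (hv : v ∈ p) :
    ((A - c • 1) ^ n) v = c ^ n • (N ^ n) v := by
  induction n with
  | zero => simp
  | succ n ih =>
    rw [pow_succ', Module.End.mul_apply, ih, map_smul, LinearMap.sub_apply,
      hA _ (Module.End.pow_apply_mem_of_forall_mem n hN v hv), LinearMap.smul_apply,
      Module.End.one_apply, smul_add, add_sub_cancel_left, smul_smul, ← pow_succ, pow_succ' N,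
      Module.End.mul_apply]

variable [DecidableEq ι] {s : ι → Submodule R V}

/-- The operator acting on the component `s i` of a graded module as the scalar `f i`. -/
def scaleBy (h : DirectSum.IsInternal s) (f : ι → R) : Module.End R V :=
  DirectSum.coeLinearMap s ∘ₗ (DirectSum.lmap fun i => f i • LinearMap.id) ∘ₗ
    (LinearEquiv.ofBijective (DirectSum.coeLinearMap s) h).symm.toLinearMap

theorem scaleBy_apply (h : DirectSum.IsInternal s) (f : ι → R) {i : ι} {v : V} (hv : v ∈ s i) :
    scaleBy h f v = f i • v := by
  have hsymm : (LinearEquiv.ofBijective (DirectSum.coeLinearMap s) h).symm v =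
      DirectSum.lof R ι (fun i => s i) i ⟨v, hv⟩ := by
    rw [LinearEquiv.symm_apply_eq]
    exact (DirectSum.coeLinearMap_lof s i ⟨v, hv⟩).symm
  simp only [scaleBy, LinearMap.comp_apply, LinearEquiv.coe_coe, hsymm, DirectSum.lmap_lof]
  simp

theorem scaleBy_mul (h : DirectSum.IsInternal s) (f g : ι → R) :
    scaleBy h (f * g) = scaleBy h f * scaleBy h g := by
  refine linearMap_ext_of_iSup_eq_top h.submodule_iSup_eq_top fun i v hv => ?_
  rw [Module.End.mul_apply, scaleBy_apply h g hv, map_smul, scaleBy_apply h f hv,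
    scaleBy_apply h _ hv, smul_smul, Pi.mul_apply, mul_comm]

theorem scaleBy_one (h : DirectSum.IsInternal s) : scaleBy h 1 = 1 :=
  linearMap_ext_of_iSup_eq_top h.submodule_iSup_eq_top fun i v hv => by
    simp [scaleBy_apply h _ hv]

theorem isUnit_scaleBy (h : DirectSum.IsInternal s) {f : ι → R} (hf : IsUnit f) :
    IsUnit (scaleBy h f) := by
  obtain ⟨g, hfg, hgf⟩ := isUnit_iff_exists.1 hf
  exact isUnit_iff_exists.2 ⟨scaleBy h g, by rw [← scaleBy_mul, hfg, scaleBy_one],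
    by rw [← scaleBy_mul, hgf, scaleBy_one]⟩

end GradedLinearAlgebra

namespace GrNil

variable {q : ℂˣ} (V : GrNil.{u} q)

open Classical in
/-- The invertible operator acting as `rep q c • (1 + nil)` on the component of the class `c`. It is
the matrix of the `q`-difference module attached to `V`, whose Jordan decomposition recovers the
grading and the nilpotent operator. -/
def twist : Module.End ℂ V.carrier :=
  scaleBy V.isInternal (fun c => (rep q c : ℂ)) * (1 + V.nil)

theorem iSup_comp : iSup V.comp = ⊤ := by
  classical exact V.isInternal.submodule_iSup_eq_top

theorem finite_comp_ne_bot : {c | V.comp c ≠ ⊥}.Finite := by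
  classical exact WellFoundedGT.finite_ne_bot_of_iSupIndep V.isInternal.submodule_iSupIndep

theorem twist_apply {c : CModQ q} {v : V.carrier} (hv : v ∈ V.comp c) :
    V.twist v = (rep q c : ℂ) • (v + V.nil v) :=
  scaleBy_apply V.isInternal _ ((V.comp c).add_mem hv (V.nil_mem c v hv))

theorem isUnit_twist : IsUnit V.twist :=
  (isUnit_scaleBy _ (Pi.isUnit_iff.2 fun c => (rep q c).isUnit)).mul V.isNilpotent.isUnit_one_add

theorem nil_apply {c : CModQ q} {v : V.carrier} (hv : v ∈ V.comp c) :
    V.nil v = (rep q c : ℂ)⁻¹ • V.twist v - v := by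
  rw [V.twist_apply hv, inv_smul_smul₀ (rep q c).ne_zero, add_sub_cancel_left]

theorem comp_eq_maxGenEigenspace (c : CModQ q) :
    V.comp c = V.twist.maxGenEigenspace (rep q c : ℂ) := by
  refine congrFun (eq_of_le_of_iSupIndep_of_iSup_eq_top V.iSup_comp
    (V.twist.independent_maxGenEigenspace.comp (rep_coe_injective q)) fun c v hv => ?_) c
  obtain ⟨k, hk⟩ := V.isNilpotent
  refine (Module.End.mem_maxGenEigenspace _ _ _).2 ⟨k, ?_⟩
  rw [pow_sub_smul_one_apply (V.nil_mem c) (fun _ => V.twist_apply) k hv, hk,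
    LinearMap.zero_apply, smul_zero]

theorem exists_eq_rep_of_hasEigenvalue_twist {z : ℂ} (h : V.twist.HasEigenvalue z) :
    ∃ c, V.comp c ≠ ⊥ ∧ z = rep q c := by
  by_contra! hz
  have htop : (⨆ j ≠ z, V.twist.maxGenEigenspace j) = ⊤ := by
    rw [eq_top_iff, ← V.iSup_comp]
    refine iSup_le fun c => ?_
    rcases eq_or_ne (V.comp c) ⊥ with hc | hc
    · simp [hc]
    · rw [V.comp_eq_maxGenEigenspace c]
      exact le_iSup₂_of_le (f := fun j (_ : j ≠ z) => V.twist.maxGenEigenspace j)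
        (rep q c : ℂ) (hz c hc).symm le_rfl
  have hbot := V.twist.independent_maxGenEigenspace z
  rw [htop, disjoint_top] at hbot
  exact h (eq_bot_iff.2 (hbot ▸ (Module.End.genEigenspace V.twist z).mono le_top))

end GrNil

theorem maxGenEigenspace_ne_bot_iff {k V : Type*} [Field k] [AddCommGroup V] [Module k V]
    {A : Module.End k V} {z : k} : A.maxGenEigenspace z ≠ ⊥ ↔ A.HasEigenvalue z :=
  Module.End.hasUnifEigenvalue_iff_hasUnifEigenvalue_one ENat.top_pos

theorem apply_mem_maxGenEigenspace {k V : Type*} [Field k] [AddCommGroup V] [Module k V]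
    {A : Module.End k V} {z : k} {v : V} (hv : v ∈ A.maxGenEigenspace z) :
    A v ∈ A.maxGenEigenspace z :=
  Module.End.mapsTo_maxGenEigenspace_of_comm (Commute.refl A) z hv

theorem GrNil.hasEigenvalue_twist {q : ℂˣ} {V : GrNil.{u} q} {c : CModQ q} (hc : V.comp c ≠ ⊥) :
    V.twist.HasEigenvalue (rep q c : ℂ) := by
  rwa [V.comp_eq_maxGenEigenspace, maxGenEigenspace_ne_bot_iff] at hc

section GrNilOfEnd

variable {q : ℂˣ} {V : Type u} [AddCommGroup V] [Module ℂ V] [FiniteDimensional ℂ V]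
  {A : Module.End ℂ V}

open Classical in
theorem isInternal_maxGenEigenspace_rep (hA : ∀ z, A.HasEigenvalue z → ∃ c, z = rep q c) :
    DirectSum.IsInternal fun c : CModQ q => A.maxGenEigenspace (rep q c : ℂ) := by
  refine DirectSum.isInternal_submodule_of_iSupIndep_of_iSup_eq_top
    (A.independent_maxGenEigenspace.comp (rep_coe_injective q)) ?_
  rw [eq_top_iff, ← A.iSup_maxGenEigenspace_eq_top]
  refine iSup_le fun z => ?_
  by_cases hz : A.HasEigenvalue z
  · obtain ⟨c, rfl⟩ := hA z hz
    exact le_iSup (fun c => A.maxGenEigenspace (rep q c : ℂ)) c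
  · rw [not_not.1 (maxGenEigenspace_ne_bot_iff.not.2 hz)]
    exact bot_le

open Classical in
/-- The nilpotent operator `N` such that `A = rep q c • (1 + N)` on the generalized eigenspace of
`A` for the eigenvalue `rep q c`. -/
def unipotentLog (hA : ∀ z, A.HasEigenvalue z → ∃ c, z = rep q c) : Module.End ℂ V :=
  scaleBy (isInternal_maxGenEigenspace_rep hA) (fun c => (rep q c : ℂ)⁻¹) * A - 1

variable (hA : ∀ z, A.HasEigenvalue z → ∃ c, z = rep q c)

theorem unipotentLog_apply {c : CModQ q} {v : V} (hv : v ∈ A.maxGenEigenspace (rep q c : ℂ)) :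
    unipotentLog hA v = (rep q c : ℂ)⁻¹ • A v - v := by
  classical
  rw [unipotentLog, LinearMap.sub_apply, Module.End.mul_apply,
    scaleBy_apply (isInternal_maxGenEigenspace_rep hA) _ (apply_mem_maxGenEigenspace hv),
    Module.End.one_apply]

theorem apply_eq_rep_smul_add_unipotentLog {c : CModQ q} {v : V}
    (hv : v ∈ A.maxGenEigenspace (rep q c : ℂ)) :
    A v = (rep q c : ℂ) • (v + unipotentLog hA v) := by
  rw [unipotentLog_apply hA hv, add_sub_cancel, smul_inv_smul₀ (rep q c).ne_zero]

theorem unipotentLog_mem {c : CModQ q} {v : V} (hv : v ∈ A.maxGenEigenspace (rep q c : ℂ)) :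
    unipotentLog hA v ∈ A.maxGenEigenspace (rep q c : ℂ) := by
  rw [unipotentLog_apply hA hv]
  exact sub_mem (Submodule.smul_mem _ _ (apply_mem_maxGenEigenspace hv)) hv

theorem isNilpotent_unipotentLog : IsNilpotent (unipotentLog hA) := by
  classical
  refine ⟨Module.finrank ℂ V, linearMap_ext_of_iSup_eq_top
    (isInternal_maxGenEigenspace_rep hA).submodule_iSup_eq_top fun c v hv => ?_⟩
  have hpow := pow_sub_smul_one_apply (fun _ => unipotentLog_mem hA)
    (fun _ => apply_eq_rep_smul_add_unipotentLog hA) (Module.finrank ℂ V) hv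
  rw [Module.End.maxGenEigenspace_eq_genEigenspace_finrank, Module.End.mem_genEigenspace_nat,
    LinearMap.mem_ker, hpow] at hv
  exact (smul_eq_zero_iff_right (pow_ne_zero _ (rep q c).ne_zero)).1 hv

/-- The graded space with nilpotent operator given by the Jordan decomposition of an operator whose
eigenvalues are all of the form `rep q c`. -/
def GrNil.ofEnd : GrNil.{u} q where
  carrier := V
  comp c := A.maxGenEigenspace (rep q c : ℂ)
  isInternal := isInternal_maxGenEigenspace_rep hA
  nil := unipotentLog hA
  isNilpotent := isNilpotent_unipotentLog hA
  nil_mem _ _ := unipotentLog_mem hA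

theorem GrNil.twist_ofEnd : (GrNil.ofEnd hA).twist = A :=
  linearMap_ext_of_iSup_eq_top (GrNil.ofEnd hA).iSup_comp fun _ _ hv =>
    ((GrNil.ofEnd hA).twist_apply hv).trans (apply_eq_rep_smul_add_unipotentLog hA hv).symm

end GrNilOfEnd

/-! ## Constants -/

instance : Algebra ℂ (LaurentSeries ℂ) := HahnSeries.instAlgebra

theorem coeff_algebraMap (c : ℂ) (k : ℤ) :
    (algebraMap ℂ (LaurentSeries ℂ) c).coeff k = if k = 0 then c else 0 := by
  simp [HahnSeries.algebraMap_apply, HahnSeries.coeff_single]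

theorem coeff_algebraMap_mul (c : ℂ) (f : LaurentSeries ℂ) (k : ℤ) :
    (algebraMap ℂ (LaurentSeries ℂ) c * f).coeff k = c * f.coeff k := by
  rw [← Algebra.smul_def]
  rfl

theorem coeff_mul_algebraMap (f : LaurentSeries ℂ) (c : ℂ) (k : ℤ) :
    (f * algebraMap ℂ (LaurentSeries ℂ) c).coeff k = f.coeff k * c := by
  rw [mul_comm, coeff_algebraMap_mul, mul_comm]

theorem algebraMap_mem_meroGerms (c : ℂ) : algebraMap ℂ (LaurentSeries ℂ) c ∈ meroGerms := by
  refine ⟨1, one_pos, summable_of_ne_finset_zero (s := {0}) fun n hn => ?_⟩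
  have hn' : n ≠ 0 := by simpa using hn
  simp [coeff_algebraMap, hn']

instance : Algebra ℂ meroGerms :=
  ((algebraMap ℂ (LaurentSeries ℂ)).codRestrict meroGerms algebraMap_mem_meroGerms).toAlgebra

theorem sigmaHat_coeff (q : ℂˣ) (f : LaurentSeries ℂ) (k : ℤ) :
    (sigmaHat q f).coeff k = (q : ℂ) ^ k * f.coeff k := rfl

theorem sigmaHat_algebraMap (q : ℂˣ) (c : ℂ) :
    sigmaHat q (algebraMap ℂ (LaurentSeries ℂ) c) = algebraMap ℂ (LaurentSeries ℂ) c := by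
  ext k
  rw [sigmaHat_coeff, coeff_algebraMap]
  split_ifs with h <;> simp [h]

theorem sigma_algebraMap (q : ℂˣ) (c : ℂ) :
    sigma q (algebraMap ℂ meroGerms c) = algebraMap ℂ meroGerms c :=
  Subtype.ext (sigmaHat_algebraMap q c)

section ConstantMatrices

variable {l m n : Type*} [Fintype m]

theorem map_coeff_algebraMap_mul (A : Matrix l m ℂ) (θ : Matrix m n (LaurentSeries ℂ)) (k : ℤ) :
    (A.map (algebraMap ℂ (LaurentSeries ℂ)) * θ).map (fun f => f.coeff k) =
      A * θ.map fun f => f.coeff k := by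
  ext i j
  simp [Matrix.mul_apply, coeff_algebraMap_mul]

theorem map_coeff_mul_algebraMap (θ : Matrix l m (LaurentSeries ℂ)) (A : Matrix m n ℂ) (k : ℤ) :
    (θ * A.map (algebraMap ℂ (LaurentSeries ℂ))).map (fun f => f.coeff k) =
      θ.map (fun f => f.coeff k) * A := by
  ext i j
  simp [Matrix.mul_apply, coeff_mul_algebraMap]

end ConstantMatrices

theorem eq_map_algebraMap_of_map_coeff_eq_zero {m n : Type*} {θ : Matrix m n (LaurentSeries ℂ)}
    (h : ∀ k : ℤ, k ≠ 0 → θ.map (fun f => f.coeff k) = 0) :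
    θ = (θ.map fun f => f.coeff 0).map (algebraMap ℂ (LaurentSeries ℂ)) := by
  ext i j k
  rw [Matrix.map_apply, Matrix.map_apply, coeff_algebraMap]
  split_ifs with hk
  · rw [hk]
  · exact congrFun (congrFun (h k hk) i) j

/-! ## Matrices of difference modules -/

namespace DiffModule

variable {F : Type} [Field F] {σ : F ≃+* F} {M N : DiffModule.{u} F σ}

theorem hom_ext {f g : M ⟶ N} (h : f.toLin = g.toLin) : f = g :=
  Hom.ext h

/-- An isomorphism of difference modules from a linear equivalence commuting with the operators. -/
def isoOfLinearEquiv (e : M.carrier ≃ₗ[F] N.carrier) (h : ∀ m, e (M.Sig m) = N.Sig (e m)) :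
    M ≅ N where
  hom := ⟨e.toLinearMap, h⟩
  inv := ⟨e.symm.toLinearMap, fun m => by
    rw [LinearEquiv.coe_coe, LinearEquiv.symm_apply_eq, h, LinearEquiv.apply_symm_apply]⟩
  hom_inv_id := hom_ext (LinearMap.ext fun m => e.symm_apply_apply m)
  inv_hom_id := hom_ext (LinearMap.ext fun m => e.apply_symm_apply m)

/-- The linear equivalence underlying an isomorphism of difference modules. -/
def linearEquivOfIso (e : M ≅ N) : M.carrier ≃ₗ[F] N.carrier :=
  LinearEquiv.ofLinearMap e.hom.toLin e.inv.toLin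
    (congrArg Hom.toLin e.inv_hom_id) (congrArg Hom.toLin e.hom_inv_id)

/-- The matrix of the operator of a difference module in a basis. -/
def sigMatrix {n : Type*} (b : Module.Basis n F M.carrier) : Matrix n n F :=
  Matrix.of fun i j => b.repr (M.Sig (b j)) i

section SigMatrix

variable {m n : Type*} [Fintype n]

theorem repr_sig (b : Module.Basis n F M.carrier) (x : M.carrier) :
    ⇑(b.repr (M.Sig x)) = (sigMatrix b).mulVec (σ ∘ b.repr x) := by
  have hx : M.Sig x = ∑ j, σ (b.repr x j) • M.Sig (b j) := by
    conv_lhs => rw [← b.sum_repr x]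
    simp only [map_sum, M.Sig_smul]
  ext i
  simp [hx, Matrix.mulVec, dotProduct, sigMatrix, mul_comm]

variable [Fintype m] [DecidableEq n]

theorem forall_apply_sig_iff (b : Module.Basis n F M.carrier) (b' : Module.Basis m F N.carrier)
    (φ : M.carrier →ₗ[F] N.carrier) :
    (∀ x, φ (M.Sig x) = N.Sig (φ x)) ↔
      sigMatrix b' * (LinearMap.toMatrix b b' φ).map σ =
        LinearMap.toMatrix b b' φ * sigMatrix b := by
  have hφ (x) : b'.repr (φ x) = (LinearMap.toMatrix b b' φ).mulVec (b.repr x) :=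
    (LinearMap.toMatrix_mulVec_repr b b' φ x).symm
  have hl (x) : b'.repr (φ (M.Sig x)) =
      (LinearMap.toMatrix b b' φ * sigMatrix b).mulVec (σ ∘ b.repr x) := by
    rw [hφ, repr_sig, Matrix.mulVec_mulVec]
  have hr (x) : b'.repr (N.Sig (φ x)) =
      (sigMatrix b' * (LinearMap.toMatrix b b' φ).map σ).mulVec (σ ∘ b.repr x) := by
    rw [repr_sig, hφ, ← Matrix.mulVec_mulVec]
    congr 1
    ext i
    exact RingHom.map_mulVec σ.toRingHom _ _ i
  refine ⟨fun h => ?_, fun h x => b'.repr.injective (DFunLike.coe_injective ?_)⟩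
  · ext i j
    have hσ : σ ∘ b.repr (b j) = Pi.single j 1 := by
      ext k
      simp [Finsupp.single_apply, Pi.single_apply, eq_comm, apply_ite σ]
    have hj : b'.repr (N.Sig (φ (b j))) i = b'.repr (φ (M.Sig (b j))) i := by rw [h]
    rwa [hl, hr, hσ, Matrix.mulVec_single_one, Matrix.mulVec_single_one] at hj
  · rw [hl, hr, h]

theorem exists_matrix_of_iso (e : M ≅ N) (b : Module.Basis n F M.carrier)
    (b' : Module.Basis n F N.carrier) :
    ∃ T T' : Matrix n n F, T * T' = 1 ∧ sigMatrix b' * T.map σ = T * sigMatrix b := by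
  refine ⟨_, LinearMap.toMatrix b' b (linearEquivOfIso e).symm.toLinearMap, ?_,
    (forall_apply_sig_iff b b' (linearEquivOfIso e).toLinearMap).1 e.hom.comm⟩
  rw [← LinearMap.toMatrix_comp]
  simp

theorem nonempty_iso_of_matrix (b : Module.Basis n F M.carrier) (b' : Module.Basis n F N.carrier)
    {T T' : Matrix n n F} (hT : T * T' = 1) (h : sigMatrix b' * T.map σ = T * sigMatrix b) :
    Nonempty (M ≅ N) :=
  ⟨isoOfLinearEquiv (Matrix.toLinOfInv b b' hT (mul_eq_one_comm.1 hT))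
    ((forall_apply_sig_iff b b' (Matrix.toLin b b' T)).2 (by rwa [LinearMap.toMatrix_toLin]))⟩

end SigMatrix

section BaseChange

variable {G : Type} [Field G] [Algebra F G] {τ : G ≃+* G} {n : Type*}

/-- The basis of an extension of scalars given by a basis of the original module. -/
def baseChangeBasis (h : ∀ f, τ (algebraMap F G f) = algebraMap F G (σ f))
    (b : Module.Basis n F M.carrier) : Module.Basis n G (M.baseChange h).carrier :=
  b.baseChange G

theorem sigMatrix_baseChangeBasis (h : ∀ f, τ (algebraMap F G f) = algebraMap F G (σ f))
    (b : Module.Basis n F M.carrier) :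
    sigMatrix (baseChangeBasis h b) = (sigMatrix b).map (algebraMap F G) := by
  ext i j
  have hj : (M.baseChange h).Sig (baseChangeBasis h b j) = (1 : G) ⊗ₜ[F] M.Sig (b j) := by
    rw [show baseChangeBasis h b j = (1 : G) ⊗ₜ[F] b j from b.baseChange_apply G j,
      ← map_one τ]
    exact congrArg (fun g => g ⊗ₜ[F] M.Sig (b j)) (by simp)
  change (b.baseChange G).repr ((M.baseChange h).Sig (baseChangeBasis h b j)) i = _
  rw [hj, Module.Basis.baseChange_repr_tmul, Algebra.smul_def, mul_one]
  rfl

end BaseChange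

end DiffModule

/-- The basis of the formalization of a module given by a basis of the module. -/
def formalizationBasis {q : ℂˣ} {n : Type*} {M : Bq.{u} q}
    (b : Module.Basis n meroGerms M.carrier) :
    Module.Basis n (LaurentSeries ℂ) (formalization M).carrier :=
  DiffModule.baseChangeBasis _ b

theorem sigMatrix_formalizationBasis {q : ℂˣ} {n : Type*} {M : Bq.{u} q}
    (b : Module.Basis n meroGerms M.carrier) :
    DiffModule.sigMatrix (formalizationBasis b) = (DiffModule.sigMatrix b).map meroGerms.subtype :=
  DiffModule.sigMatrix_baseChangeBasis _ b

/-! ## Modules with constant coefficients -/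

/-- A complex vector space with an automorphism, as a difference module over `ℂ`. -/
abbrev DiffModule.ofAut (V : Type u) [AddCommGroup V] [Module ℂ V] [FiniteDimensional ℂ V]
    (A : V ≃ₗ[ℂ] V) : DiffModule.{u} ℂ (RingEquiv.refl ℂ) where
  carrier := V
  Sig := A.toAddEquiv
  Sig_smul f m := A.map_smul f m

section AnalyticModule

variable (q : ℂˣ) {V : Type u} [AddCommGroup V] [Module ℂ V] [FiniteDimensional ℂ V]
  (A : V ≃ₗ[ℂ] V)

/-- The `q`-difference module `K ⊗ V` with operator `σ_q ⊗ A`. -/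
abbrev analyticModule : Bq.{u} q :=
  (DiffModule.ofAut V A).baseChange (τ := sigma q) (sigma_algebraMap q)

/-- The operator `σ_q ⊗ A` on `K ⊗ V`. -/
def analyticSig : meroGerms ⊗[ℂ] V ≃+ meroGerms ⊗[ℂ] V := (analyticModule q A).Sig

theorem analyticSig_tmul (f : meroGerms) (v : V) :
    analyticSig q A (f ⊗ₜ v) = sigma q f ⊗ₜ[ℂ] A v := rfl

theorem analyticSig_smul (f : meroGerms) (t : meroGerms ⊗[ℂ] V) :
    analyticSig q A (f • t) = sigma q f • analyticSig q A t :=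
  (analyticModule q A).Sig_smul f t

variable {n : Type*}

/-- The basis of `K ⊗ V` given by a basis of `V`. -/
def analyticBasis (v : Module.Basis n ℂ V) :
    Module.Basis n meroGerms (analyticModule q A).carrier :=
  v.baseChange meroGerms

variable [Fintype n] [DecidableEq n] (v : Module.Basis n ℂ V)

theorem sigMatrix_analyticBasis :
    DiffModule.sigMatrix (analyticBasis q A v) =
      (LinearMap.toMatrix v v A.toLinearMap).map (algebraMap ℂ meroGerms) := by
  refine (DiffModule.sigMatrix_baseChangeBasis (M := .ofAut V A) (sigma_algebraMap q) v).trans ?_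
  congr 1
  ext i j
  rw [LinearMap.toMatrix_apply]
  rfl

theorem sigMatrix_formalizationBasis_analyticBasis :
    DiffModule.sigMatrix (formalizationBasis (analyticBasis q A v)) =
      (LinearMap.toMatrix v v A.toLinearMap).map (algebraMap ℂ (LaurentSeries ℂ)) := by
  rw [sigMatrix_formalizationBasis, sigMatrix_analyticBasis]
  rfl

end AnalyticModule

/-! ## Rigidity -/

theorem apply_mem_maxGenEigenspace_of_intertwines {k V W : Type*} [Field k] [AddCommGroup V]
    [Module k V] [AddCommGroup W] [Module k W] {A : Module.End k V} {B : Module.End k W}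
    {T : V →ₗ[k] W} {c z : k} (hT : T ∘ₗ A = c • B ∘ₗ T) (hc : c ≠ 0) {v : V}
    (hv : v ∈ A.maxGenEigenspace (c * z)) : T v ∈ B.maxGenEigenspace z := by
  obtain ⟨n, hn⟩ := (Module.End.mem_maxGenEigenspace _ _ _).1 hv
  refine (Module.End.mem_maxGenEigenspace _ _ _).2 ⟨n, ?_⟩
  have hsub : (c • (B - z • 1)) ∘ₗ T = T ∘ₗ (A - (c * z) • 1) := by
    rw [LinearMap.comp_sub, hT]
    ext
    simp [smul_sub, smul_smul]
  have hpow := DFunLike.congr_fun (Module.End.commute_pow_left_of_commute hsub n) v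
  rw [LinearMap.comp_apply, LinearMap.comp_apply, hn, map_zero, smul_pow, LinearMap.smul_apply]
    at hpow
  exact (smul_eq_zero_iff_right (pow_ne_zero n hc)).1 hpow

section Rigidity

variable {q : ℂˣ} {V W : GrNil.{u} q}

/-- The automorphism `GrNil.twist`. -/
def GrNil.twistEquiv (V : GrNil.{u} q) : V.carrier ≃ₗ[ℂ] V.carrier :=
  LinearEquiv.ofBijective V.twist ((Module.End.isUnit_iff _).1 V.isUnit_twist)

theorem GrNil.Hom.toLin_comp_twist (f : V ⟶ W) : f.toLin ∘ₗ V.twist = W.twist ∘ₗ f.toLin := by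
  refine linearMap_ext_of_iSup_eq_top V.iSup_comp fun c v hv => ?_
  rw [LinearMap.comp_apply, LinearMap.comp_apply, V.twist_apply hv,
    W.twist_apply (f.map_comp c v hv), map_smul, map_add, f.comm]

/-- A linear map commuting with the operators `GrNil.twist` respects the gradings and the nilpotent
operators, these being given by the Jordan decompositions of the former. -/
def GrNil.homOfComm (T : V.carrier →ₗ[ℂ] W.carrier) (hT : T ∘ₗ V.twist = W.twist ∘ₗ T) :
    V ⟶ W :=
  have hcomp (c) (v) (hv : v ∈ V.comp c) : T v ∈ W.comp c := by
    rw [V.comp_eq_maxGenEigenspace, ← one_mul (rep q c : ℂ)] at hv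
    rw [W.comp_eq_maxGenEigenspace]
    exact apply_mem_maxGenEigenspace_of_intertwines (by rw [hT, one_smul]) one_ne_zero hv
  { toLin := T
    map_comp := hcomp
    comm := DFunLike.congr_fun (f := T ∘ₗ V.nil) (g := W.nil ∘ₗ T) <|
      linearMap_ext_of_iSup_eq_top V.iSup_comp fun c v hv => by
        have hTv : T (V.twist v) = W.twist (T v) := DFunLike.congr_fun hT v
        rw [LinearMap.comp_apply, LinearMap.comp_apply, V.nil_apply hv, W.nil_apply (hcomp c v hv),
          map_sub, map_smul, hTv] }

theorem eq_zero_of_intertwines (hroot : ¬ IsOfFinOrder q) {k : ℤ} (hk : k ≠ 0)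
    {T : V.carrier →ₗ[ℂ] W.carrier} (hT : T ∘ₗ V.twist = (q : ℂ) ^ k • W.twist ∘ₗ T) : T = 0 := by
  refine linearMap_ext_of_iSup_eq_top V.iSup_comp fun c v hv => ?_
  rw [V.comp_eq_maxGenEigenspace, ← mul_inv_cancel_left₀ (zpow_ne_zero k q.ne_zero) (rep q c : ℂ)]
    at hv
  have hTv := apply_mem_maxGenEigenspace_of_intertwines hT (zpow_ne_zero k q.ne_zero) hv
  have hbot : W.twist.maxGenEigenspace (((q : ℂ) ^ k)⁻¹ * rep q c) = ⊥ := by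
    refine not_not.1 (maxGenEigenspace_ne_bot_iff.not.2 fun hz => ?_)
    obtain ⟨d, -, hd⟩ := W.exists_eq_rep_of_hasEigenvalue_twist hz
    exact zpow_mul_rep_ne_rep hroot (neg_ne_zero.2 hk) c d (by rw [zpow_neg, hd])
  rwa [hbot, Submodule.mem_bot] at hTv

theorem exists_eq_map_of_intertwines (hroot : ¬ IsOfFinOrder q) {m n : Type*} [Fintype m]
    [DecidableEq m] [Fintype n] [DecidableEq n] (v : Module.Basis n ℂ V.carrier)
    (w : Module.Basis m ℂ W.carrier) {θ : Matrix m n (LaurentSeries ℂ)}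
    (hθ : (LinearMap.toMatrix w w W.twist).map (algebraMap ℂ (LaurentSeries ℂ)) *
        θ.map (sigmaHat q) =
      θ * (LinearMap.toMatrix v v V.twist).map (algebraMap ℂ (LaurentSeries ℂ))) :
    ∃ f : V ⟶ W, θ = (LinearMap.toMatrix v w f.toLin).map (algebraMap ℂ (LaurentSeries ℂ)) := by
  let T (k : ℤ) : V.carrier →ₗ[ℂ] W.carrier := Matrix.toLin v w (θ.map fun f => f.coeff k)
  have hT (k : ℤ) : T k ∘ₗ V.twist = (q : ℂ) ^ k • W.twist ∘ₗ T k := by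
    refine (LinearMap.toMatrix v w).injective ?_
    have hk := congrArg (fun M => M.map fun f => f.coeff k) hθ
    simp only [map_coeff_algebraMap_mul, map_coeff_mul_algebraMap] at hk
    rw [LinearMap.toMatrix_comp v v w, map_smul, LinearMap.toMatrix_comp v w w,
      LinearMap.toMatrix_toLin, ← hk, ← Matrix.mul_smul]
    rfl
  refine ⟨GrNil.homOfComm (T 0) (by simpa using hT 0), ?_⟩
  change θ = (LinearMap.toMatrix v w (T 0)).map _
  rw [LinearMap.toMatrix_toLin]
  refine eq_map_algebraMap_of_map_coeff_eq_zero fun k hk => ?_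
  exact (Matrix.toLin v w).map_eq_zero_iff.1 (eq_zero_of_intertwines hroot hk (hT k))

end Rigidity

/-! ## The functor -/

theorem baseChange_analyticSig {q : ℂˣ} {V W : Type u} [AddCommGroup V] [Module ℂ V]
    [FiniteDimensional ℂ V] [AddCommGroup W] [Module ℂ W] [FiniteDimensional ℂ W]
    {A : V ≃ₗ[ℂ] V} {B : W ≃ₗ[ℂ] W} {T : V →ₗ[ℂ] W} (h : ∀ v, T (A v) = B (T v))
    (t : meroGerms ⊗[ℂ] V) :
    T.baseChange meroGerms (analyticSig q A t) = analyticSig q B (T.baseChange meroGerms t) := by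
  induction t using TensorProduct.induction_on with
  | zero => simp only [map_zero]
  | tmul a v =>
    rw [analyticSig_tmul, LinearMap.baseChange_tmul, LinearMap.baseChange_tmul, analyticSig_tmul, h]
  | add x y hx hy => rw [map_add, map_add, hx, hy, map_add, map_add]

section Functor

variable {q : ℂˣ} {V W : GrNil.{u} q}

/-- The morphism `1 ⊗ f`. -/
def analyticHom (f : V ⟶ W) : analyticModule q V.twistEquiv ⟶ analyticModule q W.twistEquiv where
  toLin := f.toLin.baseChange meroGerms
  comm := baseChange_analyticSig (DFunLike.congr_fun (GrNil.Hom.toLin_comp_twist f))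

theorem toMatrix_analyticHom {m n : Type*} [Fintype n] [DecidableEq n] [Finite m] (f : V ⟶ W)
    (v : Module.Basis n ℂ V.carrier) (w : Module.Basis m ℂ W.carrier) :
    LinearMap.toMatrix (analyticBasis q V.twistEquiv v) (analyticBasis q W.twistEquiv w)
      (analyticHom f).toLin = (LinearMap.toMatrix v w f.toLin).map (algebraMap ℂ meroGerms) := by
  refine Matrix.ext fun i j => ?_
  have hj : (analyticHom f).toLin (analyticBasis q V.twistEquiv v j) =
      (1 : meroGerms) ⊗ₜ[ℂ] f.toLin (v j) := by
    rw [show analyticBasis q V.twistEquiv v j = (1 : meroGerms) ⊗ₜ[ℂ] v j from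
      v.baseChange_apply meroGerms j]
    exact LinearMap.baseChange_tmul ..
  rw [LinearMap.toMatrix_apply, hj]
  change (w.baseChange meroGerms).repr _ i = _
  rw [Module.Basis.baseChange_repr_tmul, Algebra.smul_def, mul_one, Matrix.map_apply,
    LinearMap.toMatrix_apply]

/-- The functor `V ↦ K ⊗ V`, where `K ⊗ V` carries the operator `σ_q ⊗ V.twist`. -/
def analyticFunctor (q : ℂˣ) : GrNil.{u} q ⥤ Bq.{u} q where
  obj V := analyticModule q V.twistEquiv
  map f := analyticHom f
  map_id _ := DiffModule.hom_ext (LinearMap.baseChange_id (A := meroGerms))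
  map_comp f g := DiffModule.hom_ext (LinearMap.baseChange_comp (A := meroGerms) f.toLin g.toLin)

instance : (analyticFunctor.{u} q).Faithful where
  map_injective {V _} _ _ h := GrNil.Hom.ext <|
    have := (faithfulSMul_iff_algebraMap_injective ℂ meroGerms).2 (algebraMap ℂ meroGerms).injective
    LinearMap.baseChangeHom_injective ℂ V.carrier meroGerms (congrArg DiffModule.Hom.toLin h)

theorem analyticFunctor_full (hroot : ¬ IsOfFinOrder q) : (analyticFunctor.{u} q).Full where
  map_surjective {V W} φ := by
    let v := Module.finBasis ℂ V.carrier
    let w := Module.finBasis ℂ W.carrier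
    let vK := analyticBasis q V.twistEquiv v
    let wK := analyticBasis q W.twistEquiv w
    have hφ := (DiffModule.forall_apply_sig_iff vK wK φ.toLin).1 φ.comm
    rw [sigMatrix_analyticBasis, sigMatrix_analyticBasis] at hφ
    have hφhat := congrArg (fun M => M.map meroGerms.subtype) hφ
    simp only [Matrix.map_mul] at hφhat
    obtain ⟨f, hf⟩ := exists_eq_map_of_intertwines hroot v w
      (θ := (LinearMap.toMatrix vK wK φ.toLin).map meroGerms.subtype) hφhat
    refine ⟨f, DiffModule.hom_ext ((LinearMap.toMatrix vK wK).injective ?_)⟩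
    refine (toMatrix_analyticHom f v w).trans ?_
    exact Matrix.map_injective meroGerms.subtype_injective hf.symm

end Functor

/-! ## Small divisors -/

theorem Converges.const_mul {c : ℕ → ℂ} (hc : Converges c) (a : ℂ) :
    Converges fun n => a * c n := by
  rw [converges_iff_bound] at *
  obtain ⟨A, B, hA, hB, h⟩ := hc
  refine ⟨‖a‖ * A, B, by positivity, hB, fun n => ?_⟩
  rw [norm_mul, mul_assoc]
  exact mul_le_mul_of_nonneg_left (h n) (norm_nonneg a)

theorem Converges.mul_apply {c d : ℕ → ℂ} (hc : Converges c) (hd : Converges d) :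
    Converges fun n => c n * d n := by
  rw [converges_iff_bound] at *
  obtain ⟨A, B, hA, hB, h⟩ := hc
  obtain ⟨A', B', hA', hB', h'⟩ := hd
  refine ⟨A * A', B * B', by positivity, by positivity, fun n => ?_⟩
  rw [norm_mul, mul_pow, mul_mul_mul_comm]
  exact mul_le_mul (h n) (h' n) (norm_nonneg _) (by positivity)

theorem converges_pow (a : ℂ) : Converges fun n => a ^ n :=
  converges_iff_bound.2 ⟨1, ‖a‖ + 1, zero_le_one, by positivity, fun n => by
    rw [norm_pow, one_mul]
    exact pow_le_pow_left₀ (norm_nonneg a) (by linarith) n⟩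

theorem converges_one : Converges fun _ => 1 := by simpa using converges_pow 1

theorem converges_multiset_prod {ι : Type*} (s : Multiset ι) {c : ι → ℕ → ℂ}
    (h : ∀ i ∈ s, Converges (c i)) : Converges fun n => (s.map fun i => c i n).prod := by
  induction s using Multiset.induction_on with
  | empty => simpa using converges_one
  | cons a s ih =>
    simp only [Multiset.map_cons, Multiset.prod_cons]
    exact (h a (Multiset.mem_cons_self a s)).mul_apply
      (ih fun i hi => h i (Multiset.mem_cons_of_mem hi))

theorem exists_uniform_bound {ι : Type*} [Finite ι] {c : ι → ℕ → ℂ} (h : ∀ i, Converges (c i)) :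
    ∃ C r : ℝ, 0 < C ∧ 0 < r ∧ ∀ i n, ‖c i n‖ ≤ C * r ^ n := by
  have := Fintype.ofFinite ι
  simp only [converges_iff_bound] at h
  choose A B hA hB h using h
  refine ⟨1 + ∑ i, A i, 1 + ∑ i, B i, ?_, ?_, fun i n => (h i n).trans ?_⟩
  · have := Finset.sum_nonneg fun i (_ : i ∈ Finset.univ) => hA i
    positivity
  · have := Finset.sum_nonneg fun i (_ : i ∈ Finset.univ) => (hB i).le
    positivity
  · have h1 := Finset.single_le_sum (fun i _ => hA i) (Finset.mem_univ i)
    have h2 := Finset.single_le_sum (fun i _ => (hB i).le) (Finset.mem_univ i)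
    exact mul_le_mul (by linarith) (pow_le_pow_left₀ (hB i).le (by linarith) n)
      (pow_nonneg (hB i).le n) (by linarith [hA i])

theorem le_of_convolution_bound {a δ : ℕ → ℝ} {C r : ℝ} (hC : 0 < C) (hr : 0 < r)
    (hδ : ∀ n, 1 ≤ δ n) (h0 : a 0 ≤ C)
    (h : ∀ n, a (n + 1) ≤
      δ n * (C * (r ^ (n + 1) + ∑ l ∈ Finset.range (n + 1), r ^ (n + 1 - l) * a l))) (n : ℕ) :
    a n ≤ C * (1 + C) ^ n * r ^ n * ∏ k ∈ Finset.range n, δ k := by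
  induction n using Nat.strong_induction_on with
  | _ n ih =>
    rcases n with _ | n
    · simpa using h0
    set D := ∏ k ∈ Finset.range n, δ k with hD
    have hD1 : 1 ≤ D := Finset.one_le_prod fun k _ => hδ k
    have hs : ∑ l ∈ Finset.range (n + 1), r ^ (n + 1 - l) * a l ≤
        ∑ l ∈ Finset.range (n + 1), r ^ (n + 1) * D * (C * (1 + C) ^ l) := by
      refine Finset.sum_le_sum fun l hl => ?_
      have hl := Finset.mem_range.1 hl
      have hle : ∏ k ∈ Finset.range l, δ k ≤ D :=
        Finset.prod_le_prod_of_subset_of_one_le (Finset.range_subset_range.2 (Nat.lt_succ_iff.1 hl))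
          (fun k _ => zero_le_one.trans (hδ k)) (fun k _ _ => hδ k)
      calc r ^ (n + 1 - l) * a l ≤ r ^ (n + 1 - l) * (C * (1 + C) ^ l * r ^ l * D) := by
            refine mul_le_mul_of_nonneg_left ((ih l hl).trans ?_) (by positivity)
            exact mul_le_mul_of_nonneg_left hle (by positivity)
        _ = (r ^ (n + 1 - l) * r ^ l) * D * (C * (1 + C) ^ l) := by ring
        _ = r ^ (n + 1) * D * (C * (1 + C) ^ l) := by rw [← pow_add, Nat.sub_add_cancel hl.le]
    have hgeom : ∑ l ∈ Finset.range (n + 1), C * (1 + C) ^ l = (1 + C) ^ (n + 1) - 1 := by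
      rw [← Finset.mul_sum, mul_comm]
      simpa using geom_sum_mul (1 + C) (n + 1)
    rw [← Finset.mul_sum, hgeom] at hs
    calc a (n + 1)
        ≤ δ n * (C * (r ^ (n + 1) * D + r ^ (n + 1) * D * ((1 + C) ^ (n + 1) - 1))) := by
          refine (h n).trans (mul_le_mul_of_nonneg_left (mul_le_mul_of_nonneg_left
            (add_le_add ?_ hs) hC.le) (zero_le_one.trans (hδ n)))
          exact le_mul_of_one_le_right (by positivity) hD1
      _ = _ := by rw [Finset.prod_range_succ, ← hD]; ring

theorem exists_le_geometric_of_convolution_bound {a : ℕ → ℝ} (ha : ∀ k, 0 ≤ a k) {d : ℕ → ℂ}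
    (hd0 : ∀ k, d k ≠ 0) {D : ℝ} (hd : ∀ k, ‖d k‖ ≤ D)
    (hprod : Converges fun m => (∏ k ∈ Finset.range m, d k)⁻¹) {C r : ℝ} (hC : 0 ≤ C)
    (hr : 0 < r) (h : ∀ k, ‖d k‖ * a (k + 1) ≤
      C * (r ^ (k + 1) + ∑ l ∈ Finset.range (k + 1), r ^ (k + 1 - l) * a l)) :
    ∃ A B : ℝ, 0 ≤ A ∧ 0 < B ∧ ∀ n, a n ≤ A * B ^ n := by
  have hD : 0 ≤ D := (norm_nonneg _).trans (hd 0)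
  have hpos (k) : 0 < ‖d k‖ := norm_pos_iff.2 (hd0 k)
  -- After multiplication by `1 + D` the inverses of the divisors are at least `1`.
  have hδ (k) : 1 ≤ (1 + D) * ‖d k‖⁻¹ := by
    rw [← div_eq_mul_inv, one_le_div (hpos k)]
    linarith [hd k]
  set E := a 0 + C + 1
  have hE : 0 < E := by linarith [ha 0]
  have hrec (k) : a (k + 1) ≤ (1 + D) * ‖d k‖⁻¹ *
      (E * (r ^ (k + 1) + ∑ l ∈ Finset.range (k + 1), r ^ (k + 1 - l) * a l)) := by
    set s := r ^ (k + 1) + ∑ l ∈ Finset.range (k + 1), r ^ (k + 1 - l) * a l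
    have hs : 0 ≤ s := add_nonneg (by positivity)
      (Finset.sum_nonneg fun l _ => mul_nonneg (by positivity) (ha l))
    calc a (k + 1) = ‖d k‖⁻¹ * (‖d k‖ * a (k + 1)) := by rw [inv_mul_cancel_left₀ (hpos k).ne']
      _ ≤ ‖d k‖⁻¹ * (E * s) := by
          refine mul_le_mul_of_nonneg_left ((h k).trans ?_) (by positivity)
          exact mul_le_mul_of_nonneg_right (by linarith [ha 0]) hs
      _ ≤ (1 + D) * ‖d k‖⁻¹ * (E * s) := by
          rw [mul_assoc]
          exact le_mul_of_one_le_left (by positivity) (by linarith)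
  obtain ⟨A, B, hA, hB, hAB⟩ := converges_iff_bound.1 hprod
  refine ⟨E * A, (1 + E) * r * ((1 + D) * B), by positivity, by positivity, fun m =>
    (le_of_convolution_bound hE hr hδ (by linarith) hrec m).trans ?_⟩
  rw [Finset.prod_mul_distrib, Finset.prod_const, Finset.card_range, Finset.prod_inv_distrib,
    ← norm_prod, ← norm_inv]
  refine (mul_le_mul_of_nonneg_left (mul_le_mul_of_nonneg_left (hAB m) (by positivity))
    (by positivity)).trans_eq ?_
  rw [mul_pow, mul_pow, mul_pow]
  ring

theorem exists_norm_apply_pow_le {E : Type*} [SeminormedAddCommGroup E] {w : ℂ} (hw : ‖w‖ = 1)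
    {f : ℂ → E} (hf : Continuous f) : ∃ a, ∀ k : ℕ, ‖f (w ^ k)‖ ≤ a := by
  obtain ⟨a, ha⟩ := (isCompact_sphere (0 : ℂ) 1).exists_bound_of_continuousOn hf.continuousOn
  exact ⟨a, fun k => ha _ (by simp [hw])⟩

section Matrix

variable {n : Type*} [Fintype n]

theorem norm_mulVec_le {R : Type*} [NormedRing R] {M : Matrix n n R} {b : ℝ}
    (hb : 0 ≤ b) (hM : ∀ i j, ‖M i j‖ ≤ b) (v : n → R) :
    ‖M.mulVec v‖ ≤ Fintype.card n * b * ‖v‖ := by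
  refine (pi_norm_le_iff_of_nonneg (by positivity)).2 fun i => ?_
  calc ‖∑ j, M i j * v j‖ ≤ ∑ _j : n, b * ‖v‖ := by
        refine (norm_sum_le _ _).trans (Finset.sum_le_sum fun j _ => (norm_mul_le _ _).trans ?_)
        exact mul_le_mul (hM i j) (norm_le_pi_norm v j) (norm_nonneg _) hb
    _ = _ := by simp [mul_assoc]

theorem norm_sub_sum_smul_mulVec_le {w : ℂ} (hw : ‖w‖ = 1) {B : ℕ → Matrix n n ℂ}
    {y g : ℕ → n → ℂ} {C r : ℝ} (hC : 0 ≤ C) (hr : 0 ≤ r)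
    (hB : ∀ i j k, ‖B k i j‖ ≤ C * r ^ k) (hg : ∀ i k, ‖g k i‖ ≤ C * r ^ k) (k : ℕ) :
    ‖g k - ∑ l ∈ Finset.range k, w ^ l • (B (k - l)).mulVec (y l)‖ ≤
      C * (1 + Fintype.card n) * (r ^ k + ∑ l ∈ Finset.range k, r ^ (k - l) * ‖y l‖) := by
  have hgk : ‖g k‖ ≤ C * r ^ k :=
    (pi_norm_le_iff_of_nonneg (by positivity)).2 fun i => hg i k
  have hsum : ‖∑ l ∈ Finset.range k, w ^ l • (B (k - l)).mulVec (y l)‖ ≤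
      C * Fintype.card n * ∑ l ∈ Finset.range k, r ^ (k - l) * ‖y l‖ := by
    rw [Finset.mul_sum]
    refine (norm_sum_le _ _).trans (Finset.sum_le_sum fun l _ => ?_)
    rw [norm_smul, norm_pow, hw, one_pow, one_mul]
    refine (norm_mulVec_le (b := C * r ^ (k - l)) (by positivity) (fun i j => hB i j _) _).trans_eq
      ?_
    ring
  have hsum0 : 0 ≤ C * ∑ l ∈ Finset.range k, r ^ (k - l) * ‖y l‖ := by positivity
  have hpow0 : 0 ≤ C * Fintype.card n * r ^ k := by positivity
  linarith [norm_sub_le (g k) (∑ l ∈ Finset.range k, w ^ l • (B (k - l)).mulVec (y l))]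

variable [DecidableEq n]

theorem norm_det_mul_norm_le {k : Type*} [NormedField k] {M : Matrix n n k} {a : ℝ} (ha : 0 ≤ a)
    (hM : ∀ i j, ‖M.adjugate i j‖ ≤ a) (v : n → k) :
    ‖M.det‖ * ‖v‖ ≤ Fintype.card n * a * ‖M.mulVec v‖ := by
  rw [← norm_smul, show M.det • v = M.adjugate.mulVec (M.mulVec v) by
    rw [Matrix.mulVec_mulVec, Matrix.adjugate_mul, Matrix.smul_mulVec, Matrix.one_mulVec]]
  exact norm_mulVec_le ha hM _

/-- The numbers `α - q ^ (k + 1) * z` do not vanish, and the inverses of their partial products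
grow at most geometrically. -/
def SmallDivisors (q : ℂˣ) (z α : ℂ) : Prop :=
  (∀ k : ℕ, (q : ℂ) ^ (k + 1) * z ≠ α) ∧
    Converges fun n => (∏ k ∈ Finset.range n, (α - (q : ℂ) ^ (k + 1) * z))⁻¹

variable {q : ℂˣ}

theorem norm_det_smul_sub (hq : ‖(q : ℂ)‖ = 1) (A : Matrix n n ℂ) (α : ℂ) (k : ℕ) :
    ‖((q : ℂ) ^ k • A - Matrix.scalar n α).det‖ =
      (A.charpoly.roots.map fun z => ‖α - (q : ℂ) ^ k * z‖).prod := by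
  have hk : (q : ℂ) ^ k ≠ 0 := pow_ne_zero _ q.ne_zero
  have hs := IsAlgClosed.splits A.charpoly
  have e : (q : ℂ) ^ k • A - Matrix.scalar n α =
      (-(q : ℂ) ^ k) • (Matrix.scalar n (α / (q : ℂ) ^ k) - A) := by
    ext i j
    by_cases h : i = j
    · subst h
      simp
      field_simp
      ring
    · simp [h]
  rw [e, Matrix.det_smul, ← Matrix.eval_charpoly, hs.eval_eq_prod_roots_of_monic A.charpoly_monic,
    norm_mul, norm_pow, norm_neg, norm_pow, hq, one_pow, one_pow, one_mul]
  refine (Multiset.prod_hom _ (normHom : ℂ →*₀ ℝ)).symm.trans ?_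
  rw [Multiset.map_map]
  refine congrArg _ (Multiset.map_congr rfl fun z _ => ?_)
  have : α / (q : ℂ) ^ k - z = (α - (q : ℂ) ^ k * z) / (q : ℂ) ^ k := by field_simp
  simp [this, hq]

theorem det_smul_sub_ne_zero (hq : ‖(q : ℂ)‖ = 1) {A : Matrix n n ℂ} {α : ℂ}
    (hα : ∀ z ∈ A.charpoly.roots, SmallDivisors q z α) (k : ℕ) :
    ((q : ℂ) ^ (k + 1) • A - Matrix.scalar n α).det ≠ 0 := by
  rw [← norm_ne_zero_iff, norm_det_smul_sub hq]
  refine Multiset.prod_ne_zero fun h0 => ?_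
  obtain ⟨z, hz, h0⟩ := Multiset.mem_map.1 h0
  exact (hα z hz).1 k (sub_eq_zero.1 (norm_eq_zero.1 h0)).symm

theorem converges_inv_prod_det (hq : ‖(q : ℂ)‖ = 1) {A : Matrix n n ℂ} {α : ℂ}
    (hα : ∀ z ∈ A.charpoly.roots, SmallDivisors q z α) :
    Converges fun m =>
      (∏ k ∈ Finset.range m, ((q : ℂ) ^ (k + 1) • A - Matrix.scalar n α).det)⁻¹ := by
  obtain ⟨r, hr, hs⟩ := converges_multiset_prod A.charpoly.roots fun z hz => (hα z hz).2
  refine ⟨r, hr, hs.congr fun m => ?_⟩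
  beta_reduce
  rw [Multiset.prod_map_inv, norm_inv, norm_inv, norm_prod, Multiset.prod_map_prod, norm_prod]
  simp_rw [norm_det_smul_sub hq]
  congr 2
  refine Finset.prod_congr rfl fun k _ => ?_
  refine (Multiset.prod_hom _ (normHom : ℂ →*₀ ℝ)).symm.trans ?_
  rw [Multiset.map_map]
  rfl

theorem converges_of_recursion (hq : ‖(q : ℂ)‖ = 1) {B : ℕ → Matrix n n ℂ}
    (hB : ∀ i j, Converges fun k => B k i j) {y g : ℕ → n → ℂ}
    (hg : ∀ i, Converges fun k => g k i) {α : ℂ}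
    (hα : ∀ z ∈ (B 0).charpoly.roots, SmallDivisors q z α)
    (h : ∀ k, ((q : ℂ) ^ k • B 0 - Matrix.scalar n α).mulVec (y k) =
      g k - ∑ l ∈ Finset.range k, (q : ℂ) ^ l • (B (k - l)).mulVec (y l)) (i : n) :
    Converges fun k => y k i := by
  set T : ℕ → Matrix n n ℂ := fun k => (q : ℂ) ^ k • B 0 - Matrix.scalar n α
  obtain ⟨a, ha⟩ : ∃ a, ∀ k : ℕ, ‖fun p : n × n => (T k).adjugate p.1 p.2‖ ≤ a :=
    exists_norm_apply_pow_le hq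
      (f := fun (w : ℂ) (p : n × n) => (w • B 0 - Matrix.scalar n α).adjugate p.1 p.2) <|
      continuous_pi fun p => Continuous.matrix_elem (by fun_prop) p.1 p.2
  have ha0 : 0 ≤ a := (norm_nonneg _).trans (ha 0)
  have hadj (k i j) : ‖(T k).adjugate i j‖ ≤ a :=
    (norm_le_pi_norm (fun p : n × n => (T k).adjugate p.1 p.2) (i, j)).trans (ha k)
  obtain ⟨d, hd⟩ : ∃ d, ∀ k : ℕ, ‖(T k).det‖ ≤ d :=
    exists_norm_apply_pow_le hq (f := fun w : ℂ => (w • B 0 - Matrix.scalar n α).det) (by fun_prop)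
  obtain ⟨C, r, hC, hr, hbound⟩ := exists_uniform_bound
    (c := fun p : (n × n) ⊕ n => Sum.elim (fun p k => B k p.1 p.2) (fun i k => g k i) p)
    (by rintro (p | i); exacts [hB p.1 p.2, hg i])
  obtain ⟨A, R, hA, hR, hy⟩ := exists_le_geometric_of_convolution_bound (a := fun k => ‖y k‖)
    (fun k => norm_nonneg _) (det_smul_sub_ne_zero hq hα) (fun k => hd (k + 1))
    (converges_inv_prod_det hq hα)
    (C := Fintype.card n * a * (C * (1 + Fintype.card n))) (by positivity) hr fun k => by
      refine (norm_det_mul_norm_le ha0 (hadj (k + 1)) (y (k + 1))).trans ?_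
      rw [h, mul_assoc _ (C * _)]
      exact mul_le_mul_of_nonneg_left (norm_sub_sum_smul_mulVec_le hq hC.le hr.le
        (fun i j => hbound (Sum.inl (i, j))) (fun i => hbound (Sum.inr i)) _) (by positivity)
  exact converges_iff_bound.2 ⟨A, R, hA, hR, fun k => (norm_le_pi_norm _ i).trans (hy k)⟩

end Matrix

/-! ## Power series inside Laurent series -/

/-- The inclusion `ℂ⟦x⟧ → ℂ((x))`. -/
abbrev toLaurent : PowerSeries ℂ →+* LaurentSeries ℂ := HahnSeries.ofPowerSeries ℤ ℂ

theorem toLaurent_coeff_natCast (p : PowerSeries ℂ) (n : ℕ) :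
    (toLaurent p).coeff n = PowerSeries.coeff n p :=
  LaurentSeries.coeff_coe_powerSeries p n

theorem toLaurent_coeff_of_neg (p : PowerSeries ℂ) {n : ℤ} (hn : n < 0) :
    (toLaurent p).coeff n = 0 :=
  (PowerSeries.coeff_coe p n).trans (if_pos hn)

theorem exists_toLaurent_eq {f : LaurentSeries ℂ} (h : ∀ n : ℤ, n < 0 → f.coeff n = 0) :
    ∃ p, toLaurent p = f := by
  refine ⟨PowerSeries.mk fun n => f.coeff n, ?_⟩
  ext n
  rcases lt_or_ge n 0 with hn | hn
  · rw [toLaurent_coeff_of_neg _ hn, h n hn]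
  · lift n to ℕ using hn
    rw [toLaurent_coeff_natCast, PowerSeries.coeff_mk]

theorem toLaurent_mem_meroGerms_iff {p : PowerSeries ℂ} :
    toLaurent p ∈ meroGerms ↔ Converges fun n => PowerSeries.coeff n p := by
  change Converges _ ↔ _
  simp only [toLaurent_coeff_natCast]

theorem sigmaHat_toLaurent (q : ℂˣ) (p : PowerSeries ℂ) :
    sigmaHat q (toLaurent p) = toLaurent (PowerSeries.rescale (q : ℂ) p) := by
  ext n
  rw [sigmaHat_coeff]
  rcases lt_or_ge n 0 with hn | hn
  · rw [toLaurent_coeff_of_neg _ hn, toLaurent_coeff_of_neg _ hn, mul_zero]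
  · lift n to ℕ using hn
    rw [toLaurent_coeff_natCast, toLaurent_coeff_natCast, PowerSeries.coeff_rescale, zpow_natCast]

theorem rescale_C (a c : ℂ) : PowerSeries.rescale a (PowerSeries.C c) = PowerSeries.C c := by
  ext n
  rw [PowerSeries.coeff_rescale, PowerSeries.coeff_C]
  split_ifs with h <;> simp [h]

theorem toLaurent_C (c : ℂ) : toLaurent (PowerSeries.C c) = algebraMap ℂ (LaurentSeries ℂ) c :=
  HahnSeries.ofPowerSeries_C c

theorem single_mem_meroGerms (k : ℤ) : HahnSeries.single k (1 : ℂ) ∈ meroGerms := by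
  have := (converges_single_mul k 1).2 (one_mem meroGerms)
  rwa [mul_one] at this

theorem exists_toLaurent_eq_single_mul (f : LaurentSeries ℂ) :
    ∃ N₀ : ℕ, ∀ N : ℕ, N₀ ≤ N → ∃ p, toLaurent p = HahnSeries.single (N : ℤ) (1 : ℂ) * f := by
  refine ⟨f.order.natAbs, fun N hN => exists_toLaurent_eq fun n hn => ?_⟩
  rw [coeff_single_one_mul]
  exact HahnSeries.coeff_eq_zero_of_lt_order (by omega)

theorem toLaurent_polynomial_mem (p : Polynomial ℂ) :
    toLaurent (p : PowerSeries ℂ) ∈ meroGerms := by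
  rw [toLaurent_mem_meroGerms_iff]
  refine ⟨1, one_pos, summable_of_ne_finset_zero (s := p.support) fun n hn => ?_⟩
  simp [Polynomial.notMem_support_iff.1 hn]

/-! ## Regularity of formal equivalences with constant systems -/

section Matrix

variable {m n : Type*}

theorem exists_toLaurent_eq_single_mul_matrix [Finite m] [Finite n]
    (F : Matrix m n (LaurentSeries ℂ)) :
    ∃ N₀ : ℕ, ∀ N : ℕ, N₀ ≤ N → ∃ M : Matrix m n (PowerSeries ℂ),
      ∀ i j, toLaurent (M i j) = HahnSeries.single (N : ℤ) (1 : ℂ) * F i j := by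
  have := Fintype.ofFinite (m × n)
  choose N₀ h using fun p : m × n => exists_toLaurent_eq_single_mul (F p.1 p.2)
  refine ⟨∑ p, N₀ p, fun N hN => ?_⟩
  choose M hM using fun i j => h (i, j) N
    ((Finset.single_le_sum (fun _ _ => Nat.zero_le _) (Finset.mem_univ _)).trans hN)
  exact ⟨Matrix.of M, hM⟩

theorem map_constantCoeff_map_rescale {R : Type*} [CommSemiring R] (a : R)
    (M : Matrix m n (PowerSeries R)) :
    (M.map (PowerSeries.rescale a)).map PowerSeries.constantCoeff =
      M.map PowerSeries.constantCoeff := by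
  ext i j
  rw [Matrix.map_apply, Matrix.map_apply, Matrix.map_apply,
    ← PowerSeries.coeff_zero_eq_constantCoeff_apply, PowerSeries.coeff_rescale, pow_zero, one_mul,
    PowerSeries.coeff_zero_eq_constantCoeff_apply]

theorem map_sigmaHat_map_toLaurent (q : ℂˣ) (M : Matrix m n (PowerSeries ℂ)) :
    (M.map toLaurent).map (sigmaHat q) =
      (M.map (PowerSeries.rescale (q : ℂ))).map toLaurent := by
  ext i j : 1
  exact sigmaHat_toLaurent q _

variable [Fintype n] [DecidableEq n] {q : ℂˣ}

theorem mem_meroGerms_of_regular_system (hq : ‖(q : ℂ)‖ = 1) {B : Matrix n n (PowerSeries ℂ)}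
    (hB : ∀ i j, toLaurent (B i j) ∈ meroGerms) {y : n → PowerSeries ℂ} {α : ℂ}
    (hα : ∀ z ∈ (B.map PowerSeries.constantCoeff).charpoly.roots, SmallDivisors q z α)
    (hg : ∀ i, toLaurent (B.mulVec (fun j => PowerSeries.rescale (q : ℂ) (y j)) i -
      PowerSeries.C α * y i) ∈ meroGerms) (i : n) :
    toLaurent (y i) ∈ meroGerms := by
  simp only [toLaurent_mem_meroGerms_iff] at *
  set Bc : ℕ → Matrix n n ℂ := fun k => B.map (PowerSeries.coeff k)
  have hB0 : B.map PowerSeries.constantCoeff = Bc 0 := by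
    ext i j
    simp [Bc]
  rw [hB0] at hα
  refine converges_of_recursion (B := Bc) (y := fun k i => PowerSeries.coeff k (y i)) hq hB hg hα
    (fun k => funext fun i => ?_) i
  have e : PowerSeries.coeff k (B.mulVec (fun j => PowerSeries.rescale (q : ℂ) (y j)) i) =
      ∑ l ∈ Finset.range (k + 1), (q : ℂ) ^ l *
        (Bc (k - l)).mulVec (fun i => PowerSeries.coeff l (y i)) i := by
    rw [← Finset.sum_range_reflect]
    simp only [Matrix.mulVec, dotProduct, map_sum, PowerSeries.coeff_mul]
    rw [Finset.sum_comm, Finset.Nat.sum_antidiagonal_eq_sum_range_succ_mk]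
    refine Finset.sum_congr rfl fun l hl => ?_
    have hl := Finset.mem_range_succ_iff.1 hl
    rw [show k + 1 - 1 - l = k - l by omega, Finset.mul_sum, show k - (k - l) = l by omega]
    refine Finset.sum_congr rfl fun j _ => ?_
    simp [Bc, PowerSeries.coeff_rescale]
    ring
  rw [Pi.sub_apply, map_sub, e, Finset.sum_range_succ, Nat.sub_self, Matrix.sub_mulVec,
    Finset.sum_apply]
  simp [Matrix.smul_mulVec, Matrix.scalar_apply]
  ring

theorem rescale_mulVec_C_sub {B H : Matrix n n (PowerSeries ℂ)} {A : Matrix n n ℂ}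
    (h : B * H.map (PowerSeries.rescale (q : ℂ)) = H * A.map PowerSeries.C) (α : ℂ) (c : n → ℂ) :
    (B.mulVec fun j => PowerSeries.rescale (q : ℂ) (H.mulVec (PowerSeries.C ∘ c) j)) -
        PowerSeries.C α • H.mulVec (PowerSeries.C ∘ c) =
      H.mulVec (PowerSeries.C ∘ (A - Matrix.scalar n α).mulVec c) := by
  have hσ : (fun j => PowerSeries.rescale (q : ℂ) (H.mulVec (PowerSeries.C ∘ c) j)) =
      (H.map (PowerSeries.rescale (q : ℂ))).mulVec (PowerSeries.C ∘ c) := by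
    funext j
    simp [Matrix.mulVec, dotProduct, rescale_C]
  have hA : PowerSeries.C ∘ (A - Matrix.scalar n α).mulVec c =
      (A.map PowerSeries.C).mulVec (PowerSeries.C ∘ c) -
        (PowerSeries.C α : PowerSeries ℂ) • (PowerSeries.C ∘ c) := by
    funext j
    rw [Function.comp_apply, Matrix.sub_mulVec]
    simp [Matrix.mulVec, dotProduct]
  rw [hσ, Matrix.mulVec_mulVec, h, hA, Matrix.mulVec_sub, Matrix.mulVec_mulVec, Matrix.mulVec_smul]

-- Each factor `A - α` turns `H c` into an equation `B σ(y) = α y + g` with `g` already known to be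
-- meromorphic.
theorem mem_meroGerms_of_aeval_mulVec_eq_zero (hq : ‖(q : ℂ)‖ = 1) {A : Matrix n n ℂ}
    {B H : Matrix n n (PowerSeries ℂ)} (hB : ∀ i j, toLaurent (B i j) ∈ meroGerms)
    (hB0 : B.map PowerSeries.constantCoeff = A)
    (h : B * H.map (PowerSeries.rescale (q : ℂ)) = H * A.map PowerSeries.C) (s : Multiset ℂ)
    (hs : ∀ α ∈ s, ∀ z ∈ A.charpoly.roots, SmallDivisors q z α) (c : n → ℂ)
    (hc : (Polynomial.aeval A
      (s.map fun α => Polynomial.X - Polynomial.C α).prod).mulVec c = 0) (i : n) :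
    toLaurent (H.mulVec (PowerSeries.C ∘ c) i) ∈ meroGerms := by
  induction s using Multiset.induction_on generalizing c i with
  | empty =>
    have hc0 : c = 0 := by simpa using hc
    simp [hc0, Matrix.mulVec, dotProduct, zero_mem]
  | cons α s ih =>
    have hmem := ih (fun β hβ => hs β (Multiset.mem_cons_of_mem hβ))
      ((A - Matrix.scalar n α).mulVec c) (by
        rw [Multiset.map_cons, Multiset.prod_cons, mul_comm, map_mul, ← Matrix.mulVec_mulVec] at hc
        simpa [Matrix.algebraMap_eq_diagonal, Pi.algebraMap_def] using hc)
    refine mem_meroGerms_of_regular_system hq hB (α := α) ?_ (fun i => ?_) i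
    · rw [hB0]
      exact hs α (Multiset.mem_cons_self α s)
    · rw [← smul_eq_mul, ← Pi.smul_apply, ← Pi.sub_apply, rescale_mulVec_C_sub h]
      exact hmem i

theorem mem_meroGerms_of_gauge (hq : ‖(q : ℂ)‖ = 1) {A : Matrix n n ℂ}
    (hA : ∀ z ∈ A.charpoly.roots, ∀ α ∈ A.charpoly.roots, SmallDivisors q z α)
    {B H : Matrix n n (PowerSeries ℂ)} (hB : ∀ i j, toLaurent (B i j) ∈ meroGerms)
    (hB0 : B.map PowerSeries.constantCoeff = A)
    (h : B * H.map (PowerSeries.rescale (q : ℂ)) = H * A.map PowerSeries.C) (i j : n) :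
    toLaurent (H i j) ∈ meroGerms := by
  have hcayley : (Polynomial.aeval A (A.charpoly.roots.map fun α =>
      Polynomial.X - Polynomial.C α).prod) = 0 := by
    rw [← (IsAlgClosed.splits A.charpoly).eq_prod_roots_of_monic A.charpoly_monic]
    exact A.aeval_self_charpoly
  have hmem := mem_meroGerms_of_aeval_mulVec_eq_zero hq hB hB0 h A.charpoly.roots
    (fun α hα z hz => hA z hz α hα) (Pi.single j 1) (by rw [hcayley, Matrix.zero_mulVec]) i
  have hsingle : PowerSeries.C ∘ (Pi.single j 1 : n → ℂ) = Pi.single j 1 := by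
    ext1 k
    simp [Pi.single_apply, apply_ite PowerSeries.C]
  rwa [hsingle, Matrix.mulVec_single_one] at hmem

theorem exists_polynomial_matrix_eq_mul {k : Type*} [Field k]
    {F G : Matrix n n (PowerSeries k)} {N : ℕ}
    (h : F * G = (PowerSeries.X ^ N : PowerSeries k) • 1)
    (h' : G * F = (PowerSeries.X ^ N : PowerSeries k) • 1) :
    ∃ (P : Matrix n n (Polynomial k)) (J : Matrix n n (PowerSeries k)),
      J.map PowerSeries.constantCoeff = 1 ∧ IsUnit J.det ∧
        P.map (fun p => (p : PowerSeries k)) = F * J := by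
  have hdvd (i j) : ∃ r, F i j -
      ((PowerSeries.trunc (N + 1) (F i j) : Polynomial k) : PowerSeries k) =
        PowerSeries.X ^ (N + 1) * r := by
    refine PowerSeries.X_pow_dvd_iff.2 fun m hm => ?_
    rw [map_sub, PowerSeries.coeff_coe_trunc_of_lt hm, sub_self]
  choose R hR using hdvd
  set P : Matrix n n (Polynomial k) := Matrix.of fun i j => PowerSeries.trunc (N + 1) (F i j)
  have hR' : P.map (fun p => (p : PowerSeries k)) =
      F - (PowerSeries.X ^ (N + 1) : PowerSeries k) • Matrix.of R := by
    ext i j : 1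
    simp [← hR, P]
  set J : Matrix n n (PowerSeries k) := 1 - (PowerSeries.X : PowerSeries k) • (G * Matrix.of R)
    with hJ
  have hGP : G * P.map (fun p => (p : PowerSeries k)) =
      (PowerSeries.X ^ N : PowerSeries k) • J := by
    rw [hR', Matrix.mul_sub, h', Matrix.mul_smul, hJ, smul_sub, smul_smul, pow_succ]
  have hJ0 : J.map PowerSeries.constantCoeff = 1 := by
    ext i j
    simp [hJ, Matrix.one_apply]
  refine ⟨P, J, hJ0, ?_, ?_⟩
  · rw [PowerSeries.isUnit_iff_constantCoeff, RingHom.map_det, RingHom.mapMatrix_apply, hJ0]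
    simp
  · have e : (PowerSeries.X ^ N : PowerSeries k) • P.map (fun p => (p : PowerSeries k)) =
        (PowerSeries.X ^ N : PowerSeries k) • (F * J) := by
      rw [← Matrix.mul_smul, ← hGP, ← Matrix.mul_assoc, h, Matrix.smul_mul, Matrix.one_mul]
    ext i j : 1
    exact mul_left_cancel₀ (pow_ne_zero _ PowerSeries.X_ne_zero) (congrFun (congrFun e i) j)

theorem mul_eq_X_pow_smul_one {F G : Matrix n n (LaurentSeries ℂ)} (hFG : F * G = 1) {N : ℕ}
    {F' G' : Matrix n n (PowerSeries ℂ)}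
    (hF : ∀ i j, toLaurent (F' i j) = HahnSeries.single (N : ℤ) (1 : ℂ) * F i j)
    (hG : ∀ i j, toLaurent (G' i j) = HahnSeries.single (N : ℤ) (1 : ℂ) * G i j) :
    F' * G' = (PowerSeries.X ^ (2 * N) : PowerSeries ℂ) • 1 := by
  have hX : toLaurent (PowerSeries.X ^ (2 * N)) =
      HahnSeries.single (N : ℤ) (1 : ℂ) * HahnSeries.single (N : ℤ) (1 : ℂ) := by
    rw [two_mul, pow_add, map_mul, HahnSeries.ofPowerSeries_X_pow]
  ext i j : 1
  refine HahnSeries.ofPowerSeries_injective (Γ := ℤ) (R := ℂ) ?_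
  have e : ∀ k, toLaurent (F' i k * G' k j) = HahnSeries.single (N : ℤ) (1 : ℂ) *
      HahnSeries.single (N : ℤ) (1 : ℂ) * (F i k * G k j) := fun k => by
    rw [map_mul, hF, hG, mul_mul_mul_comm]
  change toLaurent _ = toLaurent _
  rw [Matrix.smul_apply, smul_eq_mul, map_mul, hX, Matrix.mul_apply, map_sum,
    Finset.sum_congr rfl fun k _ => e k, ← Finset.mul_sum, ← Matrix.mul_apply, hFG,
    Matrix.one_apply, Matrix.one_apply, apply_ite toLaurent, map_one toLaurent, map_zero toLaurent]

theorem exists_eq_mul_of_mul_eq_one {F G : Matrix n n (LaurentSeries ℂ)} (hFG : F * G = 1) :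
    ∃ (P : Matrix n n meroGerms) (J H : Matrix n n (PowerSeries ℂ)), P.det ≠ 0 ∧ H * J = 1 ∧
      J.map PowerSeries.constantCoeff = 1 ∧ F = P.map meroGerms.subtype * H.map toLaurent := by
  obtain ⟨N₁, h₁⟩ := exists_toLaurent_eq_single_mul_matrix F
  obtain ⟨N₂, h₂⟩ := exists_toLaurent_eq_single_mul_matrix G
  obtain ⟨Ft, hFt⟩ := h₁ (N₁ + N₂) (Nat.le_add_right N₁ N₂)
  obtain ⟨Gt, hGt⟩ := h₂ (N₁ + N₂) (Nat.le_add_left N₂ N₁)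
  obtain ⟨Pt, J, hJ0, hJdet, hPJ⟩ := exists_polynomial_matrix_eq_mul
    (mul_eq_X_pow_smul_one hFG hFt hGt) (mul_eq_X_pow_smul_one (mul_eq_one_comm.1 hFG) hGt hFt)
  set t : LaurentSeries ℂ := HahnSeries.single ((N₁ + N₂ : ℕ) : ℤ) (1 : ℂ) with ht
  have ht0 : t ≠ 0 := by simp [ht]
  have hPK : ∀ i j, t⁻¹ * toLaurent (Pt i j : PowerSeries ℂ) ∈ meroGerms := fun i j =>
    mul_mem (inv_mem (single_mem_meroGerms _)) (toLaurent_polynomial_mem _)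
  set P : Matrix n n meroGerms := Matrix.of fun i j => ⟨_, hPK i j⟩
  have hF : F = P.map meroGerms.subtype * J⁻¹.map toLaurent := by
    ext i j : 1
    have e : Pt.map (fun p => (p : PowerSeries ℂ)) * J⁻¹ = Ft := by
      rw [hPJ, Matrix.mul_nonsing_inv_cancel_right _ _ hJdet]
    rw [eq_inv_mul_iff_mul_eq₀ ht0 |>.2 (hFt i j).symm, ← e, Matrix.mul_apply, Matrix.mul_apply,
      map_sum, Finset.mul_sum]
    refine Finset.sum_congr rfl fun k _ => ?_
    rw [map_mul, ← mul_assoc]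
    rfl
  refine ⟨P, J, J⁻¹, fun h0 => ?_, Matrix.nonsing_inv_mul _ hJdet, hJ0, hF⟩
  have h1 : F.det = 0 := by
    rw [hF, Matrix.det_mul, ← RingHom.mapMatrix_apply, ← RingHom.map_det, h0, map_zero, zero_mul]
  have h2 := congrArg Matrix.det hFG
  rw [Matrix.det_mul, h1, zero_mul, Matrix.det_one] at h2
  exact zero_ne_one h2

theorem map_toLaurent_gauge_eq {A : Matrix n n ℂ} {P B : Matrix n n meroGerms} (hP : P.det ≠ 0)
    {H J : Matrix n n (PowerSeries ℂ)} (hHJ : H * J = 1)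
    (h : B.map meroGerms.subtype * (P.map meroGerms.subtype * H.map toLaurent).map (sigmaHat q) =
      P.map meroGerms.subtype * H.map toLaurent * A.map (algebraMap ℂ (LaurentSeries ℂ))) :
    (H * A.map PowerSeries.C * J.map (PowerSeries.rescale (q : ℂ))).map toLaurent =
      (P⁻¹ * B * P.map (sigma q)).map meroGerms.subtype := by
  have hPinv : (P⁻¹).map meroGerms.subtype * P.map meroGerms.subtype = 1 := by
    rw [← Matrix.map_mul, Matrix.nonsing_inv_mul _ hP.isUnit]
    simp
  have hHJσ : (H.map (PowerSeries.rescale (q : ℂ))).map toLaurent *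
      (J.map (PowerSeries.rescale (q : ℂ))).map toLaurent = 1 := by
    rw [← Matrix.map_mul, ← Matrix.map_mul, hHJ]
    simp
  have hσP : (P.map meroGerms.subtype).map (sigmaHat q) =
      (P.map (sigma q)).map meroGerms.subtype := rfl
  have hAC : (A.map PowerSeries.C).map toLaurent = A.map (algebraMap ℂ (LaurentSeries ℂ)) := by
    ext i j : 1
    exact toLaurent_C _
  rw [Matrix.map_mul, hσP, map_sigmaHat_map_toLaurent] at h
  calc (H * A.map PowerSeries.C * J.map (PowerSeries.rescale (q : ℂ))).map toLaurent
      = (P⁻¹).map meroGerms.subtype * (P.map meroGerms.subtype * H.map toLaurent *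
          A.map (algebraMap ℂ (LaurentSeries ℂ))) *
            (J.map (PowerSeries.rescale (q : ℂ))).map toLaurent := by
        rw [Matrix.map_mul, Matrix.map_mul, hAC, Matrix.mul_assoc (P.map _), ← Matrix.mul_assoc,
          ← Matrix.mul_assoc, hPinv, Matrix.one_mul]
    _ = (P⁻¹).map meroGerms.subtype * B.map meroGerms.subtype *
          (P.map (sigma q)).map meroGerms.subtype * ((H.map (PowerSeries.rescale (q : ℂ))).map
            toLaurent * (J.map (PowerSeries.rescale (q : ℂ))).map toLaurent) := by
        rw [← h]
        simp only [Matrix.mul_assoc]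
    _ = _ := by rw [hHJσ, Matrix.mul_one, ← Matrix.map_mul, ← Matrix.map_mul]

theorem mem_meroGerms_of_formal_equivalence (hq : ‖(q : ℂ)‖ = 1) {A : Matrix n n ℂ}
    (hA : ∀ z ∈ A.charpoly.roots, ∀ α ∈ A.charpoly.roots, SmallDivisors q z α)
    {B : Matrix n n meroGerms} {F G : Matrix n n (LaurentSeries ℂ)} (hFG : F * G = 1)
    (h : B.map meroGerms.subtype * F.map (sigmaHat q) =
      F * A.map (algebraMap ℂ (LaurentSeries ℂ))) (i j : n) :
    F i j ∈ meroGerms := by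
  obtain ⟨P, J, H, hP, hHJ, hJ0, rfl⟩ := exists_eq_mul_of_mul_eq_one hFG
  set C := H * A.map PowerSeries.C * J.map (PowerSeries.rescale (q : ℂ))
  have hCmem (i j) : toLaurent (C i j) ∈ meroGerms := by
    rw [← Matrix.map_apply (f := toLaurent), map_toLaurent_gauge_eq hP hHJ h]
    exact Subtype.property _
  have hH0 : H.map PowerSeries.constantCoeff = 1 := by
    have h0 := congrArg (fun M => M.map PowerSeries.constantCoeff) hHJ
    rw [Matrix.map_mul, hJ0, Matrix.mul_one] at h0
    rw [h0, Matrix.map_one _ (map_zero _) (map_one _)]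
  have hC0 : C.map PowerSeries.constantCoeff = A := by
    rw [Matrix.map_mul, Matrix.map_mul, hH0, map_constantCoeff_map_rescale, hJ0, Matrix.one_mul,
      Matrix.mul_one]
    ext i j
    simp
  have hJH : J.map (PowerSeries.rescale (q : ℂ)) * H.map (PowerSeries.rescale (q : ℂ)) = 1 := by
    rw [← Matrix.map_mul, mul_eq_one_comm.1 hHJ]
    simp
  have hHmem := mem_meroGerms_of_gauge hq hA hCmem hC0
    (by rw [Matrix.mul_assoc, hJH, Matrix.mul_one])
  rw [Matrix.mul_apply]
  exact sum_mem fun k _ => mul_mem (P i k).2 (hHmem k j)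

end Matrix

/-! ## Condition `(D)` implies formal rigidity -/

section ConditionD

variable {q : ℂˣ}

theorem qPoch_ne_zero {a q : ℂ} (h : ∀ k : ℕ, q ^ k * a ≠ 1) (n : ℕ) : qPoch a q n ≠ 0 :=
  Finset.prod_ne_zero_iff.2 fun k _ => sub_ne_zero.2 (h k).symm

theorem qPoch_succ (a q : ℂ) (n : ℕ) : qPoch a q (n + 1) = qPoch a q n * (1 - q ^ n * a) :=
  Finset.prod_range_succ _ _

theorem qPoch_succ' (a q : ℂ) (n : ℕ) : qPoch a q (n + 1) = (1 - a) * qPoch (q * a) q n := by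
  rw [qPoch, Finset.prod_range_succ', pow_zero, one_mul, mul_comm, qPoch]
  simp only [pow_succ, mul_assoc]

theorem converges_qPoch (hq : ‖(q : ℂ)‖ = 1) (a : ℂ) : Converges (qPoch a q) := by
  refine converges_iff_bound.2 ⟨1, 1 + ‖a‖, zero_le_one, by positivity, fun n => ?_⟩
  have hfactor (k : ℕ) : ‖1 - (q : ℂ) ^ k * a‖ ≤ 1 + ‖a‖ := by
    refine (norm_sub_le _ _).trans ?_
    rw [norm_mul, norm_pow, hq, one_pow, one_mul, norm_one]
  rw [qPoch, norm_prod, one_mul]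
  exact (Finset.prod_le_prod (fun k _ => norm_nonneg _) fun k _ => hfactor k).trans (by simp)

theorem mem_ratios_iff {S : Finset ℂˣ} {l : ℂˣ} :
    l ∈ ratios q S ↔ (∃ a ∈ S, ∃ b ∈ S, a * b⁻¹ = l) ∧ ∀ k : ℤ, k ≤ 0 → l ≠ q ^ k := by
  classical
  simp only [ratios, Finset.mem_filter, Finset.mem_image, Finset.mem_product, Prod.exists]
  refine and_congr_left fun _ => ⟨?_, ?_⟩
  · rintro ⟨a, b, ⟨ha, hb⟩, h⟩
    exact ⟨a, ha, b, hb, h⟩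
  · rintro ⟨a, ha, b, hb, h⟩
    exact ⟨a, b, ⟨ha, hb⟩, h⟩

theorem pow_mul_ne_one_of_mem_ratios {S : Finset ℂˣ} {l : ℂˣ} (hl : l ∈ ratios q S) (k : ℕ) :
    (q : ℂ) ^ k * l ≠ 1 := by
  intro h
  have hkl : q ^ k * l = 1 := Units.ext (by simpa using h)
  refine (mem_ratios_iff.1 hl).2 (-k) (by simp) ?_
  rw [zpow_neg, zpow_natCast]
  exact eq_inv_of_mul_eq_one_right hkl

theorem converges_inv_qPoch_of_mem_ratios (hq : ‖(q : ℂ)‖ = 1) {S : Finset ℂˣ}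
    (h : Converges (phiCoeff q (ratios q S))) {l : ℂˣ} (hl : l ∈ ratios q S) :
    Converges fun n => (qPoch l q n)⁻¹ := by
  classical
  have hothers := converges_multiset_prod ((ratios q S).erase l).val
    (c := fun m n => qPoch m q n) fun m _ => converges_qPoch hq m
  convert h.mul_apply hothers using 2 with n
  rw [phiCoeff, ← Finset.mul_prod_erase _ _ hl, mul_inv, mul_assoc]
  change _ = _ * (_ * ∏ x ∈ (ratios q S).erase l, qPoch x q n)
  rw [inv_mul_cancel₀, mul_one]
  exact Finset.prod_ne_zero_iff.2 fun m hm =>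
    qPoch_ne_zero (pow_mul_ne_one_of_mem_ratios (Finset.mem_of_mem_erase hm)) n

theorem converges_inv_prod_sub {q z α : ℂ} (hα : α ≠ 0)
    (h : Converges fun n => (qPoch (q * (z / α)) q n)⁻¹) :
    Converges fun n => (∏ k ∈ Finset.range n, (α - q ^ (k + 1) * z))⁻¹ := by
  convert h.mul_apply (converges_pow α⁻¹) using 2 with n
  rw [inv_pow, ← mul_inv, qPoch, ← Finset.card_range n, ← Finset.prod_const, Finset.card_range,
    ← Finset.prod_mul_distrib]
  refine congrArg _ (Finset.prod_congr rfl fun k _ => ?_)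
  field_simp
  ring

theorem bijOn_coe_image_rep [DecidableEq ℂˣ] (s : Finset (CModQ q)) :
    Set.BijOn (fun l : ℂˣ => (l : CModQ q)) (s.image (rep q)) s := by
  have hleft : Function.LeftInverse (fun l : ℂˣ => (l : CModQ q)) (rep q) := coe_rep q
  rw [Finset.coe_image]
  refine hleft.injective.injOn.bijOn_image.symm ⟨?_, fun c _ => hleft c⟩
  rintro _ ⟨c, _, rfl⟩
  exact congrArg (rep q) (hleft c)

theorem smallDivisors_of_conditionD (hq : ‖(q : ℂ)‖ = 1) (hroot : ¬ IsOfFinOrder q)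
    (hconv : Converges fun n => (qPoch q q n)⁻¹) {V : GrNil.{u} q} (hV : ConditionD q V)
    {c d : CModQ q} (hc : V.comp c ≠ ⊥) (hd : V.comp d ≠ ⊥) :
    SmallDivisors q (rep q c) (rep q d) := by
  classical
  refine ⟨fun k h => zpow_mul_rep_ne_rep hroot (n := k + 1) (by omega) c d (by exact_mod_cast h),
    converges_inv_prod_sub (rep q d).ne_zero ?_⟩
  rcases eq_or_ne c d with rfl | hcd
  · rwa [div_self (rep q c).ne_zero, mul_one]
  set S : Finset ℂˣ := V.finite_comp_ne_bot.toFinset.image (rep q)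
  have hmemS (a) (ha : V.comp a ≠ ⊥) : rep q a ∈ S :=
    Finset.mem_image_of_mem _ ((Set.Finite.mem_toFinset _).2 ha)
  have hbij : Set.BijOn (fun l : ℂˣ => (l : CModQ q)) S {c | V.comp c ≠ ⊥} := by
    simpa only [Set.Finite.coe_toFinset] using bijOn_coe_image_rep V.finite_comp_ne_bot.toFinset
  set l : ℂˣ := rep q c * (rep q d)⁻¹ with hl_def
  have hl : l ∈ ratios q S := by
    refine mem_ratios_iff.2 ⟨⟨_, hmemS c hc, _, hmemS d hd, rfl⟩, fun k _ h => hcd ?_⟩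
    rw [← coe_rep q c, ← coe_rep q d, eq_comm]
    exact coe_eq_coe_iff_exists_zpow.2 ⟨k, mul_inv_eq_iff_eq_mul.1 h⟩
  have hl1 : (1 : ℂ) - l ≠ 0 := fun h0 =>
    pow_mul_ne_one_of_mem_ratios hl 0 (by rw [pow_zero, one_mul, ← sub_eq_zero.1 h0])
  have h := converges_succ.2 (converges_inv_qPoch_of_mem_ratios hq (hV S hbij) hl)
  convert h.const_mul (1 - l) using 2 with n
  rw [qPoch_succ', mul_inv, mul_inv_cancel_left₀ hl1, hl_def, Units.val_mul,
    Units.val_inv_eq_inv_val, div_eq_mul_inv]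

theorem finrank_eq_of_formalization_iso {M N : Bq.{u} q} (e : formalization M ≅ formalization N) :
    Module.finrank meroGerms M.carrier = Module.finrank meroGerms N.carrier := by
  have hM : Module.finrank (LaurentSeries ℂ) (formalization M).carrier =
    Module.finrank meroGerms M.carrier := Module.finrank_baseChange
  have hN : Module.finrank (LaurentSeries ℂ) (formalization N).carrier =
    Module.finrank meroGerms N.carrier := Module.finrank_baseChange
  rw [← hM, ← hN, (DiffModule.linearEquivOfIso e).finrank_eq]

theorem nonempty_iso_of_formal_matrix {n : Type*} [Fintype n] [DecidableEq n] {M N : Bq.{u} q}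
    (b : Module.Basis n meroGerms M.carrier) (b' : Module.Basis n meroGerms N.carrier)
    {T T' : Matrix n n (LaurentSeries ℂ)} (hT : T * T' = 1)
    (h : (DiffModule.sigMatrix b').map meroGerms.subtype * T.map (sigmaHat q) =
      T * (DiffModule.sigMatrix b).map meroGerms.subtype)
    (hmem : ∀ i j, T i j ∈ meroGerms) : Nonempty (M ≅ N) := by
  obtain ⟨U, rfl⟩ : ∃ U : Matrix n n meroGerms, U.map meroGerms.subtype = T :=
    ⟨.of fun i j => ⟨T i j, hmem i j⟩, rfl⟩
  have hdet : U.det ≠ 0 := fun h0 => by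
    have h1 := congrArg Matrix.det hT
    rw [Matrix.det_mul, ← RingHom.mapMatrix_apply, ← RingHom.map_det, h0, map_zero, zero_mul,
      Matrix.det_one] at h1
    exact zero_ne_one h1
  refine DiffModule.nonempty_iso_of_matrix b b' (Matrix.mul_nonsing_inv U hdet.isUnit) ?_
  refine Matrix.map_injective (f := meroGerms.subtype) Subtype.val_injective ?_
  simp only [Matrix.map_mul]
  exact h

theorem inIso_of_conditionD (hq : ‖(q : ℂ)‖ = 1) (hroot : ¬ IsOfFinOrder q)
    (hconv : Converges fun n => (qPoch q q n)⁻¹) {V : GrNil.{u} q} (hV : ConditionD q V) :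
    InIso q (analyticModule q V.twistEquiv) := by
  rintro N ⟨e⟩
  have hrank : Module.finrank ℂ V.carrier = Module.finrank meroGerms N.carrier := by
    rw [finrank_eq_of_formalization_iso e]
    exact Module.finrank_baseChange.symm
  let v : Module.Basis (Fin (Module.finrank meroGerms N.carrier)) ℂ V.carrier :=
    Module.finBasisOfFinrankEq _ _ hrank
  let b := Module.finBasis meroGerms N.carrier
  set A := LinearMap.toMatrix v v V.twist with hA
  have hroots : ∀ z ∈ A.charpoly.roots, ∃ c, V.comp c ≠ ⊥ ∧ z = rep q c := fun z hz => by
    refine V.exists_eq_rep_of_hasEigenvalue_twist ?_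
    rw [hA, LinearMap.charpoly_toMatrix] at hz
    exact (Module.End.hasEigenvalue_iff_isRoot_charpoly _ _).2 (Polynomial.isRoot_of_mem_roots hz)
  have hdiv : ∀ z ∈ A.charpoly.roots, ∀ α ∈ A.charpoly.roots, SmallDivisors q z α := by
    intro z hz α hα
    obtain ⟨c, hc, rfl⟩ := hroots z hz
    obtain ⟨d, hd, rfl⟩ := hroots α hα
    exact smallDivisors_of_conditionD hq hroot hconv hV hc hd
  obtain ⟨F, G, hFG, h⟩ := DiffModule.exists_matrix_of_iso e.symm
    (formalizationBasis (analyticBasis q V.twistEquiv v)) (formalizationBasis b)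
  have hmem : ∀ i j, F i j ∈ meroGerms := by
    rw [sigMatrix_formalizationBasis_analyticBasis, sigMatrix_formalizationBasis] at h
    exact mem_meroGerms_of_formal_equivalence hq hdiv hFG h
  rw [sigMatrix_formalizationBasis, sigMatrix_formalizationBasis] at h
  obtain ⟨i⟩ := nonempty_iso_of_formal_matrix _ b hFG h hmem
  exact ⟨i.symm⟩

end ConditionD

/-! ## Formal rigidity implies condition `(D)` -/

section SingleDivisor

theorem Converges.rescale {w : ℂ} (hw : ‖w‖ = 1) {f : PowerSeries ℂ}
    (hf : Converges fun n => PowerSeries.coeff n f) :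
    Converges fun n => PowerSeries.coeff n (PowerSeries.rescale w f) := by
  obtain ⟨r, hr, hs⟩ := hf
  exact ⟨r, hr, by simpa [PowerSeries.coeff_rescale, hw] using hs⟩

/-- The `q`-exponential series `∑ x^n / (q;q)_n`. -/
def qExp (q : ℂ) : PowerSeries ℂ :=
  PowerSeries.mk fun n => (qPoch q q n)⁻¹

theorem one_sub_X_mul_qExp {q : ℂ} (hq : ∀ n : ℕ, q ^ n * q ≠ 1) :
    (1 - PowerSeries.X) * qExp q = PowerSeries.rescale q (qExp q) := by
  ext n
  rw [sub_mul, one_mul, map_sub, PowerSeries.coeff_rescale]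
  rcases n with _ | n
  · simp
  · rw [PowerSeries.coeff_succ_X_mul, qExp, PowerSeries.coeff_mk, PowerSeries.coeff_mk, qPoch_succ,
      mul_inv, pow_succ]
    have := sub_ne_zero.2 (hq n).symm
    field_simp
    ring

theorem coeff_eq_inv_qPoch {q a : ℂ} (ha : ∀ n : ℕ, q ^ n * a ≠ 1) {y : PowerSeries ℂ}
    (hy : (1 - PowerSeries.X) * y =
      PowerSeries.C a * PowerSeries.rescale q y + PowerSeries.C (1 - a)) (n : ℕ) :
    PowerSeries.coeff n y = (qPoch (q * a) q n)⁻¹ := by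
  have hn := congrArg (PowerSeries.coeff n) hy
  rw [sub_mul, one_mul, map_sub, map_add, PowerSeries.coeff_C_mul, PowerSeries.coeff_rescale] at hn
  induction n with
  | zero =>
    have h0 : 1 - a ≠ 0 := sub_ne_zero.2 (by simpa using (ha 0).symm)
    simp only [PowerSeries.coeff_zero_X_mul, PowerSeries.coeff_zero_C, pow_zero, one_mul,
      sub_zero] at hn
    rw [qPoch, Finset.prod_range_zero, inv_one]
    exact mul_left_cancel₀ h0 (by linear_combination hn)
  | succ n ih =>
    have hn' := congrArg (PowerSeries.coeff n) hy
    rw [sub_mul, one_mul, map_sub, map_add, PowerSeries.coeff_C_mul, PowerSeries.coeff_rescale]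
      at hn'
    rw [PowerSeries.coeff_succ_X_mul, ih hn', PowerSeries.coeff_C, if_neg n.succ_ne_zero] at hn
    have h1 := sub_ne_zero.2 (ha (n + 1)).symm
    rw [pow_succ, mul_assoc] at h1
    rw [qPoch_succ, mul_inv, ← div_eq_mul_inv, eq_div_iff h1]
    linear_combination hn

-- With `e` the `q`-exponential, `y = e ψ` solves `(1 - x) y(x) = a y(q x) + 1 - a` as soon as
-- `ψ(x) - a ψ(q x) = (1 - a) / e(q x)`: only single divisors `1 - q ^ n a` enter `ψ`.
theorem converges_inv_qPoch_of_converges_inv {q a : ℂ} (hq : ‖q‖ = 1)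
    (hqn : ∀ n : ℕ, q ^ n * q ≠ 1) (hconv : Converges fun n => (qPoch q q n)⁻¹)
    (ha : ∀ n : ℕ, q ^ n * a ≠ 1) (h : Converges fun n => (1 - q ^ n * a)⁻¹) :
    Converges fun n => (qPoch (q * a) q n)⁻¹ := by
  have hconv' : Converges fun n => PowerSeries.coeff n (qExp q) := by simpa [qExp] using hconv
  set w : PowerSeries ℂ := (PowerSeries.rescale q (qExp q))⁻¹
  have hw : PowerSeries.rescale q (qExp q) * w = 1 := by
    refine PowerSeries.mul_inv_cancel _ ?_
    rw [← PowerSeries.coeff_zero_eq_constantCoeff_apply, PowerSeries.coeff_rescale]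
    simp [qExp, qPoch]
  have hwconv : Converges fun n => PowerSeries.coeff n w := (hconv'.rescale hq).inv
  set ψ : PowerSeries ℂ := PowerSeries.mk fun n =>
    PowerSeries.coeff n w * (1 - q ^ n * a)⁻¹ * (1 - a) with hψ_def
  have hψconv : Converges fun n => PowerSeries.coeff n ψ := by
    simpa [hψ_def, mul_comm] using (hwconv.mul_apply h).const_mul (1 - a)
  have hψ : ψ = PowerSeries.C a * PowerSeries.rescale q ψ + PowerSeries.C (1 - a) * w := by
    ext n
    rw [map_add, PowerSeries.coeff_C_mul, PowerSeries.coeff_C_mul, PowerSeries.coeff_rescale,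
      hψ_def, PowerSeries.coeff_mk]
    linear_combination
      (1 - a) * PowerSeries.coeff n w * inv_mul_cancel₀ (sub_ne_zero.2 (ha n).symm)
  have hy : (1 - PowerSeries.X) * (qExp q * ψ) =
      PowerSeries.C a * PowerSeries.rescale q (qExp q * ψ) + PowerSeries.C (1 - a) := by
    rw [← mul_assoc, one_sub_X_mul_qExp hqn, map_mul]
    linear_combination PowerSeries.rescale q (qExp q) * hψ + PowerSeries.C (1 - a) * hw
  simpa only [coeff_eq_inv_qPoch ha hy] using hconv'.mul hψconv

end SingleDivisor

theorem exists_rank_one_intertwiner {k V : Type*} [Field k] [AddCommGroup V] [Module k V]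
    [FiniteDimensional k V] {A : Module.End k V} {z w : k} (hzw : z ≠ w) (hz : A.HasEigenvalue z)
    (hw : A.HasEigenvalue w) :
    ∃ E : Module.End k V, E ≠ 0 ∧ E * E = 0 ∧ A * E = z • E ∧ E * A = w • E := by
  obtain ⟨v, hv⟩ := hz.exists_hasEigenvector
  have hrange : LinearMap.range (A - w • (1 : Module.End k V)) < ⊤ := by
    rw [lt_top_iff_ne_top]
    intro h
    have hinj := LinearMap.injective_iff_surjective.2 (LinearMap.range_eq_top.1 h)
    obtain ⟨u, hu⟩ := hw.exists_hasEigenvector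
    refine hu.2 (hinj ?_)
    rw [map_zero, LinearMap.sub_apply, hu.apply_eq_smul]
    simp
  obtain ⟨ξ, hξ0, hξ⟩ := Submodule.exists_le_ker_of_lt_top _ hrange
  have hξA (x) : ξ (A x) = w * ξ x := by
    have h0 : ξ ((A - w • (1 : Module.End k V)) x) = 0 := hξ ⟨x, rfl⟩
    rw [LinearMap.sub_apply, map_sub, sub_eq_zero] at h0
    simpa using h0
  have hξv : ξ v = 0 := by
    have h0 := hξA v
    rw [hv.apply_eq_smul, map_smul, smul_eq_mul] at h0
    exact (mul_eq_mul_right_iff.1 h0).resolve_left hzw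
  refine ⟨ξ.smulRight v, fun h0 => hξ0 (LinearMap.ext fun x => ?_), ?_, ?_, ?_⟩
  · simpa [hv.2] using LinearMap.congr_fun h0 x
  · ext x
    simp [hξv]
  · ext x
    simp [hv.apply_eq_smul, smul_smul, mul_comm]
  · ext x
    simp [hξA, smul_smul]

section Shear

theorem map_one_add_smul {R S n : Type*} [CommRing R] [CommRing S] [DecidableEq n] (f : R →+* S)
    (a : R) (E : Matrix n n R) : (1 + a • E).map f = 1 + f a • E.map f := by
  ext i j
  simp [Matrix.one_apply, apply_ite f]

variable {R n : Type*} [CommRing R] [Fintype n] [DecidableEq n] {A E : Matrix n n R}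

theorem one_add_smul_mul_one_sub_smul (hE : E * E = 0) (a : R) :
    (1 + a • E) * (1 - a • E) = 1 := by
  rw [add_mul, one_mul, mul_sub, mul_one, smul_mul_smul_comm, hE, smul_zero]
  abel

theorem mul_one_add_smul_of_rank_one {z w a b h : R} (hEE : E * E = 0) (hAE : A * E = z • E)
    (hEA : E * A = w • E) (hz : z * a = z * b + w * h) :
    A * (1 + a • E) = (1 + h • E) * (A * (1 + b • E)) := by
  have e : a • z • E = b • z • E + h • w • E := by
    rw [smul_smul, smul_smul, smul_smul, ← add_smul]
    congr 1
    linear_combination hz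
  simp only [mul_add, add_mul, one_mul, mul_one, Matrix.mul_smul, Matrix.smul_mul, hAE,
    hEA, hEE, smul_zero, add_zero, e]
  abel

end Shear

section DiffModuleOfMatrix

variable {F : Type} [Field F] {σ : F ≃+* F} {n : Type*} [Fintype n] [DecidableEq n]
  {V : Type u} [AddCommGroup V] [Module F V]

/-- The difference module on `V` whose operator has the invertible matrix `B` in the basis `b`. -/
abbrev DiffModule.ofMatrix (σ : F ≃+* F) (b : Module.Basis n F V) {B B' : Matrix n n F}
    (hB : B * B' = 1) : DiffModule.{u} F σ where
  carrier := V
  finite := Module.Finite.of_basis b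
  Sig := b.equivFun.toAddEquiv.trans <| (AddEquiv.piCongrRight fun _ => σ.toAddEquiv).trans <|
    (Matrix.toLin'OfInv (mul_eq_one_comm.1 hB) hB).toAddEquiv.trans b.equivFun.symm.toAddEquiv
  Sig_smul f x := by
    have h : (fun i => σ (b.equivFun (f • x) i)) = σ f • fun i => σ (b.equivFun x i) := by
      ext i
      simp
    refine (congrArg (fun y => b.equivFun.symm (Matrix.toLin' B y)) h).trans ?_
    rw [map_smul, map_smul]
    rfl

theorem DiffModule.sigMatrix_ofMatrix (b : Module.Basis n F V) {B B' : Matrix n n F}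
    (hB : B * B' = 1) : DiffModule.sigMatrix (M := .ofMatrix σ b hB) b = B := by
  ext i j
  have hj : (fun i => σ (b.equivFun (b j) i)) = Pi.single j 1 := by
    ext k
    simp [Pi.single_apply, eq_comm, apply_ite σ]
  change b.equivFun (b.equivFun.symm (Matrix.toLin' B fun i => σ (b.equivFun (b j) i))) i = _
  rw [LinearEquiv.apply_symm_apply, hj, Matrix.toLin'_apply, Matrix.mulVec_single_one,
    Matrix.col_apply]

end DiffModuleOfMatrix

section FormalRigidity

variable {q : ℂˣ} {V : GrNil.{u} q} {n : Type*} [Fintype n] [DecidableEq n]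

theorem det_ne_zero_of_gauge {A : Matrix n n (LaurentSeries ℂ)} (hA : A.det ≠ 0)
    {B : Matrix n n meroGerms} {T T' : Matrix n n (LaurentSeries ℂ)} (hT : T * T' = 1)
    (h : A * T.map (sigmaHat q) = T * B.map meroGerms.subtype) : B.det ≠ 0 := by
  intro hB
  have hTdet : T.det ≠ 0 :=
    left_ne_zero_of_mul_eq_one (by rw [← Matrix.det_mul, hT, Matrix.det_one])
  have hdet := congrArg Matrix.det h
  rw [Matrix.det_mul, Matrix.det_mul, ← RingEquiv.mapMatrix_apply, ← RingEquiv.map_det,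
    ← RingHom.mapMatrix_apply, ← RingHom.map_det, hB, map_zero, mul_zero] at hdet
  exact mul_ne_zero hA ((map_ne_zero (sigmaHat q)).2 hTdet) hdet

-- A formal isomorphism `T` and an analytic one differ by a formal automorphism of the constant
-- module, which is a constant matrix by rigidity.
theorem mem_meroGerms_of_inIso (hroot : ¬ IsOfFinOrder q)
    (hV : InIso q (analyticModule q V.twistEquiv)) (v : Module.Basis n ℂ V.carrier)
    {B : Matrix n n meroGerms} {T T' : Matrix n n (LaurentSeries ℂ)} (hT : T * T' = 1)
    (h : (LinearMap.toMatrix v v V.twist).map (algebraMap ℂ (LaurentSeries ℂ)) *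
      T.map (sigmaHat q) = T * B.map meroGerms.subtype) (i j : n) : T i j ∈ meroGerms := by
  set A := LinearMap.toMatrix v v V.twist with hA
  have hAdet : (A.map (algebraMap ℂ (LaurentSeries ℂ))).det ≠ 0 := by
    rw [← RingHom.mapMatrix_apply, ← RingHom.map_det, map_ne_zero, hA, LinearMap.det_toMatrix]
    exact (V.isUnit_twist.map LinearMap.det).ne_zero
  have hB : B * B⁻¹ = 1 := Matrix.mul_nonsing_inv B (det_ne_zero_of_gauge hAdet hT h).isUnit
  let b := analyticBasis q V.twistEquiv v
  let N : Bq.{u} q := .ofMatrix (sigma q) b hB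
  have hN : DiffModule.sigMatrix (M := N) b = B := DiffModule.sigMatrix_ofMatrix b hB
  obtain ⟨e⟩ := hV N <| DiffModule.nonempty_iso_of_matrix (formalizationBasis (M := N) b)
    (formalizationBasis b) hT <| by
      rw [sigMatrix_formalizationBasis_analyticBasis, sigMatrix_formalizationBasis, hN]
      exact h
  obtain ⟨U, U', hU, hUN⟩ := DiffModule.exists_matrix_of_iso (N := N) e.symm b b
  rw [hN, sigMatrix_analyticBasis] at hUN
  have hθ : A.map (algebraMap ℂ (LaurentSeries ℂ)) *
      (T * U.map meroGerms.subtype).map (sigmaHat q) =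
        T * U.map meroGerms.subtype * A.map (algebraMap ℂ (LaurentSeries ℂ)) := by
    have hU_hat := congrArg (fun M => M.map meroGerms.subtype) hUN
    simp only [Matrix.map_mul] at hU_hat
    rw [Matrix.map_mul, ← Matrix.mul_assoc, h, Matrix.mul_assoc, Matrix.mul_assoc]
    exact congrArg (T * ·) hU_hat
  obtain ⟨f, hf⟩ := exists_eq_map_of_intertwines hroot v v hθ
  have hT_eq : T = ((LinearMap.toMatrix v v f.toLin).map (algebraMap ℂ meroGerms) * U').map
      meroGerms.subtype := by
    rw [Matrix.map_mul]
    change T = (LinearMap.toMatrix v v f.toLin).map (algebraMap ℂ (LaurentSeries ℂ)) * _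
    rw [← hf, Matrix.mul_assoc, ← Matrix.map_mul, hU, Matrix.map_one _ (map_zero _) (map_one _),
      Matrix.mul_one]
  rw [hT_eq]
  exact Subtype.property _

end FormalRigidity

section Diverge

variable {q : ℂˣ}

/-- The geometric series `∑ x^n`. -/
def geomGerm : meroGerms :=
  ⟨toLaurent (PowerSeries.mk fun _ => 1),
    toLaurent_mem_meroGerms_iff.2 (by simpa using converges_one)⟩

/-- The solution `f` of `z f(q x) = w f(x) + z / (1 - q x)`, whose convergence is a small divisor
condition on `z / w`. -/
def shearSeries (q z w : ℂ) : PowerSeries ℂ :=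
  PowerSeries.mk fun n => z * q ^ n * (z * q ^ n - w)⁻¹

theorem algebraMap_mul_sigmaHat_shearSeries {z w : ℂ} (hzw : ∀ n : ℕ, z * (q : ℂ) ^ n - w ≠ 0) :
    algebraMap ℂ (LaurentSeries ℂ) z * sigmaHat q (toLaurent (shearSeries q z w)) =
      algebraMap ℂ (LaurentSeries ℂ) z * sigmaHat q geomGerm +
        algebraMap ℂ (LaurentSeries ℂ) w * toLaurent (shearSeries q z w) := by
  ext k
  rw [HahnSeries.coeff_add, coeff_algebraMap_mul, coeff_algebraMap_mul, coeff_algebraMap_mul,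
    sigmaHat_coeff, sigmaHat_coeff]
  change _ = z * (_ * (toLaurent (PowerSeries.mk fun _ => 1)).coeff k) + _
  rcases lt_or_ge k 0 with hk | hk
  · rw [toLaurent_coeff_of_neg _ hk, toLaurent_coeff_of_neg _ hk]
    ring
  · lift k to ℕ using hk
    rw [toLaurent_coeff_natCast, toLaurent_coeff_natCast, shearSeries, PowerSeries.coeff_mk,
      PowerSeries.coeff_mk, zpow_natCast]
    linear_combination z * (q : ℂ) ^ k * mul_inv_cancel₀ (hzw k)

theorem converges_inv_of_converges_shearSeries {q z w : ℂ} (hw : w ≠ 0)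
    (hzw : ∀ n : ℕ, z * q ^ n - w ≠ 0)
    (h : Converges fun n => PowerSeries.coeff n (shearSeries q z w)) :
    Converges fun n => (1 - q ^ n * (z / w))⁻¹ := by
  convert converges_one.add (h.const_mul (-1)) using 2 with n
  rw [shearSeries, PowerSeries.coeff_mk]
  have h1 : (z * q ^ n - w)⁻¹ * (z * q ^ n - w) = 1 := inv_mul_cancel₀ (hzw n)
  have h2 : 1 - q ^ n * (z / w) = -((z * q ^ n - w) / w) := by
    field_simp
    ring
  rw [h2, inv_neg, inv_div, div_eq_mul_inv]
  linear_combination h1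

theorem mem_meroGerms_of_one_add_smul_mem {n : Type*} [DecidableEq n] {E : Matrix n n ℂ}
    (hE : E ≠ 0) {f : LaurentSeries ℂ}
    (h : ∀ i j, (1 + f • E.map (algebraMap ℂ (LaurentSeries ℂ))) i j ∈ meroGerms) :
    f ∈ meroGerms := by
  obtain ⟨i, j, hij⟩ : ∃ i j, E i j ≠ 0 := by
    by_contra! h0
    exact hE (Matrix.ext h0)
  have hone : (1 : Matrix n n (LaurentSeries ℂ)) i j ∈ meroGerms := by
    rw [Matrix.one_apply]
    split_ifs
    exacts [one_mem _, zero_mem _]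
  have hmul := sub_mem (h i j) hone
  rw [Matrix.add_apply, add_sub_cancel_left] at hmul
  have hf := mul_mem hmul (algebraMap_mem_meroGerms (E i j)⁻¹)
  rwa [Matrix.smul_apply, Matrix.map_apply, smul_eq_mul, mul_assoc, ← map_mul,
    mul_inv_cancel₀ hij, map_one, mul_one] at hf

-- Conjugating the twist by `1 + f E` leaves a matrix with entries in `K`, so that `1 + f E` is a
-- formal isomorphism between analytic modules.
theorem mem_meroGerms_of_rank_one (hroot : ¬ IsOfFinOrder q) {V : GrNil.{u} q}
    (hV : InIso q (analyticModule q V.twistEquiv)) {E : Module.End ℂ V.carrier} (hE : E ≠ 0)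
    {z w : ℂ} (hEE : E * E = 0) (hAE : V.twist * E = z • E) (hEA : E * V.twist = w • E)
    {f : LaurentSeries ℂ} {g : meroGerms}
    (hfg : algebraMap ℂ (LaurentSeries ℂ) z * sigmaHat q f =
      algebraMap ℂ (LaurentSeries ℂ) z * sigmaHat q g + algebraMap ℂ (LaurentSeries ℂ) w * f) :
    f ∈ meroGerms := by
  let v := Module.finBasis ℂ V.carrier
  set A := LinearMap.toMatrix v v V.twist
  set E' := LinearMap.toMatrix v v E
  set Ah := A.map (algebraMap ℂ (LaurentSeries ℂ))
  set Eh := E'.map (algebraMap ℂ (LaurentSeries ℂ))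
  have hE' : E' ≠ 0 := (map_ne_zero_iff _ (LinearMap.toMatrix v v).injective).2 hE
  have hEEh : Eh * Eh = 0 := by
    rw [← Matrix.map_mul, ← LinearMap.toMatrix_mul, hEE, map_zero, Matrix.map_zero _ (map_zero _)]
  have hAEh : Ah * Eh = algebraMap ℂ (LaurentSeries ℂ) z • Eh := by
    rw [← Matrix.map_mul, ← LinearMap.toMatrix_mul, hAE, map_smul]
    exact Matrix.map_smul' _ z E' (map_mul _)
  have hEAh : Eh * Ah = algebraMap ℂ (LaurentSeries ℂ) w • Eh := by
    rw [← Matrix.map_mul, ← LinearMap.toMatrix_mul, hEA, map_smul]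
    exact Matrix.map_smul' _ w E' (map_mul _)
  have hgauge := mul_one_add_smul_of_rank_one hEEh hAEh hEAh hfg
  refine mem_meroGerms_of_one_add_smul_mem hE' <| mem_meroGerms_of_inIso hroot hV v
    (B := A.map (algebraMap ℂ meroGerms) * (1 + sigma q g • E'.map (algebraMap ℂ meroGerms)))
    (one_add_smul_mul_one_sub_smul hEEh f) ?_
  rw [Matrix.map_mul, map_one_add_smul meroGerms.subtype]
  refine (congrArg (Ah * ·) ?_).trans hgauge
  refine (map_one_add_smul (sigmaHat q).toRingHom f Eh).trans ?_
  exact congrArg (1 + _ • ·) (Matrix.ext fun i j => sigmaHat_algebraMap q (E' i j))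

theorem converges_inv_of_inIso (hroot : ¬ IsOfFinOrder q) {V : GrNil.{u} q}
    (hV : InIso q (analyticModule q V.twistEquiv)) {c d : CModQ q} (hcd : c ≠ d)
    (hc : V.comp c ≠ ⊥) (hd : V.comp d ≠ ⊥) :
    Converges fun n => (1 - (q : ℂ) ^ n * ((rep q c : ℂ) / rep q d))⁻¹ := by
  have hne : (rep q c : ℂ) ≠ rep q d := (rep_coe_injective q).ne hcd
  have hzw (n : ℕ) : (rep q c : ℂ) * (q : ℂ) ^ n - rep q d ≠ 0 := by
    rw [sub_ne_zero]
    rcases Nat.eq_zero_or_pos n with rfl | hn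
    · rwa [pow_zero, mul_one]
    · simpa [mul_comm] using zpow_mul_rep_ne_rep hroot (n := n) (by omega) c d
  obtain ⟨E, hE, hEE, hAE, hEA⟩ := exists_rank_one_intertwiner hne
    (GrNil.hasEigenvalue_twist hc) (GrNil.hasEigenvalue_twist hd)
  exact converges_inv_of_converges_shearSeries (rep q d).ne_zero hzw <|
    toLaurent_mem_meroGerms_iff.1 <| mem_meroGerms_of_rank_one hroot hV hE hEE hAE hEA
      (algebraMap_mul_sigmaHat_shearSeries hzw)

theorem converges_inv_one_sub_of_inIso (hroot : ¬ IsOfFinOrder q) {V : GrNil.{u} q}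
    (hV : InIso q (analyticModule q V.twistEquiv)) {a b : ℂˣ} (hab : (a : CModQ q) ≠ b)
    (ha : V.comp a ≠ ⊥) (hb : V.comp b ≠ ⊥) (k : ℤ) :
    Converges fun n : ℕ => (1 - (q : ℂ) ^ (n + k) * (a / b))⁻¹ := by
  obtain ⟨i, hi⟩ := exists_rep_eq_zpow_mul q a
  obtain ⟨j, hj⟩ := exists_rep_eq_zpow_mul q b
  have h := converges_inv_of_inIso hroot hV hab ha hb
  have hshift := (converges_shift
    (fun n : ℤ => (1 - (q : ℂ) ^ n * ((rep q a : ℂ) / rep q b))⁻¹) (k + j - i)).2 (by simpa using h)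
  convert hshift using 4 with n
  rw [hi, hj]
  push_cast
  rw [zpow_add₀ q.ne_zero, zpow_add₀ q.ne_zero, zpow_sub₀ q.ne_zero, zpow_add₀ q.ne_zero]
  field_simp

theorem conditionD_of_inIso (hq : ‖(q : ℂ)‖ = 1) (hroot : ¬ IsOfFinOrder q)
    (hconv : Converges fun n => (qPoch q q n)⁻¹) {V : GrNil.{u} q}
    (hV : InIso q (analyticModule q V.twistEquiv)) : ConditionD q V := by
  intro S hS
  have hqn (n : ℕ) : (q : ℂ) ^ n * q ≠ 1 := fun h0 =>
    hroot (isOfFinOrder_iff_pow_eq_one.2 ⟨n + 1, n.succ_pos, Units.ext (by simpa [pow_succ])⟩)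
  have hsingle : ∀ l ∈ ratios q S, Converges fun n => (qPoch l q n)⁻¹ := fun l hl => by
    obtain ⟨⟨a, ha, b, hb, rfl⟩, hl'⟩ := mem_ratios_iff.1 hl
    have hab : (a : CModQ q) ≠ b := fun h => by
      refine hl' 0 le_rfl ?_
      rw [hS.injOn ha hb h]
      simp
    have hne (n : ℕ) : (q : ℂ) ^ n * ((q : ℂ)⁻¹ * (a * b⁻¹ : ℂˣ)) ≠ 1 := fun h0 => by
      have h1 : q ^ (n : ℤ) * (q⁻¹ * (a * b⁻¹)) = 1 := Units.ext (by simpa using h0)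
      refine hab (coe_eq_coe_iff_exists_zpow.2 ⟨(n : ℤ) - 1, ?_⟩)
      rw [zpow_sub_one, mul_assoc]
      rwa [← mul_assoc q⁻¹, ← mul_assoc, mul_inv_eq_one, eq_comm] at h1
    have h := converges_inv_one_sub_of_inIso hroot hV hab (hS.mapsTo ha) (hS.mapsTo hb) (-1)
    have h' := converges_inv_qPoch_of_converges_inv hq hqn hconv hne <| by
      simpa [zpow_add₀, div_eq_mul_inv, mul_assoc] using h
    rwa [mul_inv_cancel_left₀ q.ne_zero] at h'
  convert converges_multiset_prod (ratios q S).val hsingle using 2 with n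
  rw [phiCoeff, ← Finset.prod_inv_distrib]
  rfl

end Diverge

/-! ## Cyclic vectors of constant systems -/

section CyclicGenerators

open Polynomial

variable {k V ι : Type*} [Field k] [AddCommGroup V] [Module k V] [DecidableEq ι]
  {A : Module.End k V} {P : ι → k[X]}
  (e : Module.AEval' A ≃ₗ[k[X]] DirectSum ι fun i => k[X] ⧸ Submodule.span k[X] {P i})

/-- The generator of the `i`-th cyclic summand of a vector space decomposed as a `k[X]`-module. -/
def cyclicGenerator (i : ι) : V :=
  (Module.AEval'.of A).symm (e.symm (DirectSum.lof k[X] ι _ i (Submodule.Quotient.mk 1)))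

theorem aeval_cyclicGenerator (i : ι) (r : k[X]) :
    aeval A r (cyclicGenerator e i) =
      (Module.AEval'.of A).symm (e.symm (DirectSum.lof k[X] ι _ i (Submodule.Quotient.mk r))) := by
  rw [cyclicGenerator, ← Module.End.smul_def, ← Module.AEval.of_symm_smul, ← map_smul, ← map_smul,
    ← Submodule.Quotient.mk_smul, smul_eq_mul, mul_one]

theorem aeval_cyclicGenerator_eq_zero_iff (i : ι) (r : k[X]) :
    aeval A r (cyclicGenerator e i) = 0 ↔ P i ∣ r := by
  rw [aeval_cyclicGenerator, LinearEquiv.map_eq_zero_iff, LinearEquiv.map_eq_zero_iff,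
    map_eq_zero_iff (DirectSum.lof k[X] ι (fun i => k[X] ⧸ Submodule.span k[X] {P i}) i)
      (DirectSum.of_injective i), Submodule.Quotient.mk_eq_zero]
  exact Ideal.mem_span_singleton

theorem eq_top_of_aeval_cyclicGenerator_mem {W : Submodule k V}
    (hW : ∀ i (p : k[X]), aeval A p (cyclicGenerator e i) ∈ W) : W = ⊤ := by
  have hmem (y) : (Module.AEval'.of A).symm (e.symm y) ∈ W := by
    induction y using DirectSum.induction_on with
    | zero => simp only [map_zero, zero_mem]
    | of i y =>
      obtain ⟨r, rfl⟩ := Submodule.Quotient.mk_surjective _ y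
      exact aeval_cyclicGenerator e i r ▸ hW i r
    | add y z hy hz => rw [map_add, map_add]; exact W.add_mem hy hz
  refine eq_top_iff.2 fun x _ => ?_
  simpa using hmem (e (Module.AEval'.of A x))

end CyclicGenerators

section Polynomial

open Polynomial

theorem sum_natDegree_eq_finrank_of_equiv_directSum {k V ι : Type*} [Field k] [AddCommGroup V]
    [Module k V] [FiniteDimensional k V] [Fintype ι] {A : Module.End k V} {P : ι → k[X]}
    (e : Module.AEval' A ≃ₗ[k[X]] DirectSum ι fun i => k[X] ⧸ Submodule.span k[X] {P i}) :
    ∑ i, (P i).natDegree = Module.finrank k V := by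
  classical
  let e' := (Module.AEval'.of A).trans (e.restrictScalars k)
  have (i : ι) : Module.Finite k (k[X] ⧸ Submodule.span k[X] {P i}) := by
    refine Module.Finite.of_surjective ((DirectSum.component k[X] ι
      (fun i => k[X] ⧸ Submodule.span k[X] {P i}) i).restrictScalars k ∘ₗ e'.toLinearMap) ?_
    rw [LinearMap.coe_comp]
    exact Function.Surjective.comp (fun y => ⟨DirectSum.lof k[X] ι _ i y,
      DirectSum.component.lof_self k[X] (M := fun i => k[X] ⧸ Submodule.span k[X] {P i}) i y⟩)
      e'.surjective
  rw [e'.finrank_eq, Module.finrank_directSum]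
  exact Finset.sum_congr rfl fun i _ => finrank_quotient_span_eq_natDegree.symm

theorem exists_equiv_directSum_quotient_span {k : Type u} {V : Type*} [Field k] [AddCommGroup V]
    [Module k V] [FiniteDimensional k V] (A : Module.End k V) :
    ∃ (ι : Type u) (_ : Fintype ι) (P : ι → k[X]), (∀ i, P i ≠ 0) ∧
      Nonempty (Module.AEval' A ≃ₗ[k[X]]
        DirectSum ι fun i => k[X] ⧸ Submodule.span k[X] {P i}) := by
  obtain ⟨ι, hι, p, hp, n, e⟩ := Module.equiv_directSum_of_isTorsion
    (Module.AEval.isTorsion_of_finiteDimensional k V A)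
  exact ⟨ι, hι, fun i => p i ^ n i, fun i => pow_ne_zero _ (hp i).ne_zero, e⟩

theorem map_aeval_apply {R V W : Type*} [CommSemiring R] [AddCommMonoid V] [Module R V]
    [AddCommMonoid W] [Module R W] {A : Module.End R V} {B : Module.End R W} {f : V →ₗ[R] W}
    (h : ∀ v, f (A v) = B (f v)) (p : R[X]) (v : V) : f (aeval A p v) = aeval B p (f v) := by
  have hpow (n : ℕ) (v : V) : f ((A ^ n) v) = (B ^ n) (f v) := by
    rw [Module.End.pow_apply, Module.End.pow_apply]
    exact Function.Semiconj.iterate_right (f := f) h n v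
  induction p using Polynomial.induction_on' with
  | add p r hp hr => simp only [map_add, LinearMap.add_apply, hp, hr]
  | monomial n a =>
    simp only [aeval_monomial, Module.End.mul_apply, Module.algebraMap_end_apply, map_smul, hpow]

theorem aeval_smul_comp_C_inv_mul_X {k R : Type*} [Field k] [Semiring R] [Algebra k R] (a : R)
    {c : k} (hc : c ≠ 0) (p : k[X]) : aeval (c • a) (p.comp (C c⁻¹ * X)) = aeval a p := by
  rw [aeval_comp, map_mul, aeval_C, aeval_X, ← Algebra.smul_def, smul_smul, inv_mul_cancel₀ hc,
    one_smul]

theorem natDegree_comp_C_inv_mul_X {k : Type*} [Field k] {c : k} (hc : c ≠ 0) (p : k[X]) :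
    (p.comp (C c⁻¹ * X)).natDegree = p.natDegree := by
  rw [natDegree_comp, natDegree_C_mul_X _ (inv_ne_zero hc), mul_one]

theorem comp_C_inv_mul_X_ne_zero {k : Type*} [Field k] {c : k} (hc : c ≠ 0) {p : k[X]}
    (hp : p ≠ 0) : p.comp (C c⁻¹ * X) ≠ 0 := by
  intro h
  have := aeval_smul_comp_C_inv_mul_X (X : k[X]) hc p
  rw [h, map_zero, aeval_X_left_apply] at this
  exact hp this.symm

theorem exists_aeval_sum_apply_eq {R V ι : Type*} [CommRing R] [AddCommGroup V] [Module R V]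
    [Fintype ι] {B : Module.End R V} {Q : ι → R[X]} {m : ι → V}
    (hQ : Pairwise (Function.onFun IsCoprime Q)) (hm : ∀ i, aeval B (Q i) (m i) = 0) (i : ι) :
    ∃ r : R[X], aeval B r (∑ j, m j) = m i := by
  classical
  have hkill {j : ι} {r : R[X]} (h : Q j ∣ r) : aeval B r (m j) = 0 := by
    obtain ⟨s, rfl⟩ := h
    rw [mul_comm, map_mul, Module.End.mul_apply, hm, map_zero]
  obtain ⟨a, b, hab⟩ := IsCoprime.prod_right (t := Finset.univ.erase i) (s := Q) fun j hj =>
    hQ (Finset.ne_of_mem_erase hj).symm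
  refine ⟨b * ∏ j ∈ Finset.univ.erase i, Q j, ?_⟩
  rw [map_sum, Finset.sum_eq_single_of_mem i (Finset.mem_univ i) fun j _ hj => hkill <|
    (Finset.dvd_prod_of_mem _ (Finset.mem_erase.2 ⟨hj, Finset.mem_univ j⟩)).mul_left b,
    eq_sub_of_add_eq' hab, map_sub, LinearMap.sub_apply, hkill (dvd_mul_left _ _), sub_zero,
    map_one, Module.End.one_apply]

theorem aeval_apply_mem_span_iterate {k V : Type*} [Field k] [AddCommGroup V] [Module k V]
    {B : Module.End k V} {L : k[X]} (hL : L ≠ 0) {m : V} (hm : aeval B L m = 0) (p : k[X]) :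
    aeval B p m ∈ Submodule.span k (Set.range fun i : Fin L.natDegree => B^[i] m) := by
  rw [← EuclideanDomain.div_add_mod p L, map_add, LinearMap.add_apply, mul_comm, map_mul,
    Module.End.mul_apply, hm, map_zero, zero_add]
  rcases eq_or_ne (p % L) 0 with h | h
  · rw [h, map_zero]
    exact Submodule.zero_mem _
  rw [aeval_eq_sum_range' (natDegree_lt_natDegree h (EuclideanDomain.mod_lt p hL)),
    LinearMap.sum_apply]
  refine Submodule.sum_mem _ fun i hi => ?_
  rw [LinearMap.smul_apply, Module.End.pow_apply]
  exact Submodule.smul_mem _ _ (Submodule.subset_span ⟨⟨i, Finset.mem_range.1 hi⟩, rfl⟩)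

end Polynomial

theorem eq_top_of_forall_one_tmul_mem {R S V : Type*} [CommSemiring R] [Semiring S]
    [Algebra R S] [AddCommMonoid V] [Module R V] {W : Submodule S (S ⊗[R] V)}
    (hW : ∀ v : V, 1 ⊗ₜ[R] v ∈ W) : W = ⊤ := by
  rw [eq_top_iff, ← Submodule.baseChange_top, Submodule.baseChange_eq_span, Submodule.span_le]
  rintro _ ⟨v, -, rfl⟩
  exact hW v

section MonomialGerm

theorem sigmaHat_single (q : ℂˣ) (k : ℤ) :
    sigmaHat q (HahnSeries.single k 1) =
      algebraMap ℂ (LaurentSeries ℂ) ((q : ℂ) ^ k) * HahnSeries.single k 1 := by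
  ext n
  rw [sigmaHat_coeff, coeff_algebraMap_mul, HahnSeries.coeff_single]
  split_ifs with h
  · rw [h]
  · rw [mul_zero, mul_zero]

variable {q : ℂˣ}

/-- The germ `x ^ k`. -/
def monomialGerm (k : ℤ) : meroGerms := ⟨HahnSeries.single k 1, single_mem_meroGerms k⟩

theorem monomialGerm_ne_zero (k : ℤ) : monomialGerm k ≠ 0 := fun h =>
  HahnSeries.single_ne_zero (Γ := ℤ) (a := k) (one_ne_zero (α := ℂ)) (congrArg Subtype.val h)

theorem sigma_monomialGerm (k : ℤ) : sigma q (monomialGerm k) = (q : ℂ) ^ k • monomialGerm k := by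
  refine Subtype.ext ?_
  rw [Algebra.smul_def]
  exact sigmaHat_single q k

end MonomialGerm

section Cyclic

open Polynomial

variable {q : ℂˣ} {V : Type u} [AddCommGroup V] [Module ℂ V] [FiniteDimensional ℂ V]

/-- The operator `σ_q ⊗ A` on `K ⊗ V`, viewed as a `ℂ`-linear map so that polynomials can be
evaluated at it. -/
def analyticEnd (q : ℂˣ) (A : V ≃ₗ[ℂ] V) : Module.End ℂ (meroGerms ⊗[ℂ] V) where
  toFun := analyticSig q A
  map_add' := map_add _
  map_smul' c t := by
    rw [← algebraMap_smul meroGerms c t, analyticSig_smul, sigma_algebraMap, algebraMap_smul]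
    rfl

theorem aeval_analyticEnd_monomialGerm_tmul (A : V ≃ₗ[ℂ] V) (k : ℤ) (p : ℂ[X]) (v : V) :
    aeval (analyticEnd q A) p (monomialGerm k ⊗ₜ[ℂ] v) =
      monomialGerm k ⊗ₜ[ℂ] aeval ((q : ℂ) ^ k • A.toLinearMap) p v := by
  refine (map_aeval_apply (f := TensorProduct.mk ℂ meroGerms V (monomialGerm k))
    (fun v => ?_) p v).symm
  change monomialGerm k ⊗ₜ[ℂ] ((q : ℂ) ^ k • A v) = sigma q (monomialGerm k) ⊗ₜ[ℂ] A v
  rw [sigma_monomialGerm, TensorProduct.smul_tmul]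

/-- The annihilator of `x ^ k ⊗ v` when `P` annihilates `v`. -/
def shiftedAnnihilator (q : ℂˣ) (k : ℤ) (P : ℂ[X]) : ℂ[X] := P.comp (C ((q : ℂ) ^ k)⁻¹ * X)

theorem aeval_shiftedAnnihilator (A : V ≃ₗ[ℂ] V) (k : ℤ) (P : ℂ[X]) (v : V) :
    aeval (analyticEnd q A) (shiftedAnnihilator q k P) (monomialGerm k ⊗ₜ[ℂ] v) =
      monomialGerm k ⊗ₜ[ℂ] aeval A.toLinearMap P v := by
  rw [aeval_analyticEnd_monomialGerm_tmul, shiftedAnnihilator,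
    aeval_smul_comp_C_inv_mul_X _ (zpow_ne_zero k q.ne_zero)]

theorem hasEigenvalue_of_isRoot_shiftedAnnihilator {A : Module.End ℂ V} {k : ℤ} {P : ℂ[X]}
    (hP : P ∣ A.charpoly) {z : ℂ} (hz : (shiftedAnnihilator q k P).IsRoot z) :
    A.HasEigenvalue (((q : ℂ) ^ k)⁻¹ * z) := by
  rw [Module.End.hasEigenvalue_iff_isRoot_charpoly]
  refine IsRoot.dvd ?_ hP
  rwa [shiftedAnnihilator, IsRoot.def, eval_comp, eval_mul, eval_C, eval_X] at hz

theorem isCoprime_shiftedAnnihilator {A : Module.End ℂ V}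
    (hA : ∀ z w : ℂ, A.HasEigenvalue z → A.HasEigenvalue w → ∀ n : ℤ, n ≠ 0 → (q : ℂ) ^ n * z ≠ w)
    {k l : ℤ} (hkl : k ≠ l) {P Q : ℂ[X]} (hP : P ∣ A.charpoly) (hQ : Q ∣ A.charpoly) :
    IsCoprime (shiftedAnnihilator q k P) (shiftedAnnihilator q l Q) := by
  rw [isCoprime_iff_aeval_ne_zero_of_isAlgClosed ℂ ℂ]
  intro z
  by_contra! h
  refine hA _ _ (hasEigenvalue_of_isRoot_shiftedAnnihilator hP (by simpa using h.1))
    (hasEigenvalue_of_isRoot_shiftedAnnihilator hQ (by simpa using h.2)) (k - l)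
    (sub_ne_zero.2 hkl) ?_
  have := zpow_ne_zero k q.ne_zero
  rw [zpow_sub₀ q.ne_zero]
  field_simp

theorem coeff_zero_shiftedAnnihilator_ne_zero (A : V ≃ₗ[ℂ] V) (k : ℤ) {P : ℂ[X]}
    (hP : P ∣ A.toLinearMap.charpoly) : (shiftedAnnihilator q k P).coeff 0 ≠ 0 := by
  intro h
  rw [coeff_zero_eq_eval_zero] at h
  have h0 := hasEigenvalue_of_isRoot_shiftedAnnihilator hP h
  rw [mul_zero] at h0
  obtain ⟨x, hx⟩ := h0.exists_hasEigenvector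
  have hAx : A x = 0 := hx.apply_eq_smul.trans (zero_smul ℂ x)
  exact hx.2 (A.map_eq_zero_iff.1 hAx)

/- The summands of `V` are multiplied by distinct powers of `x`: as `q ^ n * z = w` has no solution
among the eigenvalues, this makes their annihilators pairwise coprime. -/
theorem exists_cyclic_vector (A : V ≃ₗ[ℂ] V)
    (hA : ∀ z w : ℂ, Module.End.HasEigenvalue A.toLinearMap z →
      Module.End.HasEigenvalue A.toLinearMap w → ∀ n : ℤ, n ≠ 0 → (q : ℂ) ^ n * z ≠ w) :
    ∃ (L : ℂ[X]) (m : meroGerms ⊗[ℂ] V), L.coeff 0 ≠ 0 ∧ L.natDegree = Module.finrank ℂ V ∧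
      aeval (analyticEnd q A) L m = 0 ∧
      ∀ W : Submodule meroGerms (meroGerms ⊗[ℂ] V),
        (∀ p : ℂ[X], aeval (analyticEnd q A) p m ∈ W) → W = ⊤ := by
  classical
  obtain ⟨ι, _, P, hP0, ⟨e⟩⟩ := exists_equiv_directSum_quotient_span A.toLinearMap
  have hPA (i : ι) : P i ∣ A.toLinearMap.charpoly := by
    rw [← aeval_cyclicGenerator_eq_zero_iff e, LinearMap.aeval_self_charpoly, LinearMap.zero_apply]
  let k (i : ι) : ℤ := Fintype.equivFin ι i
  have hk : Function.Injective k :=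
    Nat.cast_injective.comp (Fin.val_injective.comp (Fintype.equivFin ι).injective)
  let Q (i : ι) : ℂ[X] := shiftedAnnihilator q (k i) (P i)
  let m (i : ι) : meroGerms ⊗[ℂ] V := monomialGerm (k i) ⊗ₜ[ℂ] cyclicGenerator e i
  have hQm (i : ι) : aeval (analyticEnd q A) (Q i) (m i) = 0 := by
    rw [aeval_shiftedAnnihilator, (aeval_cyclicGenerator_eq_zero_iff e i _).2 dvd_rfl,
      TensorProduct.tmul_zero]
  have hQ0 (i : ι) : Q i ≠ 0 := comp_C_inv_mul_X_ne_zero (zpow_ne_zero _ q.ne_zero) (hP0 i)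
  refine ⟨∏ i, Q i, ∑ i, m i, ?_, ?_, ?_, fun W hW => eq_top_of_forall_one_tmul_mem ?_⟩
  · rw [coeff_zero_prod]
    exact Finset.prod_ne_zero_iff.2 fun i _ => coeff_zero_shiftedAnnihilator_ne_zero A _ (hPA i)
  · rw [natDegree_prod _ _ fun i _ => hQ0 i, ← sum_natDegree_eq_finrank_of_equiv_directSum e]
    exact Finset.sum_congr rfl fun i _ =>
      natDegree_comp_C_inv_mul_X (zpow_ne_zero _ q.ne_zero) (P i)
  · rw [map_sum]
    refine Finset.sum_eq_zero fun i hi => ?_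
    rw [← Finset.prod_erase_mul _ _ hi, map_mul, Module.End.mul_apply, hQm, map_zero]
  · have hmem (i : ι) (p : ℂ[X]) : 1 ⊗ₜ[ℂ] aeval A.toLinearMap p (cyclicGenerator e i) ∈ W := by
      obtain ⟨r, hr⟩ := exists_aeval_sum_apply_eq (fun i j hij =>
        isCoprime_shiftedAnnihilator hA (hk.ne hij) (hPA i) (hPA j)) hQm i
      have h := hW (shiftedAnnihilator q (k i) p * r)
      rw [map_mul, Module.End.mul_apply, hr, aeval_shiftedAnnihilator] at h
      simpa only [TensorProduct.smul_tmul', smul_eq_mul,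
        inv_mul_cancel₀ (monomialGerm_ne_zero _)] using W.smul_mem (monomialGerm (k i))⁻¹ h
    have htop := eq_top_of_aeval_cyclicGenerator_mem e
      (W := (W.restrictScalars ℂ).comap (TensorProduct.mk ℂ meroGerms V 1)) hmem
    exact fun v => htop.ge (Submodule.mem_top (x := v))

end Cyclic

/-! ## Purity of constant systems -/

theorem eq_zero_of_supporting_line {S : Set (ℝ × ℝ)} {n μ c : ℝ}
    (hS : S ⊆ Set.Icc 0 n ×ˢ Set.Ici 0) (h0 : (0, 0) ∈ S) (hn : (n, 0) ∈ S)
    (hline : ∀ p ∈ S, μ * p.1 + c ≤ p.2) {p p' : ℝ × ℝ} (hp : p ∈ S) (hp' : p' ∈ S) (hne : p ≠ p')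
    (hpc : p.2 = μ * p.1 + c) (hpc' : p'.2 = μ * p'.1 + c) : μ = 0 := by
  have hc : μ * 0 + c ≤ 0 := hline _ h0
  have hnc : μ * n + c ≤ 0 := hline _ hn
  have hheight (y : ℝ × ℝ) (hy : y ∈ S) (hyc : y.2 = μ * y.1 + c) : n * y.2 ≤ 0 := by
    have hy1 := (hS hy).1
    calc n * y.2 = (n - y.1) * c + y.1 * (μ * n + c) := by rw [hyc]; ring
      _ ≤ 0 := add_nonpos
        (mul_nonpos_of_nonneg_of_nonpos (sub_nonneg.2 hy1.2) (by linarith))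
        (mul_nonpos_of_nonneg_of_nonpos hy1.1 hnc)
  obtain ⟨⟨hp0, hpn⟩, hp2⟩ := hS hp
  obtain ⟨⟨hp0', hpn'⟩, hp2'⟩ := hS hp'
  by_contra hμ
  have hfst : p.1 = p'.1 := by
    rcases (hp0.trans hpn).eq_or_lt with rfl | hpos
    · exact (hpn.antisymm hp0).trans (hpn'.antisymm hp0').symm
    · have hz := (nonpos_of_mul_nonpos_right (hheight p hp hpc) hpos).antisymm hp2
      have hz' := (nonpos_of_mul_nonpos_right (hheight p' hp' hpc') hpos).antisymm hp2'
      exact mul_left_cancel₀ hμ (by linarith)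
  exact hne (Prod.ext hfst (by rw [hpc, hpc', hfst]))

namespace DiffOperator

theorem newtonPolygon_subset (L : DiffOperator) :
    L.newtonPolygon ⊆ Set.Icc 0 (L.ν : ℝ) ×ˢ Set.Ici 0 := by
  refine convexHull_min ?_ ((convex_Icc _ _).prod (convex_Ici _))
  rintro ⟨x, y⟩ ⟨i, hi, rfl, hy⟩
  refine ⟨⟨Nat.cast_nonneg _, Nat.cast_le.2 (Nat.lt_succ_iff.1 i.2)⟩, le_trans ?_ hy⟩
  rw [Int.cast_nonneg_iff]
  by_contra! h
  exact HahnSeries.coeff_order_eq_zero.not.2 (fun h => hi (Subtype.ext h)) (L.holomorphic i _ h)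

theorem mem_newtonPolygon_of_order_eq_zero (L : DiffOperator) {i : Fin (L.ν + 1)}
    (hi : L.coeff i ≠ 0) (hord : (L.coeff i : LaurentSeries ℂ).order = 0) :
    (((i : ℕ) : ℝ), (0 : ℝ)) ∈ L.newtonPolygon :=
  subset_convexHull ℝ _ ⟨i, hi, rfl, by rw [hord, Int.cast_zero]⟩

theorem isPure_zero_of_order_eq_zero (L : DiffOperator) (h0 : L.coeff 0 ≠ 0)
    (hord0 : (L.coeff 0 : LaurentSeries ℂ).order = 0)
    (hord : (L.coeff (Fin.last _) : LaurentSeries ℂ).order = 0) : L.IsPure 0 := by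
  rintro μ ⟨c, hc, p, hp, p', hp', hne, hpc, hpc'⟩
  refine eq_zero_of_supporting_line L.newtonPolygon_subset ?_
    (L.mem_newtonPolygon_of_order_eq_zero L.lead_ne_zero hord) hc hp hp' hne hpc hpc'
  simpa only [Fin.val_zero, Nat.cast_zero] using L.mem_newtonPolygon_of_order_eq_zero h0 hord0

open Polynomial

/-- The operator `L(σ_q)` with constant coefficients. -/
def ofPolynomial (L : ℂ[X]) (hL : L ≠ 0) : DiffOperator where
  ν := L.natDegree
  coeff i := algebraMap ℂ meroGerms (L.coeff i)
  holomorphic i n hn := (coeff_algebraMap (L.coeff i) n).trans (if_neg hn.ne)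
  lead_ne_zero := by
    rw [Fin.val_last, coeff_natDegree, _root_.map_ne_zero]
    exact leadingCoeff_ne_zero.2 hL

theorem ofPolynomial_isPure {L : ℂ[X]} (h0 : L.coeff 0 ≠ 0) (hL : L ≠ 0) :
    (ofPolynomial L hL).IsPure 0 :=
  isPure_zero_of_order_eq_zero _ ((_root_.map_ne_zero (algebraMap ℂ meroGerms)).2 h0)
    HahnSeries.order_C HahnSeries.order_C

end DiffOperator

theorem isPureOfSlope_zero_analyticModule {q : ℂˣ} (hroot : ¬ IsOfFinOrder q) (V : GrNil.{u} q) :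
    IsPureOfSlope q 0 (analyticModule q V.twistEquiv) := by
  obtain ⟨L, m, hL0, hdeg, hLm, hspan⟩ := exists_cyclic_vector (q := q) V.twistEquiv
    fun z w hz hw n hn => by
      obtain ⟨c, -, rfl⟩ := V.exists_eq_rep_of_hasEigenvalue_twist hz
      obtain ⟨d, -, rfl⟩ := V.exists_eq_rep_of_hasEigenvalue_twist hw
      exact zpow_mul_rep_ne_rep hroot hn c d
  have hL : L ≠ 0 := fun h => hL0 (by rw [h, Polynomial.coeff_zero])
  have htop := hspan (.span meroGerms (Set.range fun i : Fin L.natDegree =>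
      (analyticSig q V.twistEquiv)^[i] m)) fun p =>
    Submodule.span_le_restrictScalars ℂ meroGerms _ (aeval_apply_mem_span_iterate hL hLm p)
  refine ⟨.ofPolynomial L hL, ⟨m, ?_, htop, ?_⟩, DiffOperator.ofPolynomial_isPure hL0 hL⟩
  · refine linearIndependent_of_top_le_span_of_card_eq_finrank htop.ge ?_
    rw [Fintype.card_fin]
    exact hdeg.trans Module.finrank_baseChange.symm
  · rw [Polynomial.aeval_eq_sum_range, LinearMap.sum_apply, Finset.sum_range] at hLm
    refine Eq.trans (Finset.sum_congr rfl fun i _ => ?_) hLm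
    rw [LinearMap.smul_apply, Module.End.pow_apply]
    exact algebraMap_smul meroGerms (L.coeff i) ((analyticSig q V.twistEquiv)^[i] m)

/-! ## Formal reduction to constant coefficients -/

section Eigenvector

variable {n : Type*} [Fintype n]

theorem exists_strong_rec {α : Type*} (F : ∀ k : ℕ, (Fin k → α) → α) :
    ∃ y : ℕ → α, ∀ k, y k = F k fun j => y j := by
  refine ⟨fun k => Nat.strongRec (motive := fun _ => α) (fun k ih => F k fun j => ih j j.2) k,
    fun k => ?_⟩
  beta_reduce
  conv_lhs => rw [Nat.strongRec]

theorem coeff_mulVec_rescale {m R : Type*} [CommSemiring R] (a : R)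
    (B : Matrix m n (PowerSeries R)) (y : n → PowerSeries R) (k : ℕ) :
    (fun i => PowerSeries.coeff k (B.mulVec (PowerSeries.rescale a ∘ y) i)) =
      ∑ j ∈ Finset.range (k + 1), a ^ j •
        (B.map (PowerSeries.coeff (k - j))).mulVec fun i => PowerSeries.coeff j (y i) := by
  ext i
  have hterm (l : n) : PowerSeries.coeff k (B i l * PowerSeries.rescale a (y l)) =
      ∑ j ∈ Finset.range (k + 1),
        a ^ j * (PowerSeries.coeff (k - j) (B i l) * PowerSeries.coeff j (y l)) := by
    rw [mul_comm, PowerSeries.coeff_mul, Finset.Nat.sum_antidiagonal_eq_sum_range_succ_mk]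
    refine Finset.sum_congr rfl fun j _ => ?_
    rw [PowerSeries.coeff_rescale]
    ring
  simp only [Matrix.mulVec, dotProduct, Function.comp_apply, map_sum, hterm, Finset.sum_apply,
    Pi.smul_apply, smul_eq_mul, Matrix.map_apply, Finset.mul_sum]
  exact Finset.sum_comm

variable [DecidableEq n]

theorem exists_mulVec_rescale_eq_smul {R : Type*} [CommRing R] {a μ : R}
    {B : Matrix n n (PowerSeries R)} {y₀ : n → R}
    (hy₀ : (B.map PowerSeries.constantCoeff).mulVec y₀ = μ • y₀)
    (hμ : ∀ k : ℕ, k ≠ 0 →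
      IsUnit (Matrix.scalar n μ - a ^ k • B.map PowerSeries.constantCoeff).det) :
    ∃ y : n → PowerSeries R, (fun i => PowerSeries.constantCoeff (y i)) = y₀ ∧
      B.mulVec (PowerSeries.rescale a ∘ y) = PowerSeries.C μ • y := by
  obtain ⟨Y, hY⟩ := exists_strong_rec (α := n → R) fun k Y => if k = 0 then y₀ else
    (Matrix.scalar n μ - a ^ k • B.map PowerSeries.constantCoeff)⁻¹.mulVec
      (∑ j : Fin k, a ^ (j : ℕ) • (B.map (PowerSeries.coeff (k - j))).mulVec (Y j))
  have hY₀ : Y 0 = y₀ := hY 0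
  have hrec (k : ℕ) : ∑ j ∈ Finset.range (k + 1),
      a ^ j • (B.map (PowerSeries.coeff (k - j))).mulVec (Y j) = μ • Y k := by
    rw [Finset.sum_range_succ, Nat.sub_self, PowerSeries.coeff_zero_eq_constantCoeff]
    rcases eq_or_ne k 0 with rfl | hk
    · rw [Finset.range_zero, Finset.sum_empty, zero_add, pow_zero, one_smul, hY₀, hy₀]
    · have hsolve := congrArg (Matrix.scalar n μ -
        a ^ k • B.map PowerSeries.constantCoeff).mulVec (hY k)
      rw [if_neg hk, Matrix.mulVec_mulVec, Matrix.mul_nonsing_inv _ (hμ k hk), Matrix.one_mulVec,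
        Fin.sum_univ_eq_sum_range
          (fun j => a ^ j • (B.map (PowerSeries.coeff (k - j))).mulVec (Y j)), Matrix.sub_mulVec,
        Matrix.smul_mulVec, Matrix.scalar_apply, ← Matrix.smul_one_eq_diagonal, Matrix.smul_mulVec,
        Matrix.one_mulVec] at hsolve
      rw [← hsolve, sub_add_cancel]
  refine ⟨fun i => PowerSeries.mk fun k => Y k i, ?_, ?_⟩
  · ext i
    rw [← PowerSeries.coeff_zero_eq_constantCoeff_apply, PowerSeries.coeff_mk, hY₀]
  · ext i k
    have hk := congrFun (coeff_mulVec_rescale a B (fun i => PowerSeries.mk fun k => Y k i) k) i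
    simp only [PowerSeries.coeff_mk] at hk
    rw [hk, hrec, Pi.smul_apply, Pi.smul_apply, smul_eq_mul, smul_eq_mul, PowerSeries.coeff_C_mul,
      PowerSeries.coeff_mk]

theorem exists_isRoot_forall_not_isRoot_mul_inv_pow {k : Type*} [Field k] [IsAlgClosed k] {q : kˣ}
    (hroot : ¬ IsOfFinOrder q) {p : Polynomial k} (hp : p.degree ≠ 0) (hp0 : p.eval 0 ≠ 0) :
    ∃ μ : kˣ, p.IsRoot μ ∧ ∀ j : ℕ, j ≠ 0 → ¬ p.IsRoot (μ * (q⁻¹ ^ j : kˣ)) := by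
  obtain ⟨z, hz⟩ := IsAlgClosed.exists_root p hp
  have hz0 : z ≠ 0 := by
    rintro rfl
    exact hp0 hz
  have hinj : Function.Injective fun j : ℕ => z * (q⁻¹ ^ j : kˣ) := fun i j hij =>
    injective_pow_iff_not_isOfFinOrder.2 (isOfFinOrder_inv_iff.not.2 hroot)
      (Units.ext (mul_left_cancel₀ hz0 hij))
  have hp_ne : p ≠ 0 := by
    rintro rfl
    exact hp0 Polynomial.eval_zero
  have hfin : {j : ℕ | p.IsRoot (z * (q⁻¹ ^ j : kˣ))}.Finite :=
    (Polynomial.finite_setOfPred_isRoot hp_ne).preimage hinj.injOn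
  obtain ⟨i, hi, hmax⟩ := hfin.exists_maximal ⟨0, by simpa using hz⟩
  refine ⟨Units.mk0 z hz0 * q⁻¹ ^ i, by simpa using hi, fun j hj hij => ?_⟩
  have hij' : p.IsRoot (z * (q⁻¹ ^ (i + j) : kˣ)) := by
    rwa [pow_add, Units.val_mul, ← mul_assoc]
  have hle := hmax hij' (Nat.le_add_right i j)
  omega

theorem exists_eigenvector {k : Type*} [Field k] [IsAlgClosed k] {q : kˣ}
    (hroot : ¬ IsOfFinOrder q) [Nonempty n] {B : Matrix n n (PowerSeries k)} (hB : IsUnit B.det) :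
    ∃ (μ : kˣ) (y : n → PowerSeries k), (fun i => PowerSeries.constantCoeff (y i)) ≠ 0 ∧
      B.mulVec (PowerSeries.rescale (q : k) ∘ y) = PowerSeries.C (μ : k) • y := by
  set B₀ : Matrix n n k := B.map PowerSeries.constantCoeff
  have hB₀det : B₀.det ≠ 0 := by
    have hunit := PowerSeries.isUnit_iff_constantCoeff.1 hB
    rw [RingHom.map_det] at hunit
    exact hunit.ne_zero
  obtain ⟨μ, hμ, hmax⟩ := exists_isRoot_forall_not_isRoot_mul_inv_pow hroot (p := B₀.charpoly)
    (by rw [Matrix.charpoly_degree_eq_dim]; exact_mod_cast Fintype.card_ne_zero)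
    (by rw [Matrix.eval_charpoly, map_zero, zero_sub, Matrix.det_neg]
        exact mul_ne_zero (pow_ne_zero _ (neg_ne_zero.2 one_ne_zero)) hB₀det)
  rw [Polynomial.IsRoot, Matrix.eval_charpoly] at hμ
  obtain ⟨y₀, hy₀, hker⟩ := Matrix.exists_mulVec_eq_zero_iff.2 hμ
  have heig : B₀.mulVec y₀ = (μ : k) • y₀ := by
    rw [Matrix.sub_mulVec, Matrix.scalar_apply, ← Matrix.smul_one_eq_diagonal, Matrix.smul_mulVec,
      Matrix.one_mulVec, sub_eq_zero] at hker
    exact hker.symm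
  have hunit (j : ℕ) (hj : j ≠ 0) : IsUnit (Matrix.scalar n (μ : k) - (q : k) ^ j • B₀).det := by
    have hsmul : Matrix.scalar n (μ : k) - (q : k) ^ j • B₀ =
        (q : k) ^ j • (Matrix.scalar n (μ * (q⁻¹ ^ j : kˣ) : k) - B₀) := by
      rw [smul_sub, Matrix.scalar_apply, Matrix.scalar_apply, ← Matrix.diagonal_smul]
      congr 2
      ext
      simp [mul_left_comm]
    rw [hsmul, Matrix.det_smul, ← Matrix.eval_charpoly]
    exact (((q ^ j).isUnit).pow _).mul (isUnit_iff_ne_zero.2 (hmax j hj))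
  obtain ⟨y, hy, h⟩ := exists_mulVec_rescale_eq_smul heig hunit
  exact ⟨μ, y, hy ▸ hy₀, h⟩

end Eigenvector

section FirstColumn

theorem eq_fromBlocks_of_col_eq_single {R m n : Type*} [Zero R] [Unique m] [DecidableEq m]
    [DecidableEq n] {D : Matrix (m ⊕ n) (m ⊕ n) R} {c : R}
    (h : D.col (Sum.inl default) = Pi.single (Sum.inl default) c) :
    D = Matrix.fromBlocks (Matrix.diagonal fun _ => c) D.toBlocks₁₂ 0 D.toBlocks₂₂ := by
  conv_lhs => rw [← Matrix.fromBlocks_toBlocks D]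
  congr 1
  · ext i j
    rw [Unique.eq_default i, Unique.eq_default j, Matrix.diagonal_apply_eq]
    exact (congrFun h _).trans (Pi.single_eq_same _ _)
  · ext i j
    rw [Unique.eq_default j]
    exact (congrFun h _).trans (Pi.single_eq_of_ne Sum.inr_ne_inl _)

variable {R n : Type*} [CommRing R] [Fintype n] [DecidableEq n]

theorem exists_isUnit_det_col_eq {y : n → R} {i : n} (hi : IsUnit (y i)) (j : n) :
    ∃ P : Matrix n n R, IsUnit P.det ∧ P.col j = y := by
  refine ⟨((1 : Matrix n n R).updateCol i y).submatrix id (Equiv.swap i j), ?_, ?_⟩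
  · rw [Matrix.det_permute', ← Matrix.cramer_apply, Matrix.cramer_one]
    exact ((Units.isUnit _).map (Int.castRingHom R)).mul hi
  · ext l
    simp

theorem col_nonsing_inv_mul_mul {σ : R →+* R} {B P : Matrix n n R} (hP : IsUnit P.det) {j : n}
    {c : R} (h : B.mulVec (σ ∘ P.col j) = c • P.col j) :
    (P⁻¹ * (B * P.map σ)).col j = Pi.single j c := by
  have hcol : (P⁻¹ * (B * P.map σ)).col j = P⁻¹.mulVec (B.mulVec (σ ∘ P.col j)) := rfl
  rw [hcol, h, Matrix.mulVec_smul, ← Matrix.mulVec_single_one P, Matrix.mulVec_mulVec,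
    Matrix.nonsing_inv_mul _ hP, Matrix.one_mulVec, ← Pi.single_smul, smul_eq_mul, mul_one]

end FirstColumn

/-- Two systems `σ(Y) = B Y` and `σ(Y) = C Y` are equivalent if they are related by an invertible
change of unknowns. -/
def GaugeEquiv {F n : Type*} [Semiring F] [Fintype n] [DecidableEq n] (σ : F ≃+* F)
    (B C : Matrix n n F) : Prop :=
  ∃ T T' : Matrix n n F, T * T' = 1 ∧ B * T.map σ = T * C

namespace GaugeEquiv

variable {F m n : Type*} [Fintype m] [DecidableEq m] [Fintype n] [DecidableEq n]

section Semiring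

variable [Semiring F] {σ : F ≃+* F} {B C D : Matrix n n F}

theorem trans (h : GaugeEquiv σ B C) (h' : GaugeEquiv σ C D) : GaugeEquiv σ B D := by
  obtain ⟨T, T', hT, h⟩ := h
  obtain ⟨S, S', hS, h'⟩ := h'
  refine ⟨T * S, S' * T', ?_, ?_⟩
  · rw [mul_assoc, ← mul_assoc S, hS, one_mul, hT]
  · rw [Matrix.map_mul (f := σ), ← mul_assoc, h, mul_assoc, h', mul_assoc]

theorem submatrix (h : GaugeEquiv σ B C) (e : m ≃ n) :
    GaugeEquiv σ (B.submatrix e e) (C.submatrix e e) := by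
  obtain ⟨T, T', hT, h⟩ := h
  refine ⟨T.submatrix e e, T'.submatrix e e, ?_, ?_⟩
  · rw [Matrix.submatrix_mul_equiv, hT, Matrix.submatrix_one_equiv]
  · rw [Matrix.submatrix_mul_equiv, ← h, ← Matrix.submatrix_mul_equiv _ _ e e e]
    rfl

theorem exists_fromBlocks {B' C' : Matrix m m F} (h' : GaugeEquiv σ B' C')
    (h : GaugeEquiv σ B C) (u : Matrix m n F) : ∃ v : Matrix m n F,
      GaugeEquiv σ (Matrix.fromBlocks B' u 0 B) (Matrix.fromBlocks C' v 0 C) := by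
  obtain ⟨S, S', hS, h'⟩ := h'
  obtain ⟨T, T', hT, h⟩ := h
  refine ⟨S' * (u * T.map σ), Matrix.fromBlocks S 0 0 T, Matrix.fromBlocks S' 0 0 T', ?_, ?_⟩
  · simp [Matrix.fromBlocks_multiply, hS, hT]
  · rw [Matrix.fromBlocks_map, Matrix.fromBlocks_multiply, Matrix.fromBlocks_multiply,
      ← Matrix.mul_assoc S, hS]
    simp [h, h']

end Semiring

theorem fromBlocks_of_eq [Ring F] {σ : F ≃+* F} {B' : Matrix m m F} {B : Matrix n n F}
    {u v h : Matrix m n F} (huv : B' * h.map σ + u = v + h * B) :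
    GaugeEquiv σ (Matrix.fromBlocks B' u 0 B) (Matrix.fromBlocks B' v 0 B) := by
  refine ⟨Matrix.fromBlocks 1 h 0 1, Matrix.fromBlocks 1 (-h) 0 1, ?_, ?_⟩
  · simp [Matrix.fromBlocks_multiply]
  · simp [Matrix.fromBlocks_map, Matrix.fromBlocks_multiply, huv]

theorem map_toLaurent {q : ℂˣ} (B : Matrix n n (PowerSeries ℂ)) {P : Matrix n n (PowerSeries ℂ)}
    (hP : IsUnit P.det) : GaugeEquiv (sigmaHat q) (B.map toLaurent)
      ((P⁻¹ * (B * P.map (PowerSeries.rescale (q : ℂ)))).map toLaurent) := by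
  refine ⟨P.map toLaurent, P⁻¹.map toLaurent, ?_, ?_⟩
  · rw [← Matrix.map_mul, Matrix.mul_nonsing_inv _ hP, Matrix.map_one _ (map_zero _) (map_one _)]
  · rw [map_sigmaHat_map_toLaurent, ← Matrix.map_mul, ← Matrix.map_mul,
      Matrix.mul_nonsing_inv_cancel_left _ _ hP]

theorem diagonal_algebraMap (q : ℂˣ) (k : ℤ) (c : ℂ) : GaugeEquiv (sigmaHat q)
    (Matrix.diagonal fun _ : n => algebraMap ℂ (LaurentSeries ℂ) c)
    (Matrix.diagonal fun _ : n => algebraMap ℂ (LaurentSeries ℂ) ((q : ℂ) ^ k * c)) := by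
  refine ⟨Matrix.diagonal fun _ => HahnSeries.single k 1,
    Matrix.diagonal fun _ => HahnSeries.single (-k) 1, ?_, ?_⟩
  · simp [Matrix.diagonal_mul_diagonal]
  · rw [Matrix.diagonal_map (map_zero _), Matrix.diagonal_mul_diagonal,
      Matrix.diagonal_mul_diagonal]
    congr 1
    ext1 i
    rw [sigmaHat_single, map_mul]
    ring

end GaugeEquiv

section Reduction

variable {q : ℂˣ} {m n : Type*}

theorem exists_map_coeff_eq_mul [Fintype m] {l : Type*} (u : Matrix l m (LaurentSeries ℂ))
    (M : ℤ → Matrix m n ℂ) : ∃ h : Matrix l n (LaurentSeries ℂ),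
      ∀ k, h.map (fun f => f.coeff k) = u.map (fun f => f.coeff k) * M k := by
  refine ⟨Matrix.of fun i j => ∑ a, ⟨fun k => (u i a).coeff k * M k a j,
    (u i a).isPWO_support.mono fun k => left_ne_zero_of_mul⟩, fun k => ?_⟩
  ext i j
  simp [Matrix.mul_apply, HahnSeries.coeff_sum]

variable [Fintype m] [DecidableEq m] [Fintype n] [DecidableEq n]

theorem exists_gaugeEquiv_fromBlocks_constant {c : ℂ} {A : Matrix n n ℂ}
    (hA : ∀ k : ℤ, k ≠ 0 → IsUnit (A - Matrix.scalar n (c * (q : ℂ) ^ k)).det)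
    (u : Matrix m n (LaurentSeries ℂ)) : ∃ v : Matrix m n ℂ, GaugeEquiv (sigmaHat q)
      (Matrix.fromBlocks (Matrix.diagonal fun _ => algebraMap ℂ (LaurentSeries ℂ) c) u 0
        (A.map (algebraMap ℂ (LaurentSeries ℂ))))
      ((Matrix.fromBlocks (Matrix.diagonal fun _ => c) v 0 A).map
        (algebraMap ℂ (LaurentSeries ℂ))) := by
  obtain ⟨h, hh⟩ := exists_map_coeff_eq_mul u fun k => (A - Matrix.scalar n (c * (q : ℂ) ^ k))⁻¹
  set θ := (Matrix.diagonal fun _ => c : Matrix m m ℂ).map (algebraMap ℂ (LaurentSeries ℂ)) *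
    h.map (sigmaHat q) + u - h * A.map (algebraMap ℂ (LaurentSeries ℂ)) with hθ
  have hconst : θ = (θ.map fun f => f.coeff 0).map (algebraMap ℂ (LaurentSeries ℂ)) := by
    refine eq_map_algebraMap_of_map_coeff_eq_zero fun k hk => ?_
    have hσ : (h.map (sigmaHat q)).map (fun f => f.coeff k) =
        (q : ℂ) ^ k • h.map fun f => f.coeff k := rfl
    have hu : h.map (fun f => f.coeff k) * (A - Matrix.scalar n (c * (q : ℂ) ^ k)) =
        u.map fun f => f.coeff k := by
      rw [hh, Matrix.mul_assoc, Matrix.nonsing_inv_mul _ (hA k hk), Matrix.mul_one]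
    calc θ.map (fun f => f.coeff k)
        = (Matrix.diagonal fun _ => c : Matrix m m ℂ) * ((q : ℂ) ^ k • h.map fun f => f.coeff k) +
            u.map (fun f => f.coeff k) - h.map (fun f => f.coeff k) * A := by
          rw [← hσ, ← map_coeff_algebraMap_mul, ← map_coeff_mul_algebraMap]
          rfl
      _ = 0 := by
          rw [← hu, Matrix.mul_sub, Matrix.scalar_apply, ← Matrix.smul_one_eq_diagonal,
            ← Matrix.smul_one_eq_diagonal, Matrix.smul_mul, Matrix.one_mul, Matrix.mul_smul,
            Matrix.mul_one, smul_smul]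
          abel
  refine ⟨θ.map fun f => f.coeff 0, ?_⟩
  rw [Matrix.fromBlocks_map, ← hconst, Matrix.map_zero _ (map_zero _),
    ← Matrix.diagonal_map (f := algebraMap ℂ (LaurentSeries ℂ)) (map_zero _)]
  exact GaugeEquiv.fromBlocks_of_eq (h := h) (by rw [hθ, sub_add_cancel])

/-- The system `σ_q(Y) = B Y` is formally equivalent to a system with constant coefficients whose
eigenvalues are the chosen representatives of classes of `ℂ* / q^ℤ`. -/
def HasConstantForm (q : ℂˣ) (B : Matrix n n (LaurentSeries ℂ)) : Prop :=
  ∃ A : Matrix n n ℂ, GaugeEquiv (sigmaHat q) B (A.map (algebraMap ℂ (LaurentSeries ℂ))) ∧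
    ∀ z, A.charpoly.IsRoot z → ∃ c, z = rep q c

namespace HasConstantForm

theorem of_gaugeEquiv {B C : Matrix n n (LaurentSeries ℂ)} (hC : HasConstantForm q C)
    (h : GaugeEquiv (sigmaHat q) B C) : HasConstantForm q B := by
  obtain ⟨A, hA, hroots⟩ := hC
  exact ⟨A, h.trans hA, hroots⟩

theorem submatrix {B : Matrix n n (LaurentSeries ℂ)} (hB : HasConstantForm q B) (e : m ≃ n) :
    HasConstantForm q (B.submatrix e e) := by
  obtain ⟨A, hA, hroots⟩ := hB
  refine ⟨A.submatrix e e, hA.submatrix e, fun z hz => hroots z ?_⟩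
  rwa [← Matrix.charpoly_reindex e.symm A]

theorem of_isEmpty [IsEmpty n] (B : Matrix n n (LaurentSeries ℂ)) : HasConstantForm q B :=
  ⟨0, ⟨1, 1, mul_one 1, Subsingleton.elim _ _⟩, fun z hz => by
    rw [Matrix.charpoly_isEmpty, Polynomial.IsRoot, Polynomial.eval_one] at hz
    exact absurd hz one_ne_zero⟩

theorem fromBlocks (hroot : ¬ IsOfFinOrder q) {B : Matrix n n (LaurentSeries ℂ)}
    (hB : HasConstantForm q B) (μ : ℂˣ) (u : Matrix m n (LaurentSeries ℂ)) :
    HasConstantForm q (Matrix.fromBlocks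
      (Matrix.diagonal fun _ => algebraMap ℂ (LaurentSeries ℂ) μ) u 0 B) := by
  obtain ⟨A, hA, hroots⟩ := hB
  obtain ⟨k, hk⟩ := exists_rep_eq_zpow_mul q μ
  have hk' : (q : ℂ) ^ k * μ = rep q μ := by
    rw [hk, Units.val_mul, Units.val_zpow_eq_zpow_val]
  obtain ⟨v, hv⟩ := (GaugeEquiv.diagonal_algebraMap q k (μ : ℂ)).exists_fromBlocks hA u
  rw [hk'] at hv
  have hunit (j : ℤ) (hj : j ≠ 0) :
      IsUnit (A - Matrix.scalar n ((rep q μ : ℂ) * (q : ℂ) ^ j)).det := by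
    refine isUnit_iff_ne_zero.2 fun h0 => ?_
    obtain ⟨d, hd⟩ := hroots ((rep q μ : ℂ) * (q : ℂ) ^ j) <| by
      rw [Polynomial.IsRoot, Matrix.eval_charpoly, ← neg_sub, Matrix.det_neg, h0, mul_zero]
    rw [mul_comm] at hd
    exact zpow_mul_rep_ne_rep hroot hj _ _ hd
  obtain ⟨w, hw⟩ := exists_gaugeEquiv_fromBlocks_constant hunit v
  refine ⟨_, hv.trans hw, fun z hz => ?_⟩
  rw [Matrix.charpoly_fromBlocks_zero₂₁, Matrix.charpoly_diagonal, Polynomial.root_mul] at hz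
  rcases hz with hz | hz
  · obtain ⟨-, -, hz⟩ := (Polynomial.isRoot_prod _ _ _).1 hz
    exact ⟨_, Polynomial.root_X_sub_C.1 hz |>.symm⟩
  · exact hroots z hz

end HasConstantForm

theorem exists_gaugeEquiv_fromBlocks (hroot : ¬ IsOfFinOrder q) [Unique m]
    {B : Matrix (m ⊕ n) (m ⊕ n) (PowerSeries ℂ)} (hB : IsUnit B.det) :
    ∃ (μ : ℂˣ) (u : Matrix m n (PowerSeries ℂ)) (B' : Matrix n n (PowerSeries ℂ)),
      IsUnit B'.det ∧ GaugeEquiv (sigmaHat q) (B.map toLaurent) ((Matrix.fromBlocks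
        (Matrix.diagonal fun _ => PowerSeries.C (μ : ℂ)) u 0 B').map toLaurent) := by
  obtain ⟨μ, y, hy, h⟩ := exists_eigenvector hroot hB
  obtain ⟨i, hi⟩ := Function.ne_iff.1 hy
  obtain ⟨P, hP, rfl⟩ := exists_isUnit_det_col_eq
    (PowerSeries.isUnit_iff_constantCoeff.2 (isUnit_iff_ne_zero.2 hi)) (Sum.inl default)
  let D := P⁻¹ * (B * P.map (PowerSeries.rescale (q : ℂ)))
  have hblocks : D = _ := eq_fromBlocks_of_col_eq_single (col_nonsing_inv_mul_mul hP h)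
  have hdet : IsUnit D.det := by
    rw [Matrix.det_mul, Matrix.det_mul, ← RingHom.mapMatrix_apply, ← RingHom.map_det]
    exact (Matrix.isUnit_nonsing_inv_det _ hP).mul (hB.mul (hP.map _))
  refine ⟨μ, D.toBlocks₁₂, D.toBlocks₂₂, ?_, hblocks ▸ GaugeEquiv.map_toLaurent B hP⟩
  rw [hblocks, Matrix.det_fromBlocks_zero₂₁] at hdet
  exact isUnit_of_mul_isUnit_right hdet

theorem hasConstantForm_map_toLaurent (hroot : ¬ IsOfFinOrder q)
    {B : Matrix n n (PowerSeries ℂ)} (hB : IsUnit B.det) :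
    HasConstantForm q (B.map toLaurent) := by
  induction hN : Fintype.card n using Nat.strong_induction_on generalizing n with
  | _ N ih =>
    rcases isEmpty_or_nonempty n with _ | ⟨⟨i⟩⟩
    · exact .of_isEmpty _
    let e : {j // j = i} ⊕ {j // ¬ j = i} ≃ n := Equiv.sumCompl fun j => j = i
    obtain ⟨μ, u, B', hB', h⟩ := exists_gaugeEquiv_fromBlocks (q := q) hroot
      (B := B.submatrix e e) (by rwa [Matrix.det_submatrix_equiv_self])
    have hconst := ih _ (hN ▸ Fintype.card_subtype_lt (x := i) (by simp)) hB' rfl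
    have hblocks := (hconst.fromBlocks hroot μ (u.map toLaurent)).of_gaugeEquiv
      (B := (B.submatrix e e).map toLaurent) (by
        rw [Matrix.fromBlocks_map, Matrix.map_zero _ (map_zero _),
          Matrix.diagonal_map (map_zero _)] at h
        simpa only [toLaurent_C] using h)
    have hB' := hblocks.submatrix e.symm
    rwa [← Matrix.submatrix_map, Matrix.submatrix_submatrix, e.self_comp_symm,
      Matrix.submatrix_id_id] at hB'

end Reduction

/-! ## Lattices in modules that are pure of slope zero -/

section Slope

theorem exists_supporting_line {ι : Type*} [Finite ι] {s : Set ι} (x y : ι → ℝ) {b i : ι}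
    (hx : ∀ k ∈ s, k ≠ b → x b < x k) (hi : i ∈ s) (hib : i ≠ b) :
    ∃ μ, (∀ k ∈ s, y b + μ * (x k - x b) ≤ y k) ∧
      ∃ j ∈ s, j ≠ b ∧ y j = y b + μ * (x j - x b) := by
  obtain ⟨j, ⟨hj, hjb⟩, hmin⟩ := Set.exists_min_image {k | k ∈ s ∧ k ≠ b}
    (fun k => (y k - y b) / (x k - x b)) (Set.toFinite _) ⟨i, hi, hib⟩
  refine ⟨(y j - y b) / (x j - x b), fun k hk => ?_, j, hj, hjb, ?_⟩
  · rcases eq_or_ne k b with rfl | hkb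
    · simp only [sub_self, mul_zero, add_zero, le_refl]
    · exact le_sub_iff_add_le'.1
        ((le_div_iff₀ (sub_pos.2 (hx k hk hkb))).1 (hmin k ⟨hk, hkb⟩))
  · rw [div_mul_cancel₀ _ (sub_pos.2 (hx j hj hjb)).ne', add_sub_cancel]

namespace DiffOperator

variable {L : DiffOperator}

theorem le_of_mem_newtonPolygon {μ c : ℝ}
    (h : ∀ i, L.coeff i ≠ 0 → μ * (i : ℕ) + c ≤ ((L.coeff i : LaurentSeries ℂ).order : ℤ))
    {p : ℝ × ℝ} (hp : p ∈ L.newtonPolygon) : μ * p.1 + c ≤ p.2 := by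
  refine convexHull_min (t := {p : ℝ × ℝ | μ * p.1 + c ≤ p.2}) ?_ ?_ hp
  · rintro ⟨x, y⟩ ⟨i, hi, rfl, hy⟩
    exact (h i hi).trans hy
  · have := convex_halfSpace_ge
      (LinearMap.snd ℝ ℝ ℝ - μ • LinearMap.fst ℝ ℝ ℝ).isLinear c
    simpa [le_sub_iff_add_le'] using this

theorem isSlope_of_supporting_line {μ c : ℝ}
    (h : ∀ i, L.coeff i ≠ 0 → μ * (i : ℕ) + c ≤ ((L.coeff i : LaurentSeries ℂ).order : ℤ))
    {i j : Fin (L.ν + 1)} (hij : i ≠ j) (hi0 : L.coeff i ≠ 0) (hj0 : L.coeff j ≠ 0)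
    (hi : ((L.coeff i : LaurentSeries ℂ).order : ℤ) = μ * (i : ℕ) + c)
    (hj : ((L.coeff j : LaurentSeries ℂ).order : ℤ) = μ * (j : ℕ) + c) : L.IsSlope μ :=
  ⟨c, fun _ => le_of_mem_newtonPolygon h,
    ((i : ℕ), _), subset_convexHull ℝ _ ⟨i, hi0, rfl, le_rfl⟩,
    ((j : ℕ), _), subset_convexHull ℝ _ ⟨j, hj0, rfl, le_rfl⟩,
    fun e => hij (Fin.ext (Nat.cast_injective (congrArg Prod.fst e))), hi, hj⟩

theorem IsPure.order_le (hL : L.IsPure 0) {b : Fin (L.ν + 1)} (hb : L.coeff b ≠ 0) {ε : ℝ}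
    (hε : ∀ i : Fin (L.ν + 1), i ≠ b → ε * (b : ℕ) < ε * (i : ℕ))
    {i : Fin (L.ν + 1)} (hi : L.coeff i ≠ 0) :
    (L.coeff b : LaurentSeries ℂ).order ≤ (L.coeff i : LaurentSeries ℂ).order := by
  rcases eq_or_ne i b with rfl | hib
  · exact le_rfl
  obtain ⟨μ, hle, j, hj, hjb, hj_eq⟩ := exists_supporting_line (s := {i | L.coeff i ≠ 0})
    (fun i => ε * (i : ℕ)) (fun i => ((L.coeff i : LaurentSeries ℂ).order : ℤ))
    (fun k _ => hε k) hi hib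
  have hslope : L.IsSlope (μ * ε) :=
    isSlope_of_supporting_line
      (c := ((L.coeff b : LaurentSeries ℂ).order : ℤ) - μ * ε * (b : ℕ))
      (fun k hk => by linarith [hle k hk]) hjb hj hb (by linarith) (by ring)
  have h := hle i hi
  rw [← mul_sub, ← mul_assoc, hL _ hslope, zero_mul, add_zero] at h
  exact Int.cast_le.1 h

theorem IsPure.order_coeff_zero_le (hL : L.IsPure 0) (h0 : L.coeff 0 ≠ 0) {i : Fin (L.ν + 1)}
    (hi : L.coeff i ≠ 0) :
    (L.coeff 0 : LaurentSeries ℂ).order ≤ (L.coeff i : LaurentSeries ℂ).order :=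
  hL.order_le h0 (ε := 1) (fun j hj => by simpa [Fin.val_pos_iff] using Fin.pos_of_ne_zero hj) hi

theorem IsPure.order_coeff_last_le (hL : L.IsPure 0) {i : Fin (L.ν + 1)} (hi : L.coeff i ≠ 0) :
    (L.coeff (Fin.last _) : LaurentSeries ℂ).order ≤ (L.coeff i : LaurentSeries ℂ).order :=
  hL.order_le L.lead_ne_zero (ε := -1) (fun j hj => by simpa using Fin.val_lt_last hj) hi

end DiffOperator

end Slope

namespace DiffModule

variable {F : Type} [Field F] {σ : F ≃+* F} {M : DiffModule.{u} F σ} {ν : ℕ} {m : M.carrier}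

section Relation

variable {a : Fin (ν + 1) → F}

theorem sig_iterate_eq_sum (ha : a (Fin.last ν) ≠ 0) (h : ∑ i, a i • M.Sig^[i] m = 0) :
    M.Sig^[ν] m = ∑ k : Fin ν, -(a k.castSucc / a (Fin.last ν)) • M.Sig^[k] m := by
  rw [Fin.sum_univ_castSucc, Fin.val_last] at h
  rw [← inv_smul_smul₀ ha (M.Sig^[ν] m), eq_neg_of_add_eq_zero_right h, smul_neg,
    Finset.smul_sum, ← Finset.sum_neg_distrib]
  refine Finset.sum_congr rfl fun k _ => ?_
  rw [smul_smul, neg_smul, div_eq_inv_mul, Fin.val_castSucc]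

theorem sum_symm_smul_sig_iterate (h : ∑ i, a i • M.Sig^[i] m = 0) :
    σ.symm (a 0) • M.Sig.symm m + ∑ k : Fin ν, σ.symm (a k.succ) • M.Sig^[k] m = 0 := by
  have := congrArg M.Sig.symm h
  simpa only [Fin.sum_univ_succ, map_add, map_sum, map_zero, M.symm_smul, Fin.val_succ,
    Fin.val_zero, Function.iterate_zero, id, Function.iterate_succ_apply',
    AddEquiv.symm_apply_apply] using this

theorem sig_symm_eq_sum (ha : a 0 ≠ 0) (h : ∑ i, a i • M.Sig^[i] m = 0) :
    M.Sig.symm m = ∑ k : Fin ν, -σ.symm (a k.succ / a 0) • M.Sig^[k] m := by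
  have ha' : σ.symm (a 0) ≠ 0 := (map_ne_zero_iff _ σ.symm.injective).2 ha
  rw [← inv_smul_smul₀ ha' (M.Sig.symm m),
    eq_neg_of_add_eq_zero_left (sum_symm_smul_sig_iterate h), smul_neg, Finset.smul_sum,
    ← Finset.sum_neg_distrib]
  refine Finset.sum_congr rfl fun k _ => ?_
  rw [smul_smul, neg_smul, map_div₀, div_eq_inv_mul]

theorem coeff_zero_ne_zero_of_linearIndependent
    (hind : LinearIndependent F (fun i : Fin ν => M.Sig^[i] m)) (ha : a ≠ 0)
    (h : ∑ i, a i • M.Sig^[i] m = 0) : a 0 ≠ 0 := by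
  intro h0
  have hrel := sum_symm_smul_sig_iterate h
  rw [h0, map_zero, zero_smul, zero_add] at hrel
  have hsucc (k : Fin ν) : a k.succ = 0 :=
    (map_eq_zero_iff _ σ.symm.injective).1 (Fintype.linearIndependent_iff.1 hind _ hrel k)
  exact ha (funext (Fin.cases h0 hsucc))

end Relation

section CyclicBasis

variable {R : Subring F} {b : Module.Basis (Fin ν) F M.carrier} {a : Fin ν → F}

theorem repr_self_mem {n : Type*} (b : Module.Basis n F M.carrier) (i j : n) :
    b.repr (b j) i ∈ R := by
  classical
  rw [Module.Basis.repr_self, Finsupp.single_apply]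
  split_ifs
  exacts [one_mem _, zero_mem _]

theorem repr_sig_mem (hb : ∀ j, b j = M.Sig^[j] m) (ha : ∀ k, a k ∈ R)
    (h : M.Sig^[ν] m = ∑ k, a k • b k) (i j : Fin ν) : b.repr (M.Sig (b j)) i ∈ R := by
  rw [hb, ← Function.iterate_succ_apply' M.Sig]
  rcases Nat.lt_or_ge (j + 1 : ℕ) ν with hj | hj
  · exact hb ⟨j + 1, hj⟩ ▸ repr_self_mem b i _
  · rw [show (j : ℕ).succ = ν from le_antisymm j.2 hj, h, Module.Basis.repr_sum_self]
    exact ha i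

theorem repr_sig_symm_mem (hb : ∀ j, b j = M.Sig^[j] m) (ha : ∀ k, a k ∈ R)
    (h : M.Sig.symm m = ∑ k, a k • b k) (i j : Fin ν) : b.repr (M.Sig.symm (b j)) i ∈ R := by
  rw [hb]
  obtain ⟨_ | j, hj⟩ := j
  · rw [Function.iterate_zero, id, h, Module.Basis.repr_sum_self]
    exact ha i
  · rw [Function.iterate_succ_apply', AddEquiv.symm_apply_apply]
    exact hb ⟨j, Nat.lt_of_succ_lt hj⟩ ▸ repr_self_mem b i _

end CyclicBasis

theorem sigMatrix_mul_map_symm_eq_one {n : Type*} [Fintype n] [DecidableEq n]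
    (b : Module.Basis n F M.carrier) :
    sigMatrix b * (Matrix.of fun i j => b.repr (M.Sig.symm (b j)) i).map σ = 1 := by
  ext i j
  have := congrFun (repr_sig b (M.Sig.symm (b j))) i
  rw [AddEquiv.apply_symm_apply, Module.Basis.repr_self, Finsupp.single_eq_pi_single] at this
  exact this.symm.trans ((Pi.single_apply j 1 i).trans Matrix.one_apply.symm)

end DiffModule

/-- The ring of germs at `0` of holomorphic functions, inside the field of meromorphic germs. -/
def holoGerms : Subring meroGerms := toLaurent.range.comap meroGerms.subtype

theorem div_mem_holoGerms {f g : meroGerms} (hg : g ≠ 0)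
    (h : f ≠ 0 → (g : LaurentSeries ℂ).order ≤ (f : LaurentSeries ℂ).order) :
    f / g ∈ holoGerms := by
  rcases eq_or_ne f 0 with rfl | hf
  · rw [zero_div]
    exact zero_mem _
  have hmul : ((f / g : meroGerms) : LaurentSeries ℂ) * g = f := by
    rw [← Subfield.coe_mul, div_mul_cancel₀ _ hg]
  have hord := congrArg HahnSeries.order hmul
  rw [HahnSeries.order_mul (Subtype.coe_ne_coe.2 (div_ne_zero hf hg)) (Subtype.coe_ne_coe.2 hg)]
    at hord
  have hle := h hf
  obtain ⟨p, hp⟩ := exists_toLaurent_eq (f := ((f / g : meroGerms) : LaurentSeries ℂ))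
    fun n hn => HahnSeries.coeff_eq_zero_of_lt_order (by omega)
  exact ⟨p, hp⟩

theorem sigma_symm_mem_holoGerms {q : ℂˣ} {f : meroGerms} (hf : f ∈ holoGerms) :
    (sigma q).symm f ∈ holoGerms := by
  obtain ⟨p, hp⟩ := hf
  refine ⟨PowerSeries.rescale ((q⁻¹ : ℂˣ) : ℂ) p, ?_⟩
  rw [← sigmaHat_toLaurent, hp]
  rfl

theorem exists_powerSeries_sigMatrix {q : ℂˣ} {n : Type*} [Fintype n] [DecidableEq n]
    {M : Bq.{u} q} (b : Module.Basis n meroGerms M.carrier)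
    (h : ∀ i j, b.repr (M.Sig (b j)) i ∈ holoGerms)
    (h' : ∀ i j, b.repr (M.Sig.symm (b j)) i ∈ holoGerms) :
    ∃ P : Matrix n n (PowerSeries ℂ), IsUnit P.det ∧
      (DiffModule.sigMatrix b).map meroGerms.subtype = P.map toLaurent := by
  choose P hP using h
  choose P' hP' using h'
  have hP_map : (DiffModule.sigMatrix b).map meroGerms.subtype = (Matrix.of P).map toLaurent := by
    ext1 i j
    exact (hP i j).symm
  have hP'_map : ((Matrix.of P').map (PowerSeries.rescale (q : ℂ))).map toLaurent =
      ((Matrix.of fun i j => b.repr (M.Sig.symm (b j)) i).map (sigma q)).map meroGerms.subtype := by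
    rw [← map_sigmaHat_map_toLaurent]
    ext1 i j
    exact congrArg (sigmaHat q) (hP' i j)
  refine ⟨Matrix.of P, Matrix.isUnit_det_of_right_inverse
    (B := (Matrix.of P').map (PowerSeries.rescale (q : ℂ)))
    (Matrix.map_injective (HahnSeries.ofPowerSeries_injective (Γ := ℤ) (R := ℂ)) ?_), hP_map⟩
  change (_ * _ : Matrix n n _).map toLaurent = (1 : Matrix n n _).map toLaurent
  rw [Matrix.map_mul, ← hP_map, hP'_map, ← Matrix.map_mul,
    DiffModule.sigMatrix_mul_map_symm_eq_one, Matrix.map_one _ (map_zero _) (map_one _),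
    Matrix.map_one _ (map_zero _) (map_one _)]

theorem exists_basis_sigMatrix_map_eq {q : ℂˣ} {M : Bq.{u} q} (hM : IsPureOfSlope q 0 M) :
    ∃ (ν : ℕ) (b : Module.Basis (Fin ν) meroGerms M.carrier)
      (P : Matrix (Fin ν) (Fin ν) (PowerSeries ℂ)), IsUnit P.det ∧
      (DiffModule.sigMatrix b).map meroGerms.subtype = P.map toLaurent := by
  obtain ⟨L, ⟨m, hind, hspan, hL⟩, hpure⟩ := hM
  have h0 : L.coeff 0 ≠ 0 := DiffModule.coeff_zero_ne_zero_of_linearIndependent hind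
    (fun h => L.lead_ne_zero (congrFun h _)) hL
  let b := Module.Basis.mk hind hspan.ge
  have hb (j : Fin L.ν) : b j = M.Sig^[j] m := Module.Basis.mk_apply hind hspan.ge j
  have hsig := DiffModule.sig_iterate_eq_sum L.lead_ne_zero hL
  have hsig_symm := DiffModule.sig_symm_eq_sum h0 hL
  simp only [← hb] at hsig hsig_symm
  exact ⟨L.ν, b, exists_powerSeries_sigMatrix b
    (DiffModule.repr_sig_mem hb
      (fun k => neg_mem (div_mem_holoGerms L.lead_ne_zero hpure.order_coeff_last_le)) hsig)
    (DiffModule.repr_sig_symm_mem hb (fun k => neg_mem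
      (sigma_symm_mem_holoGerms (div_mem_holoGerms h0 (hpure.order_coeff_zero_le h0)))) hsig_symm)⟩

/-! ## The essential image of the functor -/

section EssentialImage

variable {q : ℂˣ}

theorem InIso.of_formalization_iso {M N : Bq.{u} q} (hM : InIso q M)
    (f : formalization N ≅ formalization M) : InIso q N := fun L ⟨g⟩ => by
  obtain ⟨h⟩ := hM L ⟨g ≪≫ f⟩
  obtain ⟨k⟩ := hM N ⟨f⟩
  exact ⟨h ≪≫ k.symm⟩

theorem exists_grNil_basis_toMatrix_twist_eq {n : Type} [Fintype n] [DecidableEq n]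
    (A : Matrix n n ℂ) (hA : ∀ z, A.charpoly.IsRoot z → ∃ c, z = rep q c) :
    ∃ (V : GrNil.{u} q) (v : Module.Basis n ℂ V.carrier), LinearMap.toMatrix v v V.twist = A := by
  let v : Module.Basis n ℂ (ULift.{u} n → ℂ) :=
    (Pi.basisFun ℂ (ULift.{u} n)).reindex Equiv.ulift
  let A' : Module.End ℂ (ULift.{u} n → ℂ) := Matrix.toLin v v A
  have hA' (z : ℂ) (hz : A'.HasEigenvalue z) : ∃ c, z = rep q c :=
    hA z (by rwa [Module.End.hasEigenvalue_iff_isRoot_charpoly, ← LinearMap.charpoly_toMatrix _ v,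
      LinearMap.toMatrix_toLin] at hz)
  exact ⟨GrNil.ofEnd hA', v, (congrArg (LinearMap.toMatrix v v) (GrNil.twist_ofEnd hA')).trans
    (LinearMap.toMatrix_toLin v v A)⟩

theorem IsPureOfSlope.exists_formalization_iso (hroot : ¬ IsOfFinOrder q) {M : Bq.{u} q}
    (hM : IsPureOfSlope q 0 M) : ∃ V : GrNil.{u} q,
      Nonempty (formalization (analyticModule q V.twistEquiv) ≅ formalization M) := by
  obtain ⟨ν, b, P, hP, hbP⟩ := exists_basis_sigMatrix_map_eq hM
  obtain ⟨A, ⟨T, T', hT, hTA⟩, hA⟩ := hasConstantForm_map_toLaurent (q := q) hroot hP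
  obtain ⟨V, v, rfl⟩ := exists_grNil_basis_toMatrix_twist_eq.{u} A hA
  refine ⟨V, DiffModule.nonempty_iso_of_matrix
    (formalizationBasis (analyticBasis q V.twistEquiv v)) (formalizationBasis b) hT ?_⟩
  rw [sigMatrix_formalizationBasis, hbP, hTA, sigMatrix_formalizationBasis_analyticBasis]
  rfl

end EssentialImage

end QDifference

end

theorem mainTheorem2 (q : ℂˣ) (hq : ‖(q : ℂ)‖ = 1) (hroot : ∀ n : ℕ, 0 < n → q ^ n ≠ 1)
    (hconv : QDifference.Converges fun n => (QDifference.qPoch q q n)⁻¹) :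
    Nonempty (QDifference.BqIsoF.{u} q ≌ QDifference.GrNilD.{u} q) := by
  have hq_inf : ¬ IsOfFinOrder q := fun h => by
    obtain ⟨n, hn, hqn⟩ := isOfFinOrder_iff_pow_eq_one.1 h
    exact hroot n hn hqn
  let F : QDifference.GrNilD.{u} q ⥤ QDifference.BqIsoF.{u} q :=
    ObjectProperty.lift _ ((QDifference.ConditionD q).ι ⋙ QDifference.analyticFunctor q) fun V =>
      ⟨QDifference.inIso_of_conditionD hq hq_inf hconv V.property,
        QDifference.isPureOfSlope_zero_analyticModule hq_inf V.obj⟩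
  have := QDifference.analyticFunctor_full.{u} hq_inf
  have : F.EssSurj := ⟨fun M => by
    obtain ⟨V, ⟨f⟩⟩ := QDifference.IsPureOfSlope.exists_formalization_iso hq_inf M.property.2
    obtain ⟨e⟩ := M.property.1 _ ⟨f⟩
    have hV := QDifference.conditionD_of_inIso hq hq_inf hconv (M.property.1.of_formalization_iso f)
    exact ⟨⟨V, hV⟩, ⟨ObjectProperty.isoMk _ e⟩⟩⟩
  have : F.IsEquivalence := { }
  exact ⟨F.asEquivalence.symm⟩
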